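/- Let $d\in\{2,3\}$, let $\Omega\subset\mathbb R^d$ be a convex polygonal/polyhedral domain, $\Sigma\subset\partial\Omega$, $A\in\mathbb R^{d\times d}$ symmetric positive definite, $\mu\in\mathbb R$, $\gamma_T\ge 0$, $\gamma^*>0$. Let $\mathcal T$ be a conforming simplicial mesh of $\Omega$ with mesh size $h=\max_K\operatorname{diam}K$ whose boundary faces fit $\Sigma$ (that is, $\overline\Sigma$ is the union of the set $\mathcal F_\Sigma$ of faces lying on it), and which is shape regular and quasi-uniform with constant $\sigma$: each $K\in\mathcal T$ satisfies $h\le\sigma\operatorname{diam}K$ and contains a ball of some radius $r$ with $\operatorname{diam}K\le\sigma r$. Let $\mathcal F$ be the set of all faces, and let $(\cdot,\cdot)_\omega$, $\|\cdot\|_\omega$ denote the $L^2$ product and norm on $\omega$. Spaces: $X_h^k$ consists of the functions on $\Omega$ that are polynomials of degree $\le k$ on each cell, and $\pi_{X,k}$ is the $L^2(\Omega)$-projection onto it (componentwise for vector fields; $\pi_{X,-1}:=0$). $V_0^k=\{v\in H^1(\Omega)\cap X_h^k: v|_\Sigma=0\}$. $RT^l$ consists of the fields in $H_{div}(\Omega)$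 that on each cell have the form $a(x)+b(x)x$ with $a\in\mathbb P_l^d$ and $b$ a homogeneous polynomial of degree $l$. $D_0^l=\{q\in RT^l: q\cdot\nu=0\text{ on }\Sigma\}$ and $W^m=X_h^m$. For $F\in\mathcal F$ let $\pi_{F,l}$ be the $L^2(F)$-projection onto $\mathbb P_l(F)$ and let $[x]$ be the jump of $x$ across $F$ (the trace of $x$ if $F\subset\partial\Omega$). Put $$\|x\|_{1,h}^2=\sum_{K\in\mathcal T}\|\nabla x\|_K^2+\sum_{F\in\mathcal F\setminus\mathcal F_\Sigma}\|h^{-1/2}\pi_{F,l}[x]\|_F^2 .$$ Forms: $b(q,v,x)=(\nabla\cdot q+\mu v,x)_\Omega$ and $s[(u,p),(v,q)]=\tfrac12(A\nabla u-p,A\nabla v-q)_\Omega+t(u,v)$. For the full method, with $\nabla$ denoting the elementwise gradient in $s^*$, $$t(u,v)=\tfrac12\mu^2h^2((1-\pi_{X,m})u,(1-\pi_{X,m})v)_\Omega+\gamma_Th^{2k}(\nabla u,\nabla v)_\Omega,$$ $$s^*(z,x)=\tfrac12\gamma^*((1-\pi_{X,l-1})\nabla z,(1-\pi_{X,l-1})\nabla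 x)_\Omega,$$ $$\mathcal A[(u,p,z),(v,q,x)]=b(q,v,z)+b(p,u,x)-s^*(z,x)+s[(u,p),(v,q)].$$ For the reduced method, $t(u,v)=\tfrac12\gamma_Th^{2k}(\nabla u,\nabla v)_\Omega$ and $$\mathcal A_R[(u,p),(v,q)]=(\nabla\cdot p+\mu u,\nabla\cdot q+\mu v)_\Omega+s[(u,p),(v,q)].$$ With the respective $s$, let $|\!|\!|(v,q)|\!|\!|_{-\zeta}^2=s[(v,q),(v,q)]+\|h^\zeta(\nabla\cdot q+\mu v)\|_\Omega^2$, where $\zeta=1$ for the full and $\zeta=0$ for the reduced method. (i) Let $k\ge1$, $k-1\le l\le m\le k$ and $\sigma$ be given. There is $\gamma_0>0$, depending only on $d,k,l,m,\sigma$, such that for every $\gamma^*>0$ with $\gamma^*<\gamma_0$ in the case $l<m$ (no upper bound on $\gamma^*$ if $l=m$) there are constants $\alpha,C>0$, depending only on $d,k,l,m,\sigma,\gamma^*$ (in particular not on $h$), with the following property. For all $\Omega,\Sigma,A,\mu,\gamma_T,\mathcal T$ as above and all $(v_h,q_h,x_h)\in V_0^k\times D_0^l\times W^m$ there is $(w_h,y_h,r_h)\in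 V_0^k\times D_0^l\times W^m$ such that $$\alpha\big(|\!|\!|(v_h,q_h)|\!|\!|_{-1}^2+\|x_h\|_{1,h}^2\big)\le\mathcal A[(v_h,q_h,x_h),(w_h,y_h,r_h)]$$ and $$|\!|\!|(w_h,y_h)|\!|\!|_{-1}+\|r_h\|_{1,h}\le C\big(|\!|\!|(v_h,q_h)|\!|\!|_{-1}+\|x_h\|_{1,h}\big).$$ (ii) For every $k\ge1$, for all $\Omega,A,\mu,\gamma_T$ as above, for every conforming simplicial mesh of $\Omega$ with mesh size $h$, and for all $(v,q)\in H^1(\Omega)\times H_{div}(\Omega)$, $$|\!|\!|(v,q)|\!|\!|_0^2=\mathcal A_R[(v,q),(v,q)].$$ -/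

import Mathlib

open MeasureTheory Set Filter Topology
open scoped ContDiff InnerProductSpace

noncomputable section

namespace CauchyFEM

/-- Euclidean space `ℝ^d`. -/
abbrev E (d : ℕ) : Type := EuclideanSpace ℝ (Fin d)

/-! ### The domain, weak derivatives, `H¹(Ω)` and `H_div(Ω)` -/

/-- `Ω` is a (nonempty, open, bounded) convex polygonal / polyhedral domain. -/
def IsConvexPolytopeDomain {d : ℕ} (Ω : Set (E d)) : Prop :=
  Ω.Nonempty ∧ ∃ S : Finset (E d), Ω = interior (convexHull ℝ (S : Set (E d)))

/-- `φ ∈ C_c^∞(Ω)`. -/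
def IsTestFunction {d : ℕ} (Ω : Set (E d)) (φ : E d → ℝ) : Prop :=
  ContDiff ℝ ∞ φ ∧ HasCompactSupport φ ∧ tsupport φ ⊆ Ω

/-- `v ∈ L²(Ω)` has the weak gradient `g ∈ L²(Ω)^d`. -/
def HasWeakGrad {d : ℕ} (Ω : Set (E d)) (v : E d → ℝ) (g : E d → E d) : Prop :=
  MemLp v 2 (volume.restrict Ω) ∧ MemLp g 2 (volume.restrict Ω) ∧
    ∀ φ : E d → ℝ, IsTestFunction Ω φ → ∀ i : Fin d,
      ∫ y in Ω, v y * gradient φ y i = -∫ y in Ω, g y i * φ y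

/-- `q ∈ L²(Ω)^d` has the weak divergence `g ∈ L²(Ω)`. -/
def HasWeakDiv {d : ℕ} (Ω : Set (E d)) (q : E d → E d) (g : E d → ℝ) : Prop :=
  MemLp q 2 (volume.restrict Ω) ∧ MemLp g 2 (volume.restrict Ω) ∧
    ∀ φ : E d → ℝ, IsTestFunction Ω φ →
      ∫ y in Ω, ⟪q y, gradient φ y⟫_ℝ = -∫ y in Ω, g y * φ y

/-- The Sobolev space `H¹(Ω)`. -/
def MemH1 {d : ℕ} (Ω : Set (E d)) (v : E d → ℝ) : Prop := ∃ g, HasWeakGrad Ω v g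

/-- The space `H_div(Ω)` of square integrable fields with square integrable divergence. -/
def MemHdiv {d : ℕ} (Ω : Set (E d)) (q : E d → E d) : Prop := ∃ g, HasWeakDiv Ω q g

/-- The weak gradient of `v ∈ H¹(Ω)` (unique up to null sets). -/
def weakGrad {d : ℕ} (Ω : Set (E d)) (v : E d → ℝ) : E d → E d :=
  Classical.epsilon (HasWeakGrad Ω v)

/-- The weak divergence of `q ∈ H_div(Ω)` (unique up to null sets). -/
def weakDiv {d : ℕ} (Ω : Set (E d)) (q : E d → E d) : E d → ℝ :=
  Classical.epsilon (HasWeakDiv Ω q)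

/-- The `L²(ν)`-orthogonal projection of `f` onto a linear space `P` of functions:
a member `g` of `P` with `(g - f, w) = 0` for all `w ∈ P` (unique up to null sets). -/
def l2proj {d : ℕ} {G : Type} [NormedAddCommGroup G] [InnerProductSpace ℝ G]
    (ν : Measure (E d)) (P : Set (E d → G)) (f : E d → G) : E d → G :=
  Classical.epsilon fun g => g ∈ P ∧ ∀ w ∈ P, ∫ y, ⟪g y - f y, w y⟫_ℝ ∂ν = 0

/-! ### Simplicial meshes -/

/-- The closed simplex spanned by a finite set of vertices. -/
def hull {d : ℕ} (K : Finset (E d)) : Set (E d) := convexHull ℝ (K : Set (E d))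

/-- A conforming simplicial mesh of `Ω`. A cell is given by its `d + 1` affinely independent
vertices; two cells meet exactly in the simplex spanned by their common vertices. -/
structure SimplicialMesh {d : ℕ} (Ω : Set (E d)) where
  cells : Finset (Finset (E d))
  card_cell : ∀ K ∈ cells, K.card = d + 1
  indep : ∀ K ∈ cells, AffineIndependent ℝ (fun p : K => (p : E d))
  cover : ⋃ K ∈ cells, hull K = closure Ω
  conforming : ∀ K ∈ cells, ∀ L ∈ cells,
    hull K ∩ hull L = convexHull ℝ ((K : Set (E d)) ∩ (L : Set (E d)))

namespace SimplicialMesh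

variable {d : ℕ} {Ω : Set (E d)} (M : SimplicialMesh Ω)

/-- The mesh parameter `h`, the largest diameter of a cell. -/
def h : ℝ := sSup ((fun K => Metric.diam (hull K)) '' (M.cells : Set (Finset (E d))))

/-- Shape regularity and quasi-uniformity with constant `σ`: every cell `K` has
`h ≤ σ diam K` and contains a ball of radius `r` with `diam K ≤ σ r`. -/
def IsRegular (σ : ℝ) : Prop :=
  ∀ K ∈ M.cells, M.h ≤ σ * Metric.diam (hull K) ∧
    ∃ (c : E d) (r : ℝ), 0 < r ∧ Metric.ball c r ⊆ hull K ∧ Metric.diam (hull K) ≤ σ * r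

open Classical in
/-- The set `𝓕` of all faces of cells, a face being given by its `d` vertices. -/
def faces : Finset (Finset (E d)) := M.cells.biUnion fun K => K.powersetCard d

open Classical in
/-- The set `𝓕_Σ` of faces lying on `Σ`. -/
def facesOn (Sig : Set (E d)) : Finset (Finset (E d)) :=
  M.faces.filter fun F => hull F ⊆ closure Sig

/-- The mesh fits the boundary portion `Σ`: up to closure, `Σ` is a union of mesh faces. -/
def Fits (Sig : Set (E d)) : Prop :=
  ⋃ F ∈ M.facesOn Sig, hull F = closure Sig

end SimplicialMesh

/-- The `(d-1)`-dimensional surface measure on the face `F`. -/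
def faceMeasure {d : ℕ} (F : Finset (E d)) : Measure (E d) :=
  Measure.restrict (μHE[d - 1]) (hull F)

/-- A fixed unit normal `n_F` to the face `F`. -/
def unitNormal {d : ℕ} (F : Finset (E d)) : E d :=
  Classical.epsilon fun n => ‖n‖ = 1 ∧ ∀ p ∈ F, ∀ p' ∈ F, ⟪n, p - p'⟫_ℝ = 0

/-- The trace from inside the cell `K`: the limit of `f` at a point of `K` within the interior
of `K`. -/
def cellTrace {d : ℕ} {G : Type} [TopologicalSpace G] (K : Finset (E d)) (f : E d → G) :
    E d → G :=
  extendFrom (interior (hull K)) f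

open Classical in
/-- The jump of `u` over `F`: for an interior face the limit of `u (y - ε n_F) - u (y + ε n_F)` as
`ε → 0⁺`, and for a boundary face the trace of `u` from inside `Ω`. -/
def jump {d : ℕ} (Ω : Set (E d)) (u : E d → ℝ) (F : Finset (E d)) (y : E d) : ℝ :=
  if hull F ⊆ frontier Ω then extendFrom Ω u y
  else limUnder (𝓝[>] (0 : ℝ))
    fun ε => u (y - ε • unitNormal F) - u (y + ε • unitNormal F)

/-! ### Discrete spaces -/

/-- Polynomials of total degree at most `k`, as functions on `ℝ^d`. -/
def polyFun (d k : ℕ) : Set (E d → ℝ) :=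
  {f | ∃ p : MvPolynomial (Fin d) ℝ, p.totalDegree ≤ k ∧ ∀ y : E d, f y = MvPolynomial.eval y p}

/-- The projection `π_{F,l}` onto the polynomials of degree at most `l` on the face `F`. -/
def faceProj {d : ℕ} (l : ℕ) (F : Finset (E d)) (f : E d → ℝ) : E d → ℝ :=
  l2proj (faceMeasure F) (polyFun d l) f

namespace SimplicialMesh

variable {d : ℕ} {Ω : Set (E d)} (M : SimplicialMesh Ω)

/-- The space `X_h^k` of piecewise polynomials of degree at most `k`. The values on the skeleton,
a null set, are irrelevant. -/
def X (k : ℕ) : Set (E d → ℝ) :=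
  {x | ∀ K ∈ M.cells, ∃ f ∈ polyFun d k, EqOn x f (interior (hull K))}

/-- Vector fields with all components in `X_h^k`. -/
def XVec (k : ℕ) : Set (E d → E d) := {q | ∀ i, (fun y => q y i) ∈ M.X k}

/-- `π_{X,k}` on scalar functions. -/
def projX (k : ℕ) (f : E d → ℝ) : E d → ℝ := l2proj (volume.restrict Ω) (M.X k) f

/-- `π_{X,l-1}` on vector fields, with `π_{X,-1} = 0`. -/
def projVecPred : ℕ → (E d → E d) → (E d → E d)
  | 0, _ => 0
  | l + 1, f => l2proj (volume.restrict Ω) (M.XVec l) f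

/-- `L_h^k`, the `H¹`-conforming piecewise polynomials. -/
def L (k : ℕ) : Set (E d → ℝ) := {v | MemH1 Ω v ∧ v ∈ M.X k}

/-- `V_0^k`, the members of `L_h^k` that vanish on `Σ`. -/
def V0 (Sig : Set (E d)) (k : ℕ) : Set (E d → ℝ) :=
  {v | v ∈ M.L k ∧ ∀ F ∈ M.facesOn Sig, ∀ K ∈ M.cells, F ⊆ K →
    ∀ y ∈ hull F, cellTrace K v y = 0}

/-- The Raviart-Thomas space: fields in `H_div(Ω)` that on each cell have the form
`a(x) + b(x) x`, the components of `a` being polynomials of degree at most `l` and `b` being a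
homogeneous polynomial of degree `l`. -/
def RT (l : ℕ) : Set (E d → E d) :=
  {q | MemHdiv Ω q ∧ ∀ K ∈ M.cells,
    ∃ (a : Fin d → MvPolynomial (Fin d) ℝ) (b : MvPolynomial (Fin d) ℝ),
      (∀ i, (a i).totalDegree ≤ l) ∧ b.IsHomogeneous l ∧
      ∀ y ∈ interior (hull K), ∀ i,
        q y i = MvPolynomial.eval y (a i) + y i * MvPolynomial.eval y b}

/-- `D_0^l`, the members of `RT^l` with `q · ν = 0` on `Σ`. -/
def D0 (Sig : Set (E d)) (l : ℕ) : Set (E d → E d) :=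
  {q | q ∈ M.RT l ∧ ∀ F ∈ M.facesOn Sig, ∀ K ∈ M.cells, F ⊆ K →
    ∀ y ∈ hull F, ⟪cellTrace K q y, unitNormal F⟫_ℝ = 0}

/-- The broken norm `‖x‖_{1,h}`; `gradient x` is the classical gradient, taken in the interiors
of the cells. -/
def brokenH1Norm (Sig : Set (E d)) (l : ℕ) (x : E d → ℝ) : ℝ :=
  Real.sqrt ((∑ K ∈ M.cells, ∫ y in hull K, ‖gradient x y‖ ^ 2) +
    ∑ F ∈ M.faces \ M.facesOn Sig,
      ∫ y, (M.h ^ (-(1 / 2) : ℝ) * faceProj l F (jump Ω x F) y) ^ 2 ∂(faceMeasure F))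

/-! ### The forms -/

/-- Weakly consistent Tikhonov form `t` of the full method, with `W^m = X_h^m`. -/
def tFull (k m : ℕ) (μ γT : ℝ) (u v : E d → ℝ) : ℝ :=
  1 / 2 * μ ^ 2 * M.h ^ 2 * (∫ y in Ω, (u y - M.projX m u y) * (v y - M.projX m v y)) +
    γT * M.h ^ (2 * k) * ∫ y in Ω, ⟪weakGrad Ω u y, weakGrad Ω v y⟫_ℝ

/-- Tikhonov form `t` of the reduced method. -/
def tRed (k : ℕ) (γT : ℝ) (u v : E d → ℝ) : ℝ :=
  1 / 2 * γT * M.h ^ (2 * k) * ∫ y in Ω, ⟪weakGrad Ω u y, weakGrad Ω v y⟫_ℝ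

end SimplicialMesh

/-- The part `½ (A∇u - p, A∇v - q)_Ω` of the primal stabilizer. -/
def fluxStab {d : ℕ} (Ω : Set (E d)) (A : Matrix (Fin d) (Fin d) ℝ)
    (u : E d → ℝ) (p : E d → E d) (v : E d → ℝ) (q : E d → E d) : ℝ :=
  1 / 2 * ∫ y in Ω, ⟪Matrix.toEuclideanLin A (weakGrad Ω u y) - p y,
    Matrix.toEuclideanLin A (weakGrad Ω v y) - q y⟫_ℝ

/-- The conservation law `b(q,v,x) = (∇·q + μ v, x)_Ω`. -/
def bForm {d : ℕ} (Ω : Set (E d)) (μ : ℝ) (q : E d → E d) (v x : E d → ℝ) : ℝ :=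
  ∫ y in Ω, (weakDiv Ω q y + μ * v y) * x y

namespace SimplicialMesh

variable {d : ℕ} {Ω : Set (E d)} (M : SimplicialMesh Ω)

/-- Primal stabilizer `s[(u,p),(v,q)]` of the full method. -/
def sFull (k m : ℕ) (A : Matrix (Fin d) (Fin d) ℝ) (μ γT : ℝ)
    (u : E d → ℝ) (p : E d → E d) (v : E d → ℝ) (q : E d → E d) : ℝ :=
  fluxStab Ω A u p v q + M.tFull k m μ γT u v

/-- Primal stabilizer `s[(u,p),(v,q)]` of the reduced method. -/
def sRed (k : ℕ) (A : Matrix (Fin d) (Fin d) ℝ) (γT : ℝ)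
    (u : E d → ℝ) (p : E d → E d) (v : E d → ℝ) (q : E d → E d) : ℝ :=
  fluxStab Ω A u p v q + M.tRed k γT u v

/-- Dual stabilizer `s^*(z,x) = ½ γ^* ((1 - π_{X,l-1})∇z, (1 - π_{X,l-1})∇x)_Ω`. -/
def sStar (l : ℕ) (γs : ℝ) (z x : E d → ℝ) : ℝ :=
  γs * (1 / 2) * ∫ y in Ω, ⟪gradient z y - M.projVecPred l (gradient z) y,
    gradient x y - M.projVecPred l (gradient x) y⟫_ℝ

/-- The form `𝒜[(u,p,z),(v,q,x)]` of the full method. -/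
def formA (k l m : ℕ) (A : Matrix (Fin d) (Fin d) ℝ) (μ γT γs : ℝ)
    (u : E d → ℝ) (p : E d → E d) (z : E d → ℝ)
    (v : E d → ℝ) (q : E d → E d) (x : E d → ℝ) : ℝ :=
  bForm Ω μ q v z + bForm Ω μ p u x - M.sStar l γs z x + M.sFull k m A μ γT u p v q

/-- The form `𝒜_R[(u,p),(v,q)]` of the reduced method. -/
def formAR (k : ℕ) (A : Matrix (Fin d) (Fin d) ℝ) (μ γT : ℝ)
    (u : E d → ℝ) (p : E d → E d) (v : E d → ℝ) (q : E d → E d) : ℝ :=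
  (∫ y in Ω, (weakDiv Ω p y + μ * u y) * (weakDiv Ω q y + μ * v y)) + M.sRed k A γT u p v q

/-- The triple norm `⦀(v,q)⦀_{-ζ}` belonging to a primal stabilizer `s`. -/
def tripleNorm (s : (E d → ℝ) → (E d → E d) → (E d → ℝ) → (E d → E d) → ℝ) (μ : ℝ) (ζ : ℕ)
    (v : E d → ℝ) (q : E d → E d) : ℝ :=
  Real.sqrt (s v q v q + ∫ y in Ω, (M.h ^ ζ * (weakDiv Ω q y + μ * v y)) ^ 2)

end SimplicialMesh

end CauchyFEM

end

/-! Part (i) holds because suitable test functions can be written down. The primal function is kept,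
$w=v$, while the flux and the multiplier are perturbed: $y=q+\delta\eta$ and $r=-x+\varepsilon
h^2R$. Testing with $(v,q,-x)$ alone cancels the two $b$-terms and leaves $s[(v,q),(v,q)]+s^*(x,x)$.
Two quantities are still missing.

The first is $h^2\|\nabla\cdot q+\mu v\|^2$, supplied by $R=\nabla\cdot q+\mu\pi_{X,m}v$. This lies
in $W^m$ because $l\le m$, and it differs from the residual by $\mu(1-\pi_{X,m})v$, which $t$
controls (`exists_discrete_residual`). The cross term of $s^*$ with $R$ is tamed by the inverse
estimate `exists_brokenH1Norm_sq_le`.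

The second is $\|x\|_{1,h}^2$, supplied by a field $\eta\in D_0^l$ with
$(\nabla\cdot\eta,x)\ge\frac12\|x\|_{1,h}^2-C\|(1-\pi_{X,l-1})\nabla x\|^2$ and
$\|\eta\|^2+h^2\|\nabla\cdot\eta\|^2\lesssim\|x\|_{1,h}^2$ (`exists_test_field`). The negative term
is absorbed by $s^*(x,x)$ once $\delta$ is small compared with $\gamma^*$. Since $\delta$ and
$\varepsilon$ are chosen after $\gamma^*$, any positive $\gamma_0$ will do.

The field $\eta$ is explicit. On a cell it is $\sum_p c_p(y)(y-p)$ over the vertices $p$, with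
$c_p\in\mathbb P_l$. On the face opposite $p$ only $y-p$ has a normal component, and it is constant
there, so the normal trace is $c_p$ times a height. One part of $c_p$ extends $h^{-1}$ times the
projected jump from the face into the cell (`exists_face_lifting`). The other part is a multiple of
$h^{-2}\lambda_p\langle G,p\rangle$ with $G=\pi_{X,l-1}\nabla x$. It has no normal trace, and
because $\sum_p\lambda_p(y-p)=0$ its pairing with $G$ is a negative multiple of
$h^{-2}\sum_p\lambda_p\langle G,y-p\rangle^2$, a form that is coercive on shape regular cells
(`exists_vertex_form_ge`). The Gauss theorem on each cell (`gauss_simplex`) turns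
$(\nabla\cdot\eta,x)$ into jump terms minus $(\eta,\nabla x)$.

Inverse and trace estimates come from norm equivalence for polynomials on balls and scaling. A cell
lies between two concentric balls of radii comparable to $h$, so no reference simplex is needed.

Part (ii) is an identity of sums: for $\zeta=0$ the weight is $h^0=1$, and the radicand is
nonnegative. -/

namespace CauchyFEM

/-! ### Polynomial functions -/

/-- Evaluation of multivariate polynomials, as a linear map into functions on `ℝ^d`. -/
noncomputable def polyEval (d : ℕ) : MvPolynomial (Fin d) ℝ →ₗ[ℝ] (E d → ℝ) where
  toFun p := fun y => MvPolynomial.eval y p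
  map_add' p q := by ext y; simp
  map_smul' c p := by ext y; simp

/-- The polynomial functions of degree at most `k` as a linear subspace. -/
noncomputable def polySub (d k : ℕ) : Submodule ℝ (E d → ℝ) :=
  (MvPolynomial.restrictTotalDegree (Fin d) ℝ k).map (polyEval d)

instance (d k : ℕ) : Module.Finite ℝ (polySub d k) := by
  unfold polySub; infer_instance

theorem mem_polySub {d k : ℕ} {f : E d → ℝ} : f ∈ polySub d k ↔ f ∈ polyFun d k := by
  simp only [polySub, Submodule.mem_map, MvPolynomial.mem_restrictTotalDegree, polyFun, mem_ofPred_eq]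
  exact exists_congr fun p => and_congr_right fun _ =>
    ⟨fun h y => by rw [← h]; rfl, fun h => funext fun y => (h y).symm⟩

section polyFun

variable {d k l : ℕ} {f g : E d → ℝ}

theorem polyFun_mono (h : k ≤ l) (hf : f ∈ polyFun d k) : f ∈ polyFun d l := by
  obtain ⟨p, hp, e⟩ := hf
  exact ⟨p, hp.trans h, e⟩

theorem polyFun_zero : (fun _ => 0 : E d → ℝ) ∈ polyFun d k :=
  mem_polySub.1 (polySub d k).zero_mem

theorem polyFun_add (hf : f ∈ polyFun d k) (hg : g ∈ polyFun d k) :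
    (fun y => f y + g y) ∈ polyFun d k :=
  mem_polySub.1 ((polySub d k).add_mem (mem_polySub.2 hf) (mem_polySub.2 hg))

theorem polyFun_sub (hf : f ∈ polyFun d k) (hg : g ∈ polyFun d k) :
    (fun y => f y - g y) ∈ polyFun d k :=
  mem_polySub.1 ((polySub d k).sub_mem (mem_polySub.2 hf) (mem_polySub.2 hg))

theorem polyFun_const_mul (c : ℝ) (hf : f ∈ polyFun d k) : (fun y => c * f y) ∈ polyFun d k :=
  mem_polySub.1 ((polySub d k).smul_mem c (mem_polySub.2 hf))

theorem polyFun_sum {ι : Type*} {s : Finset ι} {F : ι → E d → ℝ}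
    (h : ∀ i ∈ s, F i ∈ polyFun d k) : (fun y => ∑ i ∈ s, F i y) ∈ polyFun d k := by
  have := (polySub d k).sum_mem (fun i hi => mem_polySub.2 (h i hi))
  rw [mem_polySub] at this
  convert this using 1
  ext y; simp

theorem polyFun_const (c : ℝ) : (fun _ => c : E d → ℝ) ∈ polyFun d k :=
  ⟨MvPolynomial.C c, by simp, by simp⟩

theorem polyFun_coord (i : Fin d) : (fun y : E d => y i) ∈ polyFun d 1 :=
  ⟨MvPolynomial.X i, by simp, by simp⟩

theorem polyFun_mul (hf : f ∈ polyFun d k) (hg : g ∈ polyFun d l) :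
    (fun y => f y * g y) ∈ polyFun d (k + l) := by
  obtain ⟨p, hp, e⟩ := hf
  obtain ⟨q, hq, e'⟩ := hg
  exact ⟨p * q, (MvPolynomial.totalDegree_mul p q).trans (add_le_add hp hq), by simp [e, e']⟩

theorem polyFun_pow (hf : f ∈ polyFun d 1) (n : ℕ) : (fun y => f y ^ n) ∈ polyFun d n := by
  induction n with
  | zero => simpa using polyFun_const 1
  | succ n ih => simpa [pow_succ] using polyFun_mul ih hf

theorem polyFun_prod {ι : Type*} (s : Finset ι) {F : ι → E d → ℝ} {n : ι → ℕ}
    (h : ∀ i ∈ s, F i ∈ polyFun d (n i)) :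
    (fun y => ∏ i ∈ s, F i y) ∈ polyFun d (∑ i ∈ s, n i) := by
  classical
  induction s using Finset.induction_on with
  | empty => simpa using polyFun_const 1
  | insert a s ha ih =>
    simp only [Finset.prod_insert ha, Finset.sum_insert ha]
    exact polyFun_mul (h a (by simp)) (ih fun i hi => h i (by simp [hi]))

theorem polyFun_comp {d' : ℕ} (hf : f ∈ polyFun d k) {T : E d' → E d}
    (hT : ∀ i, (fun z => T z i) ∈ polyFun d' 1) : (fun z => f (T z)) ∈ polyFun d' k := by
  obtain ⟨p, hp, e⟩ := hf
  simp only [e, MvPolynomial.eval_eq]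
  refine polyFun_sum fun s hs => polyFun_const_mul _ (polyFun_mono ?_
    (polyFun_prod s.support fun i _ => polyFun_pow (hT i) (s i)))
  exact (MvPolynomial.le_totalDegree hs).trans hp

theorem polyFun_inner_const (a : E d) : (fun y => ⟪a, y⟫_ℝ) ∈ polyFun d 1 := by
  simp only [PiLp.inner_apply, RCLike.inner_apply, conj_trivial]
  exact polyFun_sum fun i _ => by
    simpa [mul_comm] using polyFun_const_mul (a i) (polyFun_coord i)

theorem polyFun_affineMap (φ : E d →ᵃ[ℝ] ℝ) : (φ : E d → ℝ) ∈ polyFun d 1 := by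
  have h : (φ : E d → ℝ) = fun y =>
      ⟪(InnerProductSpace.toDual ℝ (E d)).symm (LinearMap.toContinuousLinearMap φ.linear), y⟫_ℝ
        + φ 0 := by
    ext y
    rw [InnerProductSpace.toDual_symm_apply]
    have := congrFun φ.decomp y
    simpa using this
  rw [h]
  exact polyFun_add (polyFun_inner_const _) (polyFun_const _)

theorem polyFun_affineMap_coord {d' : ℕ} (T : E d' →ᵃ[ℝ] E d) (i : Fin d) :
    (fun z => T z i) ∈ polyFun d' 1 :=
  polyFun_affineMap ((LinearMap.toAffineMap
    ((EuclideanSpace.proj i : E d →L[ℝ] ℝ) : E d →ₗ[ℝ] ℝ)).comp T)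

theorem contDiff_polyFun {n : WithTop ℕ∞} (hf : f ∈ polyFun d k) : ContDiff ℝ n f := by
  obtain ⟨p, hp, e⟩ := hf
  have : f = fun y : E d => MvPolynomial.eval y p := funext e
  simp only [this, MvPolynomial.eval_eq]
  fun_prop

theorem continuous_polyFun (hf : f ∈ polyFun d k) : Continuous f :=
  (contDiff_polyFun (n := 0) hf).continuous

theorem differentiable_polyFun (hf : f ∈ polyFun d k) : Differentiable ℝ f :=
  (contDiff_polyFun (n := 1) hf).differentiable (by simp)

theorem gradient_apply_eq (f : E d → ℝ) (x : E d) (i : Fin d) :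
    gradient f x i = fderiv ℝ f x (EuclideanSpace.single i 1) := by
  rw [← InnerProductSpace.toDual_symm_apply (𝕜 := ℝ), EuclideanSpace.inner_single_right]
  simp [gradient]

theorem fderiv_eval_eq_pderiv (p : MvPolynomial (Fin d) ℝ) (i : Fin d) (x : E d) :
    fderiv ℝ (fun y : E d => MvPolynomial.eval y p) x (EuclideanSpace.single i 1) =
      MvPolynomial.eval x (MvPolynomial.pderiv i p) := by
  have hd (q : MvPolynomial (Fin d) ℝ) : Differentiable ℝ fun y : E d => MvPolynomial.eval y q :=
    differentiable_polyFun (k := q.totalDegree) ⟨q, le_rfl, fun _ => rfl⟩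
  induction p using MvPolynomial.induction_on with
  | C a => simp
  | add p q hp hq =>
    simp only [map_add]
    rw [fderiv_fun_add (hd p x) (hd q x)]
    simp [hp, hq]
  | mul_X p j hp =>
    simp only [map_mul, MvPolynomial.eval_X, Derivation.leibniz, MvPolynomial.pderiv_X, map_add,
      smul_eq_mul]
    have hj : HasFDerivAt (fun y : E d => y j) (EuclideanSpace.proj j : E d →L[ℝ] ℝ) x :=
      (EuclideanSpace.proj j : E d →L[ℝ] ℝ).hasFDerivAt
    rw [fderiv_fun_mul (hd p x) hj.differentiableAt, hj.fderiv]
    simp [hp, Pi.single_apply, apply_ite, eq_comm]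

theorem totalDegree_pderiv_le (p : MvPolynomial (Fin d) ℝ) (i : Fin d) :
    (MvPolynomial.pderiv i p).totalDegree ≤ p.totalDegree - 1 := by
  conv_lhs => rw [p.as_sum, map_sum]
  refine MvPolynomial.totalDegree_finsetSum_le fun s hs => ?_
  rw [MvPolynomial.pderiv_monomial]
  by_cases h0 : s i = 0
  · simp [h0]
  · refine (MvPolynomial.totalDegree_monomial_le _ _).trans ?_
    have h1 : Finsupp.single i 1 ≤ s := by
      rw [Finsupp.single_le_iff]; omega
    have h2 : s.degree ≤ p.totalDegree := MvPolynomial.le_totalDegree hs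
    have h3 : s.degree = (s - Finsupp.single i 1).degree + 1 := by
      conv_lhs => rw [← tsub_add_cancel_of_le h1]
      simp
    change (s - Finsupp.single i 1).degree ≤ _
    omega

theorem polyFun_gradient (hf : f ∈ polyFun d k) (i : Fin d) :
    (fun y => gradient f y i) ∈ polyFun d (k - 1) := by
  obtain ⟨p, hp, e⟩ := hf
  refine ⟨MvPolynomial.pderiv i p, (totalDegree_pderiv_le p i).trans (by omega), fun y => ?_⟩
  change gradient f y i = _
  rw [gradient_apply_eq, show f = fun y : E d => MvPolynomial.eval y p from funext e,
    fderiv_eval_eq_pderiv]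

/-- A polynomial function vanishing on a nonempty open set vanishes identically. -/
theorem polyFun_eq_zero_of_open (hf : f ∈ polyFun d k) {U : Set (E d)} (hU : IsOpen U)
    (hne : U.Nonempty) (h : ∀ x ∈ U, f x = 0) : f = 0 := by
  obtain ⟨x, hx⟩ := hne
  have han : AnalyticOnNhd ℝ f univ := fun y _ =>
    (contDiff_polyFun (n := ω) hf).contDiffAt.analyticAt
  exact funext fun y => han.eqOn_zero_of_preconnected_of_eventuallyEq_zero isPreconnected_univ
    (mem_univ x) (Filter.eventually_of_mem (hU.mem_nhds hx) h) (mem_univ y)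

end polyFun

end CauchyFEM

namespace CauchyFEM

/-! ### Norm equivalence for polynomials on balls -/

/-- The source of all inverse estimates below: `S` factors through the inverse of `T` on its
finite-dimensional range, where every linear map is continuous. The summand 1 only makes the
constant positive. -/
theorem exists_norm_le_of_injective {V E₁ E₂ : Type*} [AddCommGroup V] [Module ℝ V]
    [Module.Finite ℝ V] [NormedAddCommGroup E₁] [NormedSpace ℝ E₁] [NormedAddCommGroup E₂]
    [NormedSpace ℝ E₂] (T : V →ₗ[ℝ] E₁) (hT : Function.Injective T) (S : V →ₗ[ℝ] E₂) :
    ∃ C : ℝ, 0 < C ∧ ∀ v, ‖S v‖ ≤ C * ‖T v‖ := by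
  let e := LinearEquiv.ofInjective T hT
  let L : LinearMap.range T →ₗ[ℝ] E₂ := S ∘ₗ e.symm.toLinearMap
  refine ⟨‖LinearMap.toContinuousLinearMap L‖ + 1, by positivity, fun v => ?_⟩
  have h1 : S v = LinearMap.toContinuousLinearMap L (e v) := by simp [L]
  have h2 : ‖e v‖ = ‖T v‖ := rfl
  rw [h1, ← h2]
  refine (ContinuousLinearMap.le_opNorm _ _).trans ?_
  gcongr
  simp

theorem memLp_restrict_of_continuous {X G : Type*} [TopologicalSpace X] [MeasurableSpace X]
    [OpensMeasurableSpace X] [SecondCountableTopology X] [NormedAddCommGroup G] {μ : Measure X}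
    [IsFiniteMeasureOnCompacts μ] {f : X → G} (hf : Continuous f) {K s : Set X} (hK : IsCompact K)
    (hs : s ⊆ K) (p : ENNReal) : MemLp f p (μ.restrict s) := by
  have : IsFiniteMeasure (μ.restrict s) :=
    ⟨by simpa using (measure_mono hs).trans_lt hK.measure_lt_top⟩
  obtain ⟨C, hC⟩ := hK.exists_bound_of_continuousOn hf.continuousOn
  have hb : ∀ᵐ x ∂μ.restrict K, ‖f x‖ ≤ C :=
    (ae_restrict_iff (isClosed_le hf.norm continuous_const).measurableSet).2
      (Filter.Eventually.of_forall hC)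
  exact MemLp.of_bound hf.aestronglyMeasurable C (ae_mono (Measure.restrict_mono hs le_rfl) hb)

theorem norm_toLp_sq {X G : Type*} [MeasurableSpace X] [NormedAddCommGroup G]
    [InnerProductSpace ℝ G] {μ : Measure X} {f : X → G} (hf : MemLp f 2 μ) :
    ‖hf.toLp f‖ ^ 2 = ∫ x, ‖f x‖ ^ 2 ∂μ := by
  rw [← real_inner_self_eq_norm_sq, L2.inner_def]
  refine integral_congr_ae ?_
  filter_upwards [hf.coeFn_toLp] with x hx
  rw [hx, real_inner_self_eq_norm_sq]

theorem memLp_polyFun {d N : ℕ} {p : E d → ℝ} (hp : p ∈ polyFun d N) (c : E d) (r : ℝ) :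
    MemLp p 2 (volume.restrict (Metric.ball c r)) :=
  memLp_restrict_of_continuous (continuous_polyFun hp) (isCompact_closedBall c r)
    Metric.ball_subset_closedBall 2

/-- Restriction of polynomial functions to a ball, with values in `L²`. -/
noncomputable def polyToLp (d N : ℕ) (r : ℝ) :
    polySub d N →ₗ[ℝ] Lp ℝ 2 (volume.restrict (Metric.ball (0 : E d) r)) where
  toFun p := (memLp_polyFun (mem_polySub.1 p.2) 0 r).toLp p
  map_add' _ _ := rfl
  map_smul' _ _ := rfl

/-- A continuous function that is zero almost everywhere on an open ball vanishes on it, and a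
polynomial vanishing on an open set vanishes identically. -/
theorem polyToLp_injective (d N : ℕ) {r : ℝ} (hr : 0 < r) :
    Function.Injective (polyToLp d N r) := by
  refine (injective_iff_map_eq_zero _).2 fun p hp => ?_
  have hp' := mem_polySub.1 p.2
  have h0 : (p : E d → ℝ) =ᵐ[volume.restrict (Metric.ball (0 : E d) r)] fun _ => 0 :=
    (MemLp.toLp_eq_toLp_iff (memLp_polyFun hp' 0 r) (memLp_polyFun (N := N) polyFun_zero 0 r)).1 hp
  have h1 := Measure.eqOn_open_of_ae_eq h0 Metric.isOpen_ball
    (continuous_polyFun hp').continuousOn continuousOn_const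
  exact Subtype.ext (polyFun_eq_zero_of_open hp' Metric.isOpen_ball (Metric.nonempty_ball.2 hr) h1)

/-- Restriction of polynomial functions to a closed ball, with values in the continuous
functions. -/
noncomputable def polyToCont (d N : ℕ) (R : ℝ) :
    polySub d N →ₗ[ℝ] C(Metric.closedBall (0 : E d) R, ℝ) where
  toFun p := ⟨fun x => p.1 x, (continuous_polyFun (mem_polySub.1 p.2)).comp continuous_subtype_val⟩
  map_add' _ _ := rfl
  map_smul' _ _ := rfl

/-- The maximum over one ball and the $L^2$ norm over another are compared on a single
finite-dimensional space, so extrapolating from radius `ρ` to a larger radius `R` costs only a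
constant. -/
theorem exists_sq_le_unit_ball (d N : ℕ) {ρ : ℝ} (R : ℝ) (hρ : 0 < ρ) :
    ∃ C : ℝ, 0 < C ∧ ∀ p ∈ polyFun d N, ∀ x ∈ Metric.closedBall (0 : E d) R,
      p x ^ 2 ≤ C * ∫ y in Metric.ball (0 : E d) ρ, p y ^ 2 := by
  obtain ⟨C, hC, h⟩ := exists_norm_le_of_injective _ (polyToLp_injective d N hρ) (polyToCont d N R)
  refine ⟨C ^ 2, by positivity, fun p hp x hx => ?_⟩
  have h1 := (ContinuousMap.norm_coe_le_norm (polyToCont d N R ⟨p, mem_polySub.2 hp⟩) ⟨x, hx⟩).trans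
    (h _)
  have h2 := norm_toLp_sq (memLp_polyFun hp 0 ρ)
  simp only [Real.norm_eq_abs, sq_abs] at h2
  rw [← h2, ← mul_pow, ← sq_abs]
  exact pow_le_pow_left₀ (abs_nonneg _) h1 2

theorem setIntegral_ball_comp {d : ℕ} (f : E d → ℝ) (c : E d) {h : ℝ} (hh : 0 < h) (ρ : ℝ) :
    ∫ ξ in Metric.ball (0 : E d) ρ, f (c + h • ξ) =
      (h ^ d)⁻¹ * ∫ y in Metric.ball c (ρ * h), f y := by
  rw [Measure.setIntegral_comp_smul_of_pos volume (fun y => f (c + y)) _ hh, finrank_euclideanSpace,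
    Fintype.card_fin, smul_ball hh.ne', smul_zero, Real.norm_of_nonneg hh.le, mul_comm h ρ,
    ← (measurePreserving_add_left volume c).setIntegral_preimage_emb
      (measurableEmbedding_addLeft c) f (Metric.ball c (ρ * h)), preimage_add_ball, sub_self,
    smul_eq_mul]

theorem polyFun_comp_smul {d N : ℕ} {p : E d → ℝ} (hp : p ∈ polyFun d N) (c : E d) (h : ℝ) :
    (fun ξ => p (c + h • ξ)) ∈ polyFun d N := by
  refine polyFun_comp hp fun i => ?_
  simpa using polyFun_add (polyFun_const (c i)) (polyFun_const_mul h (polyFun_coord i))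

/-- Inverse estimate: the maximum of a polynomial on a ball is bounded by its `L²`-mean on a
smaller ball. -/
theorem exists_sq_le_ball (d N : ℕ) {ρ : ℝ} (R : ℝ) (hρ : 0 < ρ) :
    ∃ C : ℝ, 0 < C ∧ ∀ p ∈ polyFun d N, ∀ (c : E d) (h : ℝ), 0 < h →
      ∀ x ∈ Metric.closedBall c (R * h),
      p x ^ 2 ≤ C * ((h ^ d)⁻¹ * ∫ y in Metric.ball c (ρ * h), p y ^ 2) := by
  obtain ⟨C, hC, H⟩ := exists_sq_le_unit_ball d N R hρ
  refine ⟨C, hC, fun p hp c h hh x hx => ?_⟩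
  have h1 := H _ (polyFun_comp_smul hp c h) (h⁻¹ • (x - c)) (by
    rw [mem_closedBall_zero_iff, norm_smul, norm_inv, Real.norm_of_nonneg hh.le, inv_mul_le_iff₀ hh,
      mul_comm h]
    rwa [Metric.mem_closedBall, dist_eq_norm] at hx)
  rw [setIntegral_ball_comp (fun y => p y ^ 2) c hh] at h1
  simpa [smul_smul, hh.ne'] using h1

/-- Inverse estimate for the gradient of a polynomial. -/
theorem exists_gradient_sq_le_ball (d N : ℕ) {ρ : ℝ} (R : ℝ) (hρ : 0 < ρ) :
    ∃ C : ℝ, 0 < C ∧ ∀ p ∈ polyFun d N, ∀ (c : E d) (h : ℝ), 0 < h →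
      ∀ x ∈ Metric.closedBall c (R * h), ‖gradient p x‖ ^ 2 ≤
        C * ((h ^ 2)⁻¹ * ((h ^ d)⁻¹ * ∫ y in Metric.ball c (ρ * h), p y ^ 2)) := by
  -- Partial differentiation is an endomorphism of the polynomial space, so following it by
  -- restriction still gives a linear map bounded by the $L^2$ norm.
  let D (i : Fin d) : polySub d N →ₗ[ℝ] polySub d N :=
    { toFun := fun p => ⟨fun y => gradient p.1 y i, mem_polySub.2
        (polyFun_mono (by omega) (polyFun_gradient (mem_polySub.1 p.2) i))⟩
      map_add' := fun p q => by
        ext y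
        have hp := differentiable_polyFun (mem_polySub.1 p.2) y
        have hq := differentiable_polyFun (mem_polySub.1 q.2) y
        simp [gradient_apply_eq, fderiv_add hp hq]
      map_smul' := fun a p => by
        ext y
        have hp := differentiable_polyFun (mem_polySub.1 p.2) y
        simp [gradient_apply_eq, fderiv_const_smul hp] }
  choose C hC H using fun i => exists_norm_le_of_injective _ (polyToLp_injective d N hρ)
    (polyToCont d N R ∘ₗ D i)
  refine ⟨∑ i, C i ^ 2 + 1, by positivity, fun p hp c h hh x hx => ?_⟩
  have hx' : h⁻¹ • (x - c) ∈ Metric.closedBall (0 : E d) R := by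
    rw [mem_closedBall_zero_iff, norm_smul, norm_inv, Real.norm_of_nonneg hh.le, inv_mul_le_iff₀ hh,
      mul_comm h]
    rwa [Metric.mem_closedBall, dist_eq_norm] at hx
  have hq := polyFun_comp_smul hp c h
  have h2 := norm_toLp_sq (memLp_polyFun hq 0 ρ)
  simp only [Real.norm_eq_abs, sq_abs] at h2
  rw [setIntegral_ball_comp (fun y => p y ^ 2) c hh] at h2
  have key (i : Fin d) : gradient p x i ^ 2 ≤
      C i ^ 2 * ((h ^ 2)⁻¹ * ((h ^ d)⁻¹ * ∫ y in Metric.ball c (ρ * h), p y ^ 2)) := by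
    have h1 := (ContinuousMap.norm_coe_le_norm
      ((polyToCont d N R ∘ₗ D i) ⟨_, mem_polySub.2 hq⟩) ⟨_, hx'⟩).trans (H i _)
    have h3 : (polyToCont d N R ∘ₗ D i) ⟨_, mem_polySub.2 hq⟩ ⟨_, hx'⟩ = h * gradient p x i := by
      change gradient (fun ξ => p (c + h • ξ)) (h⁻¹ • (x - c)) i = _
      have hT : HasFDerivAt (fun ξ : E d => c + h • ξ) (h • ContinuousLinearMap.id ℝ (E d))
          (h⁻¹ • (x - c)) := ((hasFDerivAt_id _).const_smul h).const_add c
      have he : c + h • h⁻¹ • (x - c) = x := by simp [smul_smul, hh.ne']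
      have hpx : HasFDerivAt p (fderiv ℝ p x) (c + h • h⁻¹ • (x - c)) := by
        rw [he]; exact (differentiable_polyFun hp x).hasFDerivAt
      have hcomp : HasFDerivAt (fun ξ : E d => p (c + h • ξ)) _ _ :=
        HasFDerivAt.comp (f := fun ξ : E d => c + h • ξ) _ hpx hT
      rw [gradient_apply_eq, gradient_apply_eq, hcomp.fderiv]
      simp
    rw [h3] at h1
    have h4 := pow_le_pow_left₀ (norm_nonneg _) h1 2
    rw [mul_pow, Real.norm_eq_abs, sq_abs, mul_pow] at h4
    have h5 : ‖polyToLp d N ρ ⟨_, mem_polySub.2 hq⟩‖ ^ 2 =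
      (h ^ d)⁻¹ * ∫ y in Metric.ball c (ρ * h), p y ^ 2 := h2
    rw [h5] at h4
    have h6 : gradient p x i ^ 2 = (h ^ 2)⁻¹ * (h ^ 2 * gradient p x i ^ 2) := by
      field_simp
    rw [h6]
    calc _ ≤ (h ^ 2)⁻¹ * _ := mul_le_mul_of_nonneg_left h4 (by positivity)
      _ = _ := by ring
  rw [EuclideanSpace.norm_sq_eq]
  simp only [Real.norm_eq_abs, sq_abs]
  refine (Finset.sum_le_sum fun i _ => key i).trans ?_
  rw [← Finset.sum_mul]
  refine mul_le_mul_of_nonneg_right (by linarith) ?_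
  have : 0 ≤ ∫ y in Metric.ball c (ρ * h), p y ^ 2 := integral_nonneg fun _ => sq_nonneg _
  positivity

end CauchyFEM

namespace CauchyFEM

/-! ### Simplices and barycentric coordinates -/

/-- `K` is the vertex set of a nondegenerate simplex. -/
def IsSimplex {d : ℕ} (K : Finset (E d)) : Prop :=
  K.card = d + 1 ∧ AffineIndependent ℝ (fun p : K => (p : E d))

theorem IsSimplex.affineSpan_eq_top {d : ℕ} {K : Finset (E d)} (hK : IsSimplex K) :
    affineSpan ℝ (range fun p : K => (p : E d)) = ⊤ := by
  rw [hK.2.affineSpan_eq_top_iff_card_eq_finrank_add_one]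
  simp [hK.1]

/-- The vertices of a simplex as an affine basis. -/
noncomputable def IsSimplex.basis {d : ℕ} {K : Finset (E d)} (hK : IsSimplex K) :
    AffineBasis K ℝ (E d) :=
  ⟨fun p : K => (p : E d), hK.2, hK.affineSpan_eq_top⟩

open Classical in
/-- The barycentric coordinate of the simplex `K` belonging to the vertex `p`. -/
noncomputable def bary {d : ℕ} (K : Finset (E d)) (p : E d) : E d →ᵃ[ℝ] ℝ :=
  if h : IsSimplex K ∧ p ∈ K then h.1.basis.coord ⟨p, h.2⟩ else 0

namespace IsSimplex

variable {d : ℕ} {K : Finset (E d)} (hK : IsSimplex K)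
include hK

theorem bary_eq {p : E d} (hp : p ∈ K) : bary K p = hK.basis.coord ⟨p, hp⟩ := by
  rw [bary, dif_pos ⟨hK, hp⟩]

theorem bary_self {p : E d} (hp : p ∈ K) : bary K p p = 1 := by
  rw [hK.bary_eq hp]
  exact hK.basis.coord_apply_eq ⟨p, hp⟩

theorem bary_of_ne {p q : E d} (hp : p ∈ K) (hq : q ∈ K) (h : p ≠ q) : bary K p q = 0 := by
  rw [hK.bary_eq hp]
  exact hK.basis.coord_apply_ne (i := ⟨p, hp⟩) (j := ⟨q, hq⟩) (by simpa using h)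

theorem sum_bary (x : E d) : ∑ p ∈ K, bary K p x = 1 := by
  rw [← Finset.sum_coe_sort, ← hK.basis.sum_coord_apply_eq_one x]
  exact Finset.sum_congr rfl fun p _ => by rw [hK.bary_eq p.2]

theorem sum_bary_smul (x : E d) : ∑ p ∈ K, bary K p x • p = x := by
  rw [← Finset.sum_coe_sort]
  conv_rhs => rw [← hK.basis.linear_combination_coord_eq_self x]
  exact Finset.sum_congr rfl fun p _ => by rw [hK.bary_eq p.2]; rfl

theorem sum_bary_smul_sub (x : E d) : ∑ p ∈ K, bary K p x • (x - p) = 0 := by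
  simp only [smul_sub, Finset.sum_sub_distrib, ← Finset.sum_smul, hK.sum_bary, hK.sum_bary_smul,
    one_smul, sub_self]

theorem hull_eq : hull K = {x | ∀ p ∈ K, 0 ≤ bary K p x} := by
  have h := hK.basis.convexHull_eq_nonneg_coord
  have h2 : range hK.basis = (K : Set (E d)) := by
    change range (fun p : K => (p : E d)) = _
    simp
  rw [h2] at h
  rw [hull, h]
  ext x
  simp only [mem_ofPred_eq, Subtype.forall]
  exact forall₂_congr fun p hp => by rw [hK.bary_eq hp]

theorem interior_hull_eq : interior (hull K) = {x | ∀ p ∈ K, 0 < bary K p x} := by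
  have h := hK.basis.interior_convexHull
  have h2 : range hK.basis = (K : Set (E d)) := by
    change range (fun p : K => (p : E d)) = _
    simp
  rw [h2] at h
  rw [hull, h]
  ext x
  simp only [mem_ofPred_eq, Subtype.forall]
  exact forall₂_congr fun p hp => by rw [hK.bary_eq hp]

omit hK in
theorem _root_.CauchyFEM.convex_hull (K : Finset (E d)) : Convex ℝ (hull K) := convex_convexHull ℝ _

omit hK in
theorem _root_.CauchyFEM.isCompact_hull (K : Finset (E d)) : IsCompact (hull K) :=
  K.finite_toSet.isCompact_convexHull (𝕜 := ℝ)

theorem interior_nonempty : (interior (hull K)).Nonempty := by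
  rw [hull, interior_convexHull_nonempty_iff_affineSpan_eq_top]
  simpa using hK.affineSpan_eq_top

theorem closure_interior_hull : closure (interior (hull K)) = hull K := by
  rw [(convex_hull K).closure_interior_eq_closure_of_nonempty_interior hK.interior_nonempty,
    (isCompact_hull K).isClosed.closure_eq]

omit hK in
theorem mem_hull {p : E d} (hp : p ∈ K) : p ∈ hull K := subset_convexHull ℝ _ hp

/-- Translates the conformity condition into coordinates: at a point common to two cells, the
coordinates of unshared vertices vanish. -/
theorem bary_eq_zero_of_mem_convexHull {S : Set (E d)} (hS : S ⊆ K) {p : E d} (hp : p ∈ K)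
    (hpS : p ∉ S) {x : E d} (hx : x ∈ convexHull ℝ S) : bary K p x = 0 := by
  have hc : Convex ℝ ((bary K p) ⁻¹' {0}) := (convex_singleton (0 : ℝ)).affine_preimage (bary K p)
  exact convexHull_min (fun q hq => hK.bary_of_ne hp (hS hq) (fun h => hpS (h ▸ hq))) hc hx

theorem mem_hull_erase [DecidableEq (E d)] {p : E d} (hp : p ∈ K) {x : E d} :
    x ∈ hull (K.erase p) ↔ x ∈ hull K ∧ bary K p x = 0 := by
  constructor
  · intro hx
    exact ⟨convexHull_mono (by simp) hx,
      hK.bary_eq_zero_of_mem_convexHull (by simp) hp (by simp) hx⟩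
  · rintro ⟨hx, h0⟩
    rw [hK.hull_eq] at hx
    rw [← hK.sum_bary_smul x, ← Finset.add_sum_erase K _ hp, h0, zero_smul, zero_add]
    refine (convex_hull _).sum_mem (fun q hq => hx q (Finset.mem_of_mem_erase hq)) ?_
      (fun q hq => subset_convexHull ℝ _ hq)
    rw [← hK.sum_bary x, ← Finset.add_sum_erase K _ hp, h0, zero_add]

omit hK in
/-- The linear part of a barycentric coordinate in the direction of an edge. -/
theorem _root_.CauchyFEM.bary_linear_sub (p q r : E d) :
    (bary K p).linear (q - r) = bary K p q - bary K p r := by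
  simpa using (bary K p).linearMap_vsub q r

end IsSimplex

/-! ### Normals of faces -/

section normal

variable {n : ℕ} {K : Finset (E (n + 1))} (hK : IsSimplex K) {p : E (n + 1)} (hp : p ∈ K)
include hK

theorem IsSimplex.nontrivial : K.Nontrivial := by
  rw [← Finset.one_lt_card_iff_nontrivial, hK.1]; omega

variable [DecidableEq (E (n + 1))]

theorem IsSimplex.erase_nonempty : (K.erase p).Nonempty :=
  hK.nontrivial.erase_nonempty

include hp

/-- The gradient of the barycentric coordinate of `p` is orthogonal to the opposite face, and
nonzero because that coordinate is 1 at `p` and 0 on the face. Normalised, it witnesses the choice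
made by `epsilon`. -/
theorem unitNormal_spec : ‖unitNormal (K.erase p)‖ = 1 ∧
    ∀ q ∈ K.erase p, ∀ q' ∈ K.erase p, ⟪unitNormal (K.erase p), q - q'⟫_ℝ = 0 := by
  let g := (InnerProductSpace.toDual ℝ (E (n + 1))).symm
    (LinearMap.toContinuousLinearMap (bary K p).linear)
  have hg (v : E (n + 1)) : ⟪g, v⟫_ℝ = (bary K p).linear v := by
    rw [InnerProductSpace.toDual_symm_apply]; rfl
  obtain ⟨q, hq⟩ := hK.erase_nonempty (p := p)
  have hg0 : g ≠ 0 := by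
    intro h
    have := hg (p - q)
    rw [h, inner_zero_left, bary_linear_sub, hK.bary_self hp,
      hK.bary_of_ne hp (Finset.mem_of_mem_erase hq) (Finset.ne_of_mem_erase hq).symm] at this
    norm_num at this
  refine Classical.epsilon_spec
    (p := fun ν => ‖ν‖ = 1 ∧ ∀ p' ∈ K.erase p, ∀ q' ∈ K.erase p, ⟪ν, p' - q'⟫_ℝ = 0)
    ⟨‖g‖⁻¹ • g, ?_, fun q hq q' hq' => ?_⟩
  · rw [norm_smul, norm_inv, norm_norm, inv_mul_cancel₀ (norm_ne_zero_iff.2 hg0)]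
  · rw [real_inner_smul_left, hg, bary_linear_sub,
      hK.bary_of_ne hp (Finset.mem_of_mem_erase hq) (Finset.ne_of_mem_erase hq).symm,
      hK.bary_of_ne hp (Finset.mem_of_mem_erase hq') (Finset.ne_of_mem_erase hq').symm]
    simp

/-- The distance to the hyperplane of a face is proportional to the barycentric coordinate of the
opposite vertex. -/
theorem inner_unitNormal_sub {f : E (n + 1)} (hf : f ∈ K.erase p) (x : E (n + 1)) :
    ⟪unitNormal (K.erase p), f - x⟫_ℝ = bary K p x * ⟪unitNormal (K.erase p), f - p⟫_ℝ := by
  have h : f - x = ∑ q ∈ K, bary K q x • (f - q) := by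
    simp only [smul_sub, Finset.sum_sub_distrib, ← Finset.sum_smul, hK.sum_bary, hK.sum_bary_smul,
      one_smul]
  rw [h, inner_sum, ← Finset.add_sum_erase K _ hp, real_inner_smul_right, add_eq_left]
  refine Finset.sum_eq_zero fun q hq => ?_
  rw [real_inner_smul_right, (unitNormal_spec hK hp).2 f hf q hq, mul_zero]

/-- If `p` lay in the hyperplane of the face, proportionality would put every point there, but `f`
minus the unit normal is at distance one. -/
theorem inner_unitNormal_ne_zero {f : E (n + 1)} (hf : f ∈ K.erase p) :
    ⟪unitNormal (K.erase p), f - p⟫_ℝ ≠ 0 := by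
  intro h
  have h1 := inner_unitNormal_sub hK hp hf (f - unitNormal (K.erase p))
  rw [h, mul_zero, sub_sub_cancel, real_inner_self_eq_norm_sq, (unitNormal_spec hK hp).1] at h1
  norm_num at h1

theorem inner_unitNormal_sub_vertex {f : E (n + 1)} (hf : f ∈ K.erase p) (x : E (n + 1)) :
    ⟪unitNormal (K.erase p), x - p⟫_ℝ = (1 - bary K p x) * ⟪unitNormal (K.erase p), f - p⟫_ℝ := by
  have h : x - p = (f - p) - (f - x) := by abel
  rw [h, inner_sub_right, inner_unitNormal_sub hK hp hf x]
  ring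

theorem bary_linear_eq {f : E (n + 1)} (hf : f ∈ K.erase p) (v : E (n + 1)) :
    (bary K p).linear v * ⟪unitNormal (K.erase p), f - p⟫_ℝ = -⟪unitNormal (K.erase p), v⟫_ℝ := by
  have h1 := inner_unitNormal_sub hK hp hf (f + v)
  have h2 : (bary K p).linear v = bary K p (f + v) - bary K p f := by
    simpa using bary_linear_sub p (f + v) f
  rw [h2, hK.bary_of_ne hp (Finset.mem_of_mem_erase hf) (Finset.ne_of_mem_erase hf).symm, sub_zero,
    ← h1, sub_add_cancel_left, inner_neg_right]

end normal

/-! ### Coordinates adapted to a hyperplane -/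

/-- The line along `ν` and its orthogonal complement are both parametrised isometrically, so the
product measure becomes Lebesgue measure without a Jacobian. -/
theorem exists_hyperplane_coords {n : ℕ} (ν : E (n + 1)) (hν : ‖ν‖ = 1) (f : E (n + 1)) :
    ∃ L : E n →ₗᵢ[ℝ] E (n + 1), (∀ z, ⟪ν, L z⟫_ℝ = 0) ∧ (∀ x, ⟪ν, x⟫_ℝ = 0 → ∃ z, L z = x) ∧
      MeasurePreserving (fun w : ℝ × E n => f + w.1 • ν + L w.2) (volume.prod volume) volume := by
  have hν0 : ν ≠ 0 := fun h => by simp [h] at hν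
  have : Fact (Module.finrank ℝ (E (n + 1)) = n + 1) := ⟨by simp⟩
  let b : OrthonormalBasis (Fin n) ℝ (ℝ ∙ ν)ᗮ := (stdOrthonormalBasis ℝ (ℝ ∙ ν)ᗮ).reindex
    (finCongr (Submodule.finrank_orthogonal_span_singleton hν0))
  let L : E n →ₗᵢ[ℝ] E (n + 1) := ((ℝ ∙ ν)ᗮ).subtypeₗᵢ.comp b.repr.symm.toLinearIsometry
  refine ⟨L, fun z => Submodule.mem_orthogonal_singleton_iff_inner_right.1 (b.repr.symm z).2,
    fun x hx => ⟨b.repr ⟨x, Submodule.mem_orthogonal_singleton_iff_inner_right.2 hx⟩, ?_⟩, ?_⟩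
  · simp [L]
  · have h1 := ((LinearIsometryEquiv.toSpanUnitSingleton ν hν).measurePreserving).prod
      b.repr.symm.measurePreserving
    have h2 := ((ℝ ∙ ν).measurePreserving_measurableEquivProd f).symm
    rw [finrank_euclideanSpace, Fintype.card_fin,
      EuclideanSpace.euclideanHausdorffMeasure_eq_volume] at h2
    have h3 : (fun w : ℝ × E n => f + w.1 • ν + L w.2) = ((ℝ ∙ ν).measurableEquivProd f).symm ∘
        Prod.map (LinearIsometryEquiv.toSpanUnitSingleton ν hν) b.repr.symm := by
      ext1 w
      simp [L, add_comm _ f, add_assoc]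
    rw [h3]
    exact h2.comp h1

/-- Lebesgue measure in oblique coordinates with respect to a hyperplane. -/
theorem volume_eq_smul_map_oblique {n : ℕ} {ν : E (n + 1)} {f : E (n + 1)} (hν : ‖ν‖ = 1)
    {L : E n →ₗᵢ[ℝ] E (n + 1)} (hL : ∀ x, ⟪ν, x⟫_ℝ = 0 → ∃ z, L z = x)
    (hm : MeasurePreserving (fun w : ℝ × E n => f + w.1 • ν + L w.2) (volume.prod volume) volume)
    {e : E (n + 1)} (he : ⟪ν, e⟫_ℝ ≠ 0) :
    (volume : Measure (E (n + 1))) = ENNReal.ofReal |⟪ν, e⟫_ℝ| •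
      Measure.map (fun w : ℝ × E n => f + w.1 • e + L w.2) (volume.prod volume) := by
  set a := ⟪ν, e⟫_ℝ with ha
  -- With $e=a\nu+Lv$ the oblique map is a shear, which preserves measure, followed by scaling of
  -- the first variable by $a$ and the orthogonal coordinates.
  obtain ⟨v, hv⟩ := hL (e - a • ν) (by
    rw [inner_sub_right, real_inner_smul_right, real_inner_self_eq_norm_sq, hν, ← ha]; ring)
  have h1 : MeasurePreserving (fun w : ℝ × E n => (w.1, w.2 + w.1 • v))
      ((volume : Measure ℝ).prod volume) (volume.prod volume) := by
    refine (MeasurePreserving.id volume).skew_product (g := fun t z => z + t • v) (by fun_prop)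
      (Filter.Eventually.of_forall fun t => ?_)
    exact (measurePreserving_add_right volume (t • v)).map_eq
  have h2 : Measure.map (Prod.map (fun t : ℝ => a * t) (id : E n → E n)) (volume.prod volume) =
      ENNReal.ofReal |a⁻¹| • (volume.prod volume) := by
    rw [← Measure.map_prod_map _ _ (by fun_prop) measurable_id, Real.map_volume_mul_left he,
      Measure.map_id, Measure.prod_smul_left]
  have h3 : (fun w : ℝ × E n => f + w.1 • e + L w.2) =
      (fun w : ℝ × E n => f + w.1 • ν + L w.2) ∘ (Prod.map (fun t : ℝ => a * t) id) ∘
        (fun w : ℝ × E n => (w.1, w.2 + w.1 • v)) := by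
    ext1 w
    simp only [Function.comp, Prod.map, id, map_add, map_smul, hv, smul_sub, smul_smul]
    rw [mul_comm a]
    abel
  have hmm : Measurable (Prod.map (fun t : ℝ => a * t) (id : E n → E n)) := by fun_prop
  rw [h3, ← Measure.map_map hm.measurable (hmm.comp h1.measurable),
    ← Measure.map_map hmm h1.measurable, h1.map_eq, h2, Measure.map_smul, hm.map_eq, smul_smul,
    ← ENNReal.ofReal_mul (abs_nonneg _), ← abs_mul, mul_inv_cancel₀ he]
  simp

/-- The surface measure on a hyperplane is the image of Lebesgue measure. -/
theorem restrict_euclideanHausdorffMeasure_eq_map {n : ℕ} {ν f : E (n + 1)}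
    {L : E n →ₗᵢ[ℝ] E (n + 1)} (hL : ∀ x, ⟪ν, x⟫_ℝ = 0 → ∃ z, L z = x) {s : Set (E (n + 1))}
    (hs : MeasurableSet s) (hsf : ∀ x ∈ s, ⟪ν, x - f⟫_ℝ = 0) :
    (μHE[n] : Measure (E (n + 1))).restrict s =
      Measure.map (fun z => f + L z) (volume.restrict ((fun z => f + L z) ⁻¹' s)) := by
  have hi : Isometry (fun z => f + L z) := (isometry_add_left f).comp L.isometry
  have h1 := hi.map_euclideanHausdorffMeasure (d := n)
  rw [EuclideanSpace.euclideanHausdorffMeasure_eq_volume] at h1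
  rw [← Measure.restrict_map hi.continuous.measurable hs, h1, Measure.restrict_restrict hs,
    inter_eq_left.2]
  intro x hx
  obtain ⟨z, hz⟩ := hL _ (hsf x hx)
  exact ⟨z, by simp [hz]⟩

end CauchyFEM

namespace CauchyFEM

/-! ### The Gauss theorem on a simplex -/

theorem bary_add_smul_sub {d : ℕ} (K : Finset (E d)) (r p q x : E d) (t : ℝ) :
    bary K r (x + t • (p - q)) = bary K r x + t * (bary K r p - bary K r q) := by
  have := (bary K r).map_vadd x (t • (p - q))
  rw [vadd_eq_add, vadd_eq_add, map_smul, bary_linear_sub, smul_eq_mul] at this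
  rw [add_comm, this, add_comm]

theorem continuous_bary {d : ℕ} (K : Finset (E d)) (p : E d) : Continuous (bary K p) :=
  (bary K p).continuous_of_finiteDimensional

/-- Coordinates on the hyperplane of the face opposite to `p`. -/
theorem exists_face_coords {n : ℕ} {K : Finset (E (n + 1))} (hK : IsSimplex K)
    [DecidableEq (E (n + 1))] {p : E (n + 1)} (hp : p ∈ K) {f : E (n + 1)} (hf : f ∈ K.erase p) :
    ∃ L : E n →ₗᵢ[ℝ] E (n + 1), (∀ z, ⟪unitNormal (K.erase p), L z⟫_ℝ = 0) ∧
      (∀ x, ⟪unitNormal (K.erase p), x⟫_ℝ = 0 → ∃ z, L z = x) ∧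
      (∀ z, bary K p (f + L z) = 0) ∧
      faceMeasure (K.erase p) = Measure.map (fun z => f + L z)
        (volume.restrict ((fun z => f + L z) ⁻¹' hull (K.erase p))) ∧
      ∀ e, ⟪unitNormal (K.erase p), e⟫_ℝ ≠ 0 →
        (volume : Measure (E (n + 1))) = ENNReal.ofReal |⟪unitNormal (K.erase p), e⟫_ℝ| •
          Measure.map (fun w : ℝ × E n => f + w.1 • e + L w.2) (volume.prod volume) := by
  obtain ⟨hν, -⟩ := unitNormal_spec hK hp
  obtain ⟨L, hL0, hL, hm⟩ := exists_hyperplane_coords _ hν f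
  refine ⟨L, hL0, hL, fun z => ?_, ?_, fun e he => volume_eq_smul_map_oblique hν hL hm he⟩
  · have h := inner_unitNormal_sub hK hp hf (f + L z)
    rw [sub_add_cancel_left, inner_neg_right, hL0, neg_zero] at h
    exact (mul_eq_zero.1 h.symm).resolve_right (inner_unitNormal_ne_zero hK hp hf)
  · refine restrict_euclideanHausdorffMeasure_eq_map hL
      (isCompact_hull _).isClosed.measurableSet fun x hx => ?_
    have := inner_unitNormal_sub hK hp hf x
    rw [((hK.mem_hull_erase hp).1 hx).2, zero_mul] at this
    rw [← neg_sub, inner_neg_right, this, neg_zero]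

section Gauss

variable {n : ℕ} {K : Finset (E (n + 1))} (hK : IsSimplex K) [DecidableEq (E (n + 1))]
  {p q : E (n + 1)} (hp : p ∈ K) (hq : q ∈ K) (hpq : p ≠ q)
include hK hp hq hpq

/-- Along the edge direction only two coordinates move: that of `p` rises by `t` and that of `q`
falls by `t`. The segment starting on the face opposite `p` therefore leaves through the face
opposite `q`. -/
theorem add_smul_edge_mem_hull {x : E (n + 1)} (hx : bary K p x = 0) (t : ℝ) :
    x + t • (p - q) ∈ hull K ↔ x ∈ hull (K.erase p) ∧ t ∈ Icc 0 (bary K q x) := by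
  have h1 : bary K p (x + t • (p - q)) = t := by
    rw [bary_add_smul_sub, hx, hK.bary_self hp, hK.bary_of_ne hp hq hpq]; ring
  have h2 : bary K q (x + t • (p - q)) = bary K q x - t := by
    rw [bary_add_smul_sub, hK.bary_self hq, hK.bary_of_ne hq hp hpq.symm]; ring
  have h3 (r) (hr : r ∈ K) (hrp : r ≠ p) (hrq : r ≠ q) :
      bary K r (x + t • (p - q)) = bary K r x := by
    rw [bary_add_smul_sub, hK.bary_of_ne hr hp hrp, hK.bary_of_ne hr hq hrq]; ring
  rw [hK.mem_hull_erase hp, and_iff_left hx, hK.hull_eq]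
  simp only [mem_ofPred_eq, mem_Icc]
  constructor
  · intro h
    have hp' := h p hp
    have hq' := h q hq
    rw [h1] at hp'
    rw [h2] at hq'
    refine ⟨fun r hr => ?_, hp', by linarith⟩
    by_cases hrp : r = p
    · rw [hrp, hx]
    by_cases hrq : r = q
    · rw [hrq]; linarith
    rw [← h3 r hr hrp hrq]
    exact h r hr
  · rintro ⟨h, ht0, ht1⟩ r hr
    by_cases hrp : r = p
    · rwa [hrp, h1]
    by_cases hrq : r = q
    · rw [hrq, h2]; linarith
    rw [h3 r hr hrp hrq]
    exact h r hr

theorem add_bary_smul_edge_mem {x : E (n + 1)} (hx : bary K p x = 0) :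
    x + bary K q x • (p - q) ∈ hull (K.erase q) ↔ x ∈ hull (K.erase p) := by
  rw [hK.mem_hull_erase hq, add_smul_edge_mem_hull hK hp hq hpq hx, and_assoc]
  refine and_iff_left_of_imp fun h => ⟨⟨?_, le_rfl⟩, ?_⟩
  · have := ((hK.mem_hull_erase hp).1 h).1
    rw [hK.hull_eq] at this
    exact this q hq
  · rw [bary_add_smul_sub, hK.bary_self hq, hK.bary_of_ne hq hp hpq.symm]; ring

theorem inner_unitNormal_edge_ne_zero : ⟪unitNormal (K.erase p), p - q⟫_ℝ ≠ 0 := by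
  rw [← neg_sub, inner_neg_right, neg_ne_zero]
  exact inner_unitNormal_ne_zero hK hp (Finset.mem_erase.2 ⟨hpq.symm, hq⟩)

/-- The cell is swept by segments parallel to the edge, based on the face opposite `p`. Fubini in
oblique coordinates gives the Jacobian factor, and the fundamental theorem of calculus is applied on
each segment. -/
theorem setIntegral_hull_edge {g : E (n + 1) → ℝ} (hg : ContDiff ℝ 1 g) :
    ∫ x in hull K, fderiv ℝ g x (p - q) = |⟪unitNormal (K.erase p), p - q⟫_ℝ| *
      ∫ x, (g (x + bary K q x • (p - q)) - g x) ∂faceMeasure (K.erase p) := by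
  have hqF : q ∈ K.erase p := Finset.mem_erase.2 ⟨hpq.symm, hq⟩
  have ha := inner_unitNormal_edge_ne_zero hK hp hq hpq
  obtain ⟨L, -, -, hb, hface, hvol⟩ := exists_face_coords hK hp hqF
  replace hvol := hvol _ ha
  set ν := unitNormal (K.erase p)
  have hmF := (isCompact_hull (K.erase p)).isClosed.measurableSet
  have hmK := (isCompact_hull K).isClosed.measurableSet
  have hcd : Continuous fun x => fderiv ℝ g x (p - q) :=
    (hg.continuous_fderiv (by simp)).clm_apply continuous_const
  have hcι : Continuous fun z => q + L z := by fun_prop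
  set Ψ : ℝ × E n → E (n + 1) := fun w => q + w.1 • (p - q) + L w.2 with hΨ
  have hΨm : Measurable Ψ := by fun_prop
  have hint : Integrable ((hull K).indicator fun x => fderiv ℝ g x (p - q)) volume :=
    (hcd.continuousOn.integrableOn_compact (isCompact_hull K)).integrable_indicator hmK
  rw [← integral_indicator hmK]
  have hint' := hint
  rw [hvol] at hint'
  have hint2 := (integrable_smul_measure (by simpa using ha) (by simp)).1 hint'
  have e1 : ∫ x, (hull K).indicator (fun x => fderiv ℝ g x (p - q)) x = |⟪ν, p - q⟫_ℝ| *
      ∫ x, (hull K).indicator (fun x => fderiv ℝ g x (p - q)) x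
        ∂(Measure.map Ψ (volume.prod volume)) := by
    conv_lhs => rw [hvol]
    rw [integral_smul_measure, ENNReal.toReal_ofReal (abs_nonneg _), smul_eq_mul]
  have hint3 : Integrable (fun w => (hull K).indicator (fun x => fderiv ℝ g x (p - q)) (Ψ w))
      (volume.prod volume) :=
    (integrable_map_measure hint2.aestronglyMeasurable hΨm.aemeasurable).1 hint2
  rw [e1, integral_map hΨm.aemeasurable hint2.aestronglyMeasurable,
    integral_prod_symm _ hint3, hface, integral_map hcι.measurable.aemeasurable]
  swap
  · exact Continuous.aestronglyMeasurable (by have := continuous_bary K q; fun_prop)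
  rw [← integral_indicator (hcι.measurable hmF)]
  congr 1
  refine integral_congr_ae (Filter.Eventually.of_forall fun z => ?_)
  have hΨz (t : ℝ) : Ψ (t, z) = (q + L z) + t • (p - q) := by simp only [hΨ]; abel
  simp only [hΨz]
  by_cases hz : q + L z ∈ hull (K.erase p)
  · have h0 : 0 ≤ bary K q (q + L z) := by
      have := ((hK.mem_hull_erase hp).1 hz).1
      rw [hK.hull_eq] at this
      exact this q hq
    have h1 : (fun t : ℝ => (hull K).indicator (fun x => fderiv ℝ g x (p - q))
        (q + L z + t • (p - q))) = (Icc 0 (bary K q (q + L z))).indicator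
          fun t => fderiv ℝ g (q + L z + t • (p - q)) (p - q) := by
      ext t
      simp only [indicator, add_smul_edge_mem_hull hK hp hq hpq (hb z), hz, true_and]
    rw [h1, integral_indicator measurableSet_Icc, integral_Icc_eq_integral_Ioc,
      ← intervalIntegral.integral_of_le h0, indicator_of_mem (by exact hz)]
    rw [intervalIntegral.integral_eq_sub_of_hasDerivAt
      (f := fun t => g (q + L z + t • (p - q)))]
    · simp
    · intro t _
      have hT : HasDerivAt (fun t : ℝ => q + L z + t • (p - q)) (p - q) t := by
        simpa using ((hasDerivAt_id t).smul_const (p - q)).const_add (q + L z)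
      exact ((hg.differentiable (by simp)) _).hasFDerivAt.comp_hasDerivAt t hT
    · exact (hcd.comp (by fun_prop)).intervalIntegrable _ _
  · rw [indicator_of_notMem (by exact hz)]
    refine integral_eq_zero_of_ae (Filter.Eventually.of_forall fun t => ?_)
    exact indicator_of_notMem
      (fun h => hz ((add_smul_edge_mem_hull hK hp hq hpq (hb z) t).1 h).1) _

/-- Sliding along an edge maps the surface measures of the two adjacent faces to each other. -/
theorem map_faceMeasure_edge :
    ENNReal.ofReal |⟪unitNormal (K.erase p), p - q⟫_ℝ| •
      Measure.map (fun x => x + bary K q x • (p - q)) (faceMeasure (K.erase p)) =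
    ENNReal.ofReal |⟪unitNormal (K.erase q), p - q⟫_ℝ| • faceMeasure (K.erase q) := by
  have hqF : q ∈ K.erase p := Finset.mem_erase.2 ⟨hpq.symm, hq⟩
  have hpF : p ∈ K.erase q := Finset.mem_erase.2 ⟨hpq, hp⟩
  have ha := inner_unitNormal_edge_ne_zero hK hp hq hpq
  have ha' : ⟪unitNormal (K.erase q), p - q⟫_ℝ ≠ 0 := inner_unitNormal_ne_zero hK hq hpF
  obtain ⟨L, -, -, hb, hface, hvol⟩ := exists_face_coords hK hp hqF
  obtain ⟨L', -, -, hb', hface', hvol'⟩ := exists_face_coords hK hq hpF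
  replace hvol := hvol _ ha
  replace hvol' := hvol' _ ha'
  have hcq := continuous_bary K q
  have hcp := continuous_bary K p
  have hmF' := (isCompact_hull (K.erase q)).isClosed.measurableSet
  have hmF := (isCompact_hull (K.erase p)).isClosed.measurableSet
  set P : E (n + 1) → E (n + 1) := fun x => x + bary K q x • (p - q) with hPdef
  have hP : Measurable P := by fun_prop
  have hbp (x : E (n + 1)) (t : ℝ) : bary K p (x + t • (p - q)) = bary K p x + t := by
    rw [bary_add_smul_sub, hK.bary_self hp, hK.bary_of_ne hp hq hpq]; ring
  have hbq (x : E (n + 1)) (t : ℝ) : bary K q (x + t • (p - q)) = bary K q x - t := by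
    rw [bary_add_smul_sub, hK.bary_self hq, hK.bary_of_ne hq hp hpq.symm]; ring
  have hPt (x : E (n + 1)) (t : ℝ) : P (x + t • (p - q)) = P x := by
    simp only [hPdef, hbq, sub_smul]; abel
  ext B hB
  -- An oblique cylinder over `B`. Its volume is computed with either face as base. The coordinate
  -- of `p` grows at unit rate along $p-q$, so in both computations every nonempty fibre has length
  -- one.
  let T : Set (E (n + 1)) := {x | bary K p x ∈ Icc (0 : ℝ) 1} ∩ P ⁻¹' (B ∩ hull (K.erase q))
  have hT : MeasurableSet T :=
    (hcp.measurable measurableSet_Icc).inter (hP (hB.inter hmF'))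
  have hι : Measurable fun z => q + L z := by fun_prop
  have hι' : Measurable fun z => p + L' z := by fun_prop
  have hΨ : Measurable fun w : ℝ × E n => q + w.1 • (p - q) + L w.2 := by fun_prop
  have hΨ' : Measurable fun w : ℝ × E n => p + w.1 • (p - q) + L' w.2 := by fun_prop
  have e1 : volume T = ENNReal.ofReal |⟪unitNormal (K.erase p), p - q⟫_ℝ| *
      faceMeasure (K.erase p) (P ⁻¹' B) := by
    rw [hvol, Measure.smul_apply, Measure.map_apply hΨ hT, smul_eq_mul, hface,
      Measure.map_apply hι (hP hB), Measure.restrict_apply (hι (hP hB))]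
    congr 1
    have : (fun w : ℝ × E n => q + w.1 • (p - q) + L w.2) ⁻¹' T =
        Icc 0 1 ×ˢ ((fun z => q + L z) ⁻¹' (P ⁻¹' B) ∩ (fun z => q + L z) ⁻¹' hull (K.erase p)) := by
      ext ⟨t, z⟩
      have h1 : q + t • (p - q) + L z = (q + L z) + t • (p - q) := by abel
      simp only [T, mem_preimage, mem_inter_iff, mem_ofPred_eq, mem_prod, h1, hbp, hPt, hb, zero_add]
      rw [← add_bary_smul_edge_mem hK hp hq hpq (hb z)]
    rw [this, Measure.prod_prod]
    simp
  have e2 : volume T = ENNReal.ofReal |⟪unitNormal (K.erase q), p - q⟫_ℝ| *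
      faceMeasure (K.erase q) B := by
    rw [hvol', Measure.smul_apply, Measure.map_apply hΨ' hT, smul_eq_mul, hface',
      Measure.map_apply hι' hB, Measure.restrict_apply (hι' hB),
      Measure.prod_apply_symm (hΨ' hT), ← lintegral_indicator_one ((hι' hB).inter (hι' hmF'))]
    congr 1
    refine lintegral_congr fun z => ?_
    have h1 (t : ℝ) : p + t • (p - q) + L' z = (p + L' z) + t • (p - q) := by abel
    have hPz : P (p + L' z) = p + L' z := by simp [hPdef, hb']
    by_cases hz : z ∈ (fun z => p + L' z) ⁻¹' B ∩ (fun z => p + L' z) ⁻¹' hull (K.erase q)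
    · rw [indicator_of_mem hz]
      have : (fun t : ℝ => (t, z)) ⁻¹' ((fun w : ℝ × E n => p + w.1 • (p - q) + L' w.2) ⁻¹' T) =
          Icc (-bary K p (p + L' z)) (1 - bary K p (p + L' z)) := by
        ext t
        simp only [mem_inter_iff, mem_preimage] at hz
        simp only [T, mem_preimage, mem_inter_iff, mem_ofPred_eq, h1, hbp, hPt, hPz, hz, and_true,
          mem_Icc]
        constructor <;> rintro ⟨h2, h3⟩ <;> constructor <;> linarith
      rw [this, Real.volume_Icc]
      simp
    · rw [indicator_of_notMem hz]
      have : (fun t : ℝ => (t, z)) ⁻¹' ((fun w : ℝ × E n => p + w.1 • (p - q) + L' w.2) ⁻¹' T) =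
          ∅ := by
        ext t
        simp only [mem_inter_iff, mem_preimage] at hz
        simp only [T, mem_preimage, mem_inter_iff, mem_ofPred_eq, h1, hbp, hPt, hPz, hz, and_false,
          mem_empty_iff_false]
      rw [this, measure_empty]
  rw [Measure.smul_apply, Measure.smul_apply, Measure.map_apply hP hB, smul_eq_mul, smul_eq_mul,
    ← e1, e2]

end Gauss

end CauchyFEM

namespace CauchyFEM

/-! ### Orientation of faces and the Gauss theorem -/

/-- A fixed vertex of the face `F`. -/
noncomputable def facePoint {d : ℕ} (F : Finset (E d)) : E d := Classical.epsilon (· ∈ F)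

/-- The signed distance from the vertices of the cell `K` opposite to `F` to the hyperplane
of `F`. -/
noncomputable def offset {d : ℕ} (K F : Finset (E d)) : ℝ :=
  ∑ p ∈ K, ⟪unitNormal F, facePoint F - p⟫_ℝ

/-- The sign `±1` for which `orient K F • unitNormal F` is the outward normal of `K` on `F`. -/
noncomputable def orient {d : ℕ} (K F : Finset (E d)) : ℝ := offset K F / |offset K F|

theorem facePoint_mem {d : ℕ} {F : Finset (E d)} (hF : F.Nonempty) : facePoint F ∈ F :=
  Classical.epsilon_spec hF

section

variable {n : ℕ} {K : Finset (E (n + 1))} (hK : IsSimplex K) [DecidableEq (E (n + 1))]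
  {p : E (n + 1)} (hp : p ∈ K)
include hK hp

/-- Every vertex of the face contributes zero to the defining sum, so only `p` survives. The sum
form lets the orientation be defined from cell and face without naming `p`. -/
theorem offset_erase {f : E (n + 1)} (hf : f ∈ K.erase p) :
    offset K (K.erase p) = ⟪unitNormal (K.erase p), f - p⟫_ℝ := by
  have hf' := facePoint_mem (hK.erase_nonempty (p := p))
  have h := unitNormal_spec hK hp
  rw [offset, ← Finset.add_sum_erase K _ hp, Finset.sum_eq_zero fun q hq => h.2 _ hf' q hq,
    add_zero, ← sub_eq_zero, ← inner_sub_right, sub_sub_sub_cancel_right]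
  exact h.2 _ hf' _ hf

theorem offset_ne_zero : offset K (K.erase p) ≠ 0 := by
  obtain ⟨f, hf⟩ := hK.erase_nonempty (p := p)
  rw [offset_erase hK hp hf]
  exact inner_unitNormal_ne_zero hK hp hf

theorem orient_sq : orient K (K.erase p) * orient K (K.erase p) = 1 := by
  have := offset_ne_zero hK hp
  rw [orient, div_mul_div_comm, ← abs_mul, abs_mul_self, div_self (mul_self_ne_zero.2 this)]

theorem orient_mul_offset : orient K (K.erase p) * offset K (K.erase p) =
    |offset K (K.erase p)| := by
  have := abs_ne_zero.2 (offset_ne_zero hK hp)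
  rw [orient, div_mul_eq_mul_div, ← abs_mul_abs_self, mul_div_assoc, div_self this, mul_one]

theorem inner_unitNormal_linear (v : E (n + 1)) :
    ⟪unitNormal (K.erase p), v⟫_ℝ = -(bary K p).linear v * offset K (K.erase p) := by
  obtain ⟨f, hf⟩ := hK.erase_nonempty (p := p)
  rw [offset_erase hK hp hf, neg_mul, bary_linear_eq hK hp hf, neg_neg]

theorem faceMeasure_univ_le {f : E (n + 1)} (hf : f ∈ K.erase p) {D : ℝ}
    (hD : hull (K.erase p) ⊆ Metric.closedBall f D) :
    faceMeasure (K.erase p) univ ≤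
      ENNReal.ofReal (D ^ n) * volume (Metric.ball (0 : E n) 1) := by
  obtain ⟨L, -, -, -, hface, -⟩ := exists_face_coords hK hp hf
  have hι : Measurable fun z => f + L z := by fun_prop
  have hf' := hD (IsSimplex.mem_hull hf)
  rw [Metric.mem_closedBall, dist_self] at hf'
  rw [hface, Measure.map_apply hι .univ, preimage_univ, Measure.restrict_apply_univ]
  calc _ ≤ volume (Metric.closedBall (0 : E n) D) := by
        refine measure_mono fun z hz => ?_
        have := hD hz
        simpa using this
    _ = _ := by rw [Measure.addHaar_closedBall _ _ hf']; simp

theorem isFiniteMeasure_faceMeasure : IsFiniteMeasure (faceMeasure (K.erase p)) := by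
  obtain ⟨f, hf⟩ := hK.erase_nonempty (p := p)
  obtain ⟨D, hD⟩ := (isCompact_hull (K.erase p)).isBounded.subset_closedBall f
  refine ⟨(faceMeasure_univ_le hK hp hf hD).trans_lt (ENNReal.mul_lt_top (by simp) ?_)⟩
  exact Metric.isBounded_ball.measure_lt_top

theorem memLp_faceMeasure {g : E (n + 1) → ℝ} (hg : Continuous g) (r : ENNReal) :
    MemLp g r (faceMeasure (K.erase p)) := by
  have := isFiniteMeasure_faceMeasure hK hp
  obtain ⟨C, hC⟩ := (isCompact_hull (K.erase p)).exists_bound_of_continuousOn hg.continuousOn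
  refine MemLp.of_bound hg.aestronglyMeasurable C ?_
  exact ae_restrict_of_forall_mem (isCompact_hull _).isClosed.measurableSet hC

theorem integrable_faceMeasure {g : E (n + 1) → ℝ} (hg : Continuous g) :
    Integrable g (faceMeasure (K.erase p)) :=
  memLp_one_iff_integrable.1 (memLp_faceMeasure hK hp hg 1)

end

/-- The edge direction is tangential to all faces except those opposite `p` and `q`. On these two,
`setIntegral_hull_edge` gives a difference of boundary values, and `map_faceMeasure_edge` transports
one of them to its own face. -/
theorem gauss_edge {n : ℕ} {K : Finset (E (n + 1))} (hK : IsSimplex K) [DecidableEq (E (n + 1))]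
    {g : E (n + 1) → ℝ} (hg : ContDiff ℝ 1 g) {p q : E (n + 1)} (hp : p ∈ K) (hq : q ∈ K)
    (hpq : p ≠ q) :
    ∫ x in hull K, fderiv ℝ g x (p - q) = ∑ r ∈ K, orient K (K.erase r) *
      ⟪unitNormal (K.erase r), p - q⟫_ℝ * ∫ x, g x ∂faceMeasure (K.erase r) := by
  have hqF : q ∈ K.erase p := Finset.mem_erase.2 ⟨hpq.symm, hq⟩
  have hpF : p ∈ K.erase q := Finset.mem_erase.2 ⟨hpq, hp⟩
  have hbq := continuous_bary K q
  have hgc := hg.continuous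
  rw [setIntegral_hull_edge hK hp hq hpq hg, integral_sub
    (integrable_faceMeasure hK hp (by fun_prop)) (integrable_faceMeasure hK hp hgc)]
  have hm := congrArg (fun m => ∫ x, g x ∂m) (map_faceMeasure_edge hK hp hq hpq)
  simp only [integral_smul_measure, ENNReal.toReal_ofReal (abs_nonneg _), smul_eq_mul] at hm
  rw [integral_map (by fun_prop) hgc.aestronglyMeasurable] at hm
  have h1 : ∀ r ∈ K, r ∉ ({p, q} : Finset (E (n + 1))) → orient K (K.erase r) *
      ⟪unitNormal (K.erase r), p - q⟫_ℝ * ∫ x, g x ∂faceMeasure (K.erase r) = 0 := by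
    intro r hr hr'
    simp only [Finset.mem_insert, Finset.mem_singleton, not_or] at hr'
    rw [(unitNormal_spec hK hr).2 p (Finset.mem_erase.2 ⟨fun h => hr'.1 h.symm, hp⟩) q
      (Finset.mem_erase.2 ⟨fun h => hr'.2 h.symm, hq⟩)]
    simp
  rw [← Finset.sum_subset (s₁ := {p, q}) (by simp [Finset.insert_subset_iff, hp, hq]) h1,
    Finset.sum_pair hpq]
  have h2 : orient K (K.erase p) * ⟪unitNormal (K.erase p), p - q⟫_ℝ =
      -|⟪unitNormal (K.erase p), p - q⟫_ℝ| := by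
    have h := offset_erase hK hp hqF
    rw [← neg_sub q p, inner_neg_right, ← h, mul_neg, orient_mul_offset hK hp, abs_neg]
  have h3 : orient K (K.erase q) * ⟪unitNormal (K.erase q), p - q⟫_ℝ =
      |⟪unitNormal (K.erase q), p - q⟫_ℝ| := by
    rw [← offset_erase hK hq hpF, orient_mul_offset hK hq]
  rw [h2, h3, mul_sub, hm]
  ring

/-- The Gauss theorem on a simplex. -/
theorem gauss_simplex {n : ℕ} {K : Finset (E (n + 1))} (hK : IsSimplex K)
    [DecidableEq (E (n + 1))] {g : E (n + 1) → ℝ} (hg : ContDiff ℝ 1 g) (e : E (n + 1)) :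
    ∫ x in hull K, fderiv ℝ g x e = ∑ r ∈ K, orient K (K.erase r) *
      ⟪unitNormal (K.erase r), e⟫_ℝ * ∫ x, g x ∂faceMeasure (K.erase r) := by
  obtain ⟨q, hq⟩ := hK.nontrivial.nonempty
  -- The linear parts of the barycentric coordinates sum to zero, so `q` drops out and every
  -- direction is a combination of edges at `q`.
  have hsum : e = ∑ p ∈ K, (bary K p).linear e • (p - q) := by
    have h1 (p) : (bary K p).linear e = bary K p e - bary K p 0 := by
      simpa using bary_linear_sub (K := K) p e 0
    simp only [h1, smul_sub, sub_smul, Finset.sum_sub_distrib, ← Finset.sum_smul, hK.sum_bary,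
      hK.sum_bary_smul]
    simp
  have hcd (v : E (n + 1)) : Integrable (fun x => fderiv ℝ g x v) (volume.restrict (hull K)) :=
    (((hg.continuous_fderiv (by simp)).clm_apply
      continuous_const).continuousOn.integrableOn_compact (isCompact_hull K))
  have hedge (p) (hp : p ∈ K) : ∫ x in hull K, fderiv ℝ g x (p - q) =
      ∑ r ∈ K, orient K (K.erase r) *
      ⟪unitNormal (K.erase r), p - q⟫_ℝ * ∫ x, g x ∂faceMeasure (K.erase r) := by
    by_cases hpq : p = q
    · simp [hpq]
    · exact gauss_edge hK hg hp hq hpq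
  conv_lhs => rw [hsum]
  simp only [map_sum, map_smul, smul_eq_mul]
  rw [integral_finsetSum _ fun p _ => (hcd _).const_mul _]
  simp only [integral_const_mul]
  rw [Finset.sum_congr rfl fun p hp => by rw [hedge p hp]]
  conv_rhs => rw [hsum]
  simp only [inner_sum, real_inner_smul_right, Finset.mul_sum, Finset.sum_mul]
  rw [Finset.sum_comm]
  exact Finset.sum_congr rfl fun r _ => Finset.sum_congr rfl fun p _ => by ring

end CauchyFEM

namespace CauchyFEM

/-! ### Geometry of meshes -/

theorem IsSimplex.affineMap_eq_sum {d : ℕ} {K : Finset (E d)} (hK : IsSimplex K)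
    (φ : E d →ᵃ[ℝ] ℝ) (x : E d) : φ x = ∑ q ∈ K, bary K q x * φ q := by
  have h (y : E d) : φ y = φ.linear y + φ 0 := congrFun φ.decomp y
  conv_lhs => rw [h, ← hK.sum_bary_smul x, map_sum]
  conv_rhs => rw [Finset.sum_congr rfl fun q _ => by rw [h q, mul_add]]
  rw [Finset.sum_add_distrib, ← Finset.sum_mul, hK.sum_bary, one_mul]
  simp

/-- The relative interior of the face of `K` opposite to `p`. -/
def openFace {d : ℕ} (K : Finset (E d)) (p : E d) : Set (E d) :=
  {x | bary K p x = 0 ∧ ∀ q ∈ K.erase p, 0 < bary K q x}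

theorem openFace_subset_hull {d : ℕ} {K : Finset (E d)} (hK : IsSimplex K) {p : E d} (hp : p ∈ K) :
    openFace K p ⊆ hull (K.erase p) := by
  rintro x ⟨h0, h1⟩
  rw [hK.mem_hull_erase hp, hK.hull_eq]
  refine ⟨fun q hq => ?_, h0⟩
  by_cases hqp : q = p
  · rw [hqp, h0]
  · exact (h1 q (Finset.mem_erase.2 ⟨hqp, hq⟩)).le

/-- An affine function on a face is determined by its vertex values, so both cells see the same
barycentric coordinates there. -/
theorem openFace_congr {d : ℕ} {K L : Finset (E d)} (hK : IsSimplex K) (hL : IsSimplex L)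
    {p p' : E d} (hp : p ∈ K) (hp' : p' ∈ L) (h : K.erase p = L.erase p') :
    openFace K p ⊆ openFace L p' := by
  rintro x ⟨h0, h1⟩
  have key (r) : bary L r x = ∑ q ∈ K.erase p, bary K q x * bary L r q := by
    rw [hK.affineMap_eq_sum, ← Finset.add_sum_erase K _ hp, h0, zero_mul, zero_add]
  refine ⟨?_, fun r hr => ?_⟩
  · rw [key]
    refine Finset.sum_eq_zero fun q hq => ?_
    rw [h] at hq
    rw [hL.bary_of_ne hp' (Finset.mem_of_mem_erase hq) (Finset.ne_of_mem_erase hq).symm, mul_zero]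
  · rw [key, Finset.sum_eq_single r]
    · rw [hL.bary_self (Finset.mem_of_mem_erase hr), mul_one]
      exact h1 r (h ▸ hr)
    · intro q hq hqr
      rw [h] at hq
      rw [hL.bary_of_ne (Finset.mem_of_mem_erase hr) (Finset.mem_of_mem_erase hq) hqr.symm,
        mul_zero]
    · intro h2
      exact absurd (h ▸ hr) h2

section

variable {n : ℕ} {K : Finset (E (n + 1))} (hK : IsSimplex K) {p : E (n + 1)} (hp : p ∈ K)
include hK hp

/-- The barycentre of the face is a witness. -/
theorem openFace_nonempty : (openFace K p).Nonempty := by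
  have hn : (0 : ℝ) < n + 1 := by positivity
  have hcard : (K.erase p).card = n + 1 := by
    rw [Finset.card_erase_of_mem hp, hK.1]; rfl
  have key (r) (hr : r ∈ K) : bary K r (∑ q ∈ K.erase p, (n + 1 : ℝ)⁻¹ • q) =
      ∑ q ∈ K.erase p, (n + 1 : ℝ)⁻¹ * bary K r q := by
    have h (y : E (n + 1)) : bary K r y = (bary K r).linear y + bary K r 0 :=
      congrFun (bary K r).decomp y
    rw [h, map_sum]
    conv_rhs => rw [Finset.sum_congr rfl fun q _ => by rw [h q, mul_add]]
    rw [Finset.sum_add_distrib, Finset.sum_const, hcard, nsmul_eq_mul]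
    simp only [map_smul, smul_eq_mul]
    push_cast
    field_simp
  refine ⟨∑ q ∈ K.erase p, (n + 1 : ℝ)⁻¹ • q, ?_, fun r hr => ?_⟩
  · rw [key p hp]
    refine Finset.sum_eq_zero fun q hq => ?_
    rw [hK.bary_of_ne hp (Finset.mem_of_mem_erase hq) (Finset.ne_of_mem_erase hq).symm, mul_zero]
  · have hrK := Finset.mem_of_mem_erase hr
    rw [key r hrK, Finset.sum_eq_single r, hK.bary_self hrK]
    · positivity
    · intro q hq hqr
      rw [hK.bary_of_ne hrK (Finset.mem_of_mem_erase hq) hqr.symm, mul_zero]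
    · intro h2
      exact absurd hr h2

/-- The exceptional points lie where the coordinate of some vertex `q` of the face vanishes. In face
coordinates this is an affine subspace, proper because it misses `q`, and hence null. -/
theorem ae_mem_openFace : ∀ᵐ x ∂faceMeasure (K.erase p), x ∈ openFace K p := by
  obtain ⟨f, hf⟩ := hK.erase_nonempty (p := p)
  obtain ⟨L, hL0, hL, hb, hface, -⟩ := exists_face_coords hK hp hf
  have hι : Measurable fun z => f + L z := by fun_prop
  have hmF := (isCompact_hull (K.erase p)).isClosed.measurableSet
  have hmem : ∀ᵐ x ∂faceMeasure (K.erase p), x ∈ hull (K.erase p) := ae_restrict_mem hmF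
  have hne (q) (hq : q ∈ K.erase p) : ∀ᵐ x ∂faceMeasure (K.erase p), bary K q x ≠ 0 := by
    have hm : MeasurableSet {x | bary K q x ≠ 0} :=
      (isClosed_singleton.preimage (continuous_bary K q)).isOpen_compl.measurableSet
    rw [hface, ae_map_iff hι.aemeasurable hm]
    refine ae_restrict_of_ae ?_
    let φ : E n →ᵃ[ℝ] ℝ := (bary K q).comp
      (AffineMap.const ℝ (E n) f + L.toLinearMap.toAffineMap)
    let s : AffineSubspace ℝ (E n) := (AffineSubspace.mk' (0 : ℝ) ⊥).comap φ
    have hs : s ≠ ⊤ := by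
      obtain ⟨z, hz⟩ := hL (q - f) ((unitNormal_spec hK hp).2 q hq f hf)
      intro h
      have h1 : z ∈ s := h ▸ AffineSubspace.mem_top ℝ _ z
      have h2 : φ z = 1 := by
        change bary K q (f + L z) = 1
        rw [hz, add_sub_cancel, hK.bary_self (Finset.mem_of_mem_erase hq)]
      simp [s, AffineSubspace.mem_comap, h2] at h1
    have h0 := Measure.addHaar_affineSubspace volume s hs
    rw [ae_iff]
    convert h0 using 2
    ext z
    simp [s, φ]
  have hne' : ∀ᵐ x ∂faceMeasure (K.erase p), ∀ q ∈ K.erase p, bary K q x ≠ 0 :=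
    (Finset.eventually_all _).2 hne
  filter_upwards [hmem, hne'] with x hx hx'
  have hx2 := (hK.mem_hull_erase hp).1 hx
  rw [hK.hull_eq] at hx2
  exact ⟨hx2.2, fun q hq => lt_of_le_of_ne (hx2.1 q (Finset.mem_of_mem_erase hq)) (hx' q hq).symm⟩

/-- Moving off a relative interior point of a face against the outward normal leads into the
interior of the cell. -/
theorem eventually_mem_interior {x : E (n + 1)} (hx : x ∈ openFace K p) :
    ∀ᶠ ε in 𝓝[>] (0 : ℝ),
      x - ε • orient K (K.erase p) • unitNormal (K.erase p) ∈ interior (hull K) := by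
  set v := orient K (K.erase p) • unitNormal (K.erase p) with hv
  have hlin (q) (ε : ℝ) : bary K q (x - ε • v) = bary K q x - ε * (bary K q).linear v := by
    have h := bary_linear_sub (K := K) q x (x - ε • v)
    rw [sub_sub_cancel, map_smul, smul_eq_mul] at h
    linarith
  have hpv : (bary K p).linear v < 0 := by
    have h1 := inner_unitNormal_linear hK hp v
    have h2 := orient_mul_offset hK hp
    have h3 := abs_pos.2 (offset_ne_zero hK hp)
    have h4 := orient_sq hK hp
    rw [hv, real_inner_smul_right, real_inner_self_eq_norm_sq, (unitNormal_spec hK hp).1, ← hv] at h1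
    -- Along the outward normal the coordinate of `p` decreases at rate $1/|\mathrm{offset}|$.
    have h5 : -(bary K p).linear v * |offset K (K.erase p)| = 1 := by
      rw [← h2, ← h4]
      have h1' : orient K (K.erase p) = -(bary K p).linear v * offset K (K.erase p) := by
        simpa using h1
      calc _ = orient K (K.erase p) * (-(bary K p).linear v * offset K (K.erase p)) := by ring
        _ = _ := by rw [← h1']
    nlinarith
  have h : ∀ q ∈ K, ∀ᶠ ε in 𝓝[>] (0 : ℝ), 0 < bary K q (x - ε • v) := by
    intro q hq
    by_cases hqp : q = p
    · filter_upwards [self_mem_nhdsWithin] with ε hε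
      rw [hqp, hlin, hx.1]
      have : ε * (bary K p).linear v < 0 := mul_neg_of_pos_of_neg hε hpv
      linarith
    · refine Filter.Eventually.filter_mono nhdsWithin_le_nhds ?_
      have hc : Continuous fun ε : ℝ => bary K q (x - ε • v) := by
        have := continuous_bary K q
        fun_prop
      refine hc.continuousAt.eventually (lt_mem_nhds ?_)
      simpa using hx.2 q (Finset.mem_erase.2 ⟨hqp, hq⟩)
  filter_upwards [(Finset.eventually_all K).2 h] with ε hε
  rw [hK.interior_hull_eq]
  exact hε

end

/-! ### Cells of a mesh and the underlying polytope -/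

namespace SimplicialMesh

variable {d : ℕ} {Ω : Set (E d)} (M : SimplicialMesh Ω)

theorem isSimplex {K : Finset (E d)} (hK : K ∈ M.cells) : IsSimplex K :=
  ⟨M.card_cell K hK, M.indep K hK⟩

theorem hull_subset {K : Finset (E d)} (hK : K ∈ M.cells) : hull K ⊆ closure Ω := by
  rw [← M.cover]
  exact subset_biUnion_of_mem (u := fun K => hull K) hK

/-- Cells have equally many vertices, so `K` has one outside `L`. Its coordinate vanishes on the
intersection by conformity but is positive in the interior of `K`. -/
theorem disjoint_interior {K L : Finset (E d)} (hK : K ∈ M.cells) (hL : L ∈ M.cells)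
    (hKL : K ≠ L) : Disjoint (interior (hull K)) (interior (hull L)) := by
  rw [Set.disjoint_iff]
  rintro x ⟨hx, hx'⟩
  have h1 : x ∈ hull K ∩ hull L := ⟨interior_subset hx, interior_subset hx'⟩
  rw [M.conforming K hK L hL] at h1
  have h2 : ∃ p ∈ K, p ∉ L := by
    by_contra! h
    exact hKL (Finset.eq_of_subset_of_card_le h
      (by rw [M.card_cell K hK, M.card_cell L hL]))
  obtain ⟨p, hp, hpL⟩ := h2
  have h3 := (M.isSimplex hK).bary_eq_zero_of_mem_convexHull inter_subset_left hp
    (fun h => hpL h.2) h1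
  rw [(M.isSimplex hK).interior_hull_eq] at hx
  exact (hx p hp).ne' h3

theorem mem_faces {F : Finset (E d)} :
    F ∈ M.faces ↔ ∃ K ∈ M.cells, F ⊆ K ∧ F.card = d := by
  simp [faces, Finset.mem_powersetCard]

end SimplicialMesh

theorem IsConvexPolytopeDomain.isOpen {d : ℕ} {Ω : Set (E d)} (h : IsConvexPolytopeDomain Ω) :
    IsOpen Ω := by
  obtain ⟨-, S, rfl⟩ := h
  exact isOpen_interior

theorem IsConvexPolytopeDomain.convex {d : ℕ} {Ω : Set (E d)} (h : IsConvexPolytopeDomain Ω) :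
    Convex ℝ Ω := by
  obtain ⟨-, S, rfl⟩ := h
  exact (convex_convexHull ℝ _).interior

theorem IsConvexPolytopeDomain.interior_closure {d : ℕ} {Ω : Set (E d)}
    (h : IsConvexPolytopeDomain Ω) : interior (closure Ω) = Ω := by
  rw [h.convex.interior_closure_eq_interior_of_nonempty_interior
    (by rw [h.isOpen.interior_eq]; exact h.1), h.isOpen.interior_eq]

theorem IsConvexPolytopeDomain.isBounded {d : ℕ} {Ω : Set (E d)}
    (h : IsConvexPolytopeDomain Ω) : Bornology.IsBounded Ω := by
  obtain ⟨-, S, rfl⟩ := h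
  exact (isCompact_hull S).isBounded.subset interior_subset

namespace SimplicialMesh

section

variable {d : ℕ} {Ω : Set (E d)} (M : SimplicialMesh Ω) (hΩ : IsConvexPolytopeDomain Ω)
include hΩ

theorem interior_hull_subset {K : Finset (E d)} (hK : K ∈ M.cells) : interior (hull K) ⊆ Ω := by
  rw [← hΩ.interior_closure]
  exact interior_mono (M.hull_subset hK)

theorem cells_nonempty : M.cells.Nonempty := by
  by_contra h
  rw [Finset.not_nonempty_iff_eq_empty] at h
  have h1 := M.cover
  rw [h] at h1
  obtain ⟨x, hx⟩ := hΩ.1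
  have h2 := subset_closure hx
  rw [← h1] at h2
  simp at h2

/-- What the open cells miss lies in the cell frontiers, which are null by convexity. Splitting
integrals and null sets over cells rests on this. -/
theorem restrict_eq_sum : (volume : Measure (E d)).restrict Ω =
    ∑ K ∈ M.cells, volume.restrict (interior (hull K)) := by
  have h1 := Measure.restrict_biUnion_finset (μ := (volume : Measure (E d))) (T := M.cells)
    (s := fun K => interior (hull K))
    (fun K hK L hL hKL => M.disjoint_interior hK hL hKL) (fun K => isOpen_interior.measurableSet)
  have h2 : (⋃ K ∈ M.cells, interior (hull K) : Set (E d)) =ᵐ[volume] Ω := by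
    refine ae_eq_set.2 ⟨?_, ?_⟩
    · have h3 : (⋃ K ∈ M.cells, interior (hull K)) ⊆ Ω :=
        iUnion₂_subset fun K hK => M.interior_hull_subset hΩ hK
      rw [sdiff_eq_empty.2 h3, measure_empty]
    · refine measure_mono_null (t := ⋃ K ∈ M.cells, frontier (hull K)) ?_ ?_
      · rintro x ⟨hx, hx'⟩
        have hx2 := subset_closure hx
        rw [← M.cover] at hx2
        simp only [mem_iUnion, exists_prop, not_exists, not_and] at hx2 hx' ⊢
        obtain ⟨K, hK, hxK⟩ := hx2
        exact ⟨K, hK, subset_closure hxK, hx' K hK⟩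
      · exact (measure_biUnion_null_iff M.cells.countable_toSet).2
          fun K _ => (convex_hull K).addHaar_frontier volume
  rw [← Measure.restrict_congr_set h2, h1, Measure.sum_fintype,
    Finset.sum_coe_sort M.cells fun K => volume.restrict (interior (hull K))]

omit hΩ M in
theorem _root_.CauchyFEM.restrict_interior_hull (K : Finset (E d)) :
    (volume : Measure (E d)).restrict (interior (hull K)) = volume.restrict (hull K) := by
  refine Measure.restrict_congr_set (interior_ae_eq_of_null_frontier ?_)
  exact (convex_hull K).addHaar_frontier volume

theorem ae_restrict_iff_cells {P : E d → Prop} : (∀ᵐ x ∂volume.restrict Ω, P x) ↔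
    ∀ K ∈ M.cells, ∀ᵐ x ∂volume.restrict (interior (hull K)), P x := by
  rw [M.restrict_eq_sum hΩ]
  simp only [ae_iff, Measure.finsetSum_apply, Finset.sum_eq_zero_iff]

theorem setIntegral_eq_sum {G : Type*} [NormedAddCommGroup G] [NormedSpace ℝ G] {f : E d → G}
    (hf : Integrable f (volume.restrict Ω)) :
    ∫ x in Ω, f x = ∑ K ∈ M.cells, ∫ x in hull K, f x := by
  rw [M.restrict_eq_sum hΩ, integral_finsetSum_measure]
  · simp only [restrict_interior_hull]
  · intro K hK
    exact hf.mono_measure (Measure.restrict_mono (M.interior_hull_subset hΩ hK) le_rfl)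

theorem memLp_of_cells {G : Type*} [NormedAddCommGroup G] {f : E d → G} {p : ENNReal}
    (h : ∀ K ∈ M.cells, MemLp f p (volume.restrict (hull K))) : MemLp f p (volume.restrict Ω) := by
  have h1 : MemLp (fun x => ∑ K ∈ M.cells, (interior (hull K)).indicator f x) p
      (volume.restrict Ω) := by
    refine (memLp_finsetSum M.cells fun K hK => ?_)
    refine MemLp.restrict Ω ((memLp_indicator_iff_restrict isOpen_interior.measurableSet).2 ?_)
    rw [restrict_interior_hull]
    exact h K hK
  refine h1.ae_eq ?_
  refine (M.ae_restrict_iff_cells hΩ).2 fun K hK => ?_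
  refine ae_restrict_of_forall_mem isOpen_interior.measurableSet fun x hx => ?_
  change ∑ K ∈ M.cells, (interior (hull K)).indicator f x = f x
  rw [Finset.sum_eq_single_of_mem K hK, indicator_of_mem hx]
  intro L hL hLK
  exact indicator_of_notMem (fun hx' => Set.disjoint_iff.1 (M.disjoint_interior hL hK hLK)
    ⟨hx', hx⟩) _

end

/-! ### Faces, adjacent cells and their orientation -/

section

variable {n : ℕ} {Ω : Set (E (n + 1))} (M : SimplicialMesh Ω)

theorem exists_erase_eq {K F : Finset (E (n + 1))} (hK : K ∈ M.cells) (hF : F ∈ M.faces)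
    (hFK : F ⊆ K) : ∃ p ∈ K, F = K.erase p := by
  obtain ⟨-, -, -, hc⟩ := M.mem_faces.1 hF
  have h : (K \ F).card = 1 := by
    rw [Finset.card_sdiff_of_subset hFK, M.card_cell K hK, hc]; simp
  obtain ⟨p, hp⟩ := Finset.card_eq_one.1 h
  refine ⟨p, ?_, ?_⟩
  · have : p ∈ K \ F := by rw [hp]; simp
    exact (Finset.mem_sdiff.1 this).1
  · rw [← Finset.sdiff_singleton_eq_erase, ← hp, Finset.sdiff_sdiff_eq_self hFK]

theorem erase_mem_faces {K : Finset (E (n + 1))} (hK : K ∈ M.cells) {p : E (n + 1)} (hp : p ∈ K) :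
    K.erase p ∈ M.faces :=
  M.mem_faces.2 ⟨K, hK, Finset.erase_subset _ _, by
    rw [Finset.card_erase_of_mem hp, M.card_cell K hK]; rfl⟩

/-- The cells containing a face. -/
noncomputable def adj (F : Finset (E (n + 1))) : Finset (Finset (E (n + 1))) := M.cells.filter (F ⊆ ·)

theorem mem_adj {F K : Finset (E (n + 1))} : K ∈ M.adj F ↔ K ∈ M.cells ∧ F ⊆ K := by
  simp [adj]

/-- Summation over the faces of all cells, arranged by faces. -/
theorem sum_faces_eq {G : Type*} [AddCommMonoid G]
    (f : Finset (E (n + 1)) → Finset (E (n + 1)) → G) :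
    ∑ K ∈ M.cells, ∑ p ∈ K, f K (K.erase p) = ∑ F ∈ M.faces, ∑ K ∈ M.adj F, f K F := by
  have h1 (K) (hK : K ∈ M.cells) : ∑ p ∈ K, f K (K.erase p) = ∑ F ∈ M.faces with F ⊆ K, f K F := by
    refine Finset.sum_bij (fun p _ => K.erase p) (fun p hp => ?_) (fun p hp q hq h => ?_)
      (fun F hF => ?_) (fun p hp => rfl)
    · exact Finset.mem_filter.2 ⟨M.erase_mem_faces hK hp, Finset.erase_subset _ _⟩
    · by_contra hpq
      have h2 : q ∈ K.erase p := Finset.mem_erase.2 ⟨fun h => hpq h.symm, hq⟩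
      rw [h] at h2
      simp at h2
    · obtain ⟨hF1, hF2⟩ := Finset.mem_filter.1 hF
      obtain ⟨p, hp, h⟩ := M.exists_erase_eq hK hF1 hF2
      exact ⟨p, hp, h.symm⟩
  rw [Finset.sum_congr rfl h1]
  refine Finset.sum_comm' fun K F => ?_
  rw [Finset.mem_filter, M.mem_adj]
  tauto

/-- Near a relative interior point of a face only cells containing the face occur. -/
theorem eventually_subset_of_mem_hull {K : Finset (E (n + 1))} (hK : K ∈ M.cells)
    {p x : E (n + 1)} (hp : p ∈ K) (hx : x ∈ openFace K p) :
    ∀ᶠ y in 𝓝 x, ∀ L ∈ M.cells, y ∈ hull L → K.erase p ⊆ L := by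
  have hKs := M.isSimplex hK
  rw [Finset.eventually_all]
  intro L hL
  by_cases hxL : x ∈ hull L
  · refine Filter.Eventually.of_forall fun _ _ q hq => ?_
    have h1 : x ∈ hull K ∩ hull L :=
      ⟨((hKs.mem_hull_erase hp).1 (openFace_subset_hull hKs hp hx)).1, hxL⟩
    rw [M.conforming K hK L hL] at h1
    by_contra hqL
    exact (hx.2 q hq).ne' (hKs.bary_eq_zero_of_mem_convexHull inter_subset_left
      (Finset.mem_of_mem_erase hq) (fun h => hqL h.2) h1)
  · filter_upwards [(isCompact_hull L).isClosed.isOpen_compl.mem_nhds hxL] with y hy hy'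
    exact absurd hy' hy

/-- Two different cells sharing a face lie on opposite sides of it. -/
theorem orient_eq_neg {K L F : Finset (E (n + 1))} (hF : F ∈ M.faces) (hK : K ∈ M.adj F)
    (hL : L ∈ M.adj F) (hKL : K ≠ L) : orient K F = -orient L F := by
  rw [M.mem_adj] at hK
  obtain ⟨hK, hFK⟩ := hK
  rw [M.mem_adj] at hL
  obtain ⟨hL, hFL⟩ := hL
  obtain ⟨p, hp, rfl⟩ := M.exists_erase_eq hK hF hFK
  obtain ⟨p', hp', h⟩ := M.exists_erase_eq hL hF hFL
  have hKs := M.isSimplex hK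
  have hLs := M.isSimplex hL
  have h1 := orient_sq hKs hp
  have h2 := orient_sq hLs hp'
  rw [← h] at h2
  rcases mul_self_eq_mul_self_iff.1 (h1.trans h2.symm) with h3 | h3
  -- With equal signs, moving slightly inward from a relative interior point of the face would land
  -- in both open cells at once.
  · exfalso
    obtain ⟨x, hx⟩ := openFace_nonempty hKs hp
    have h4 := eventually_mem_interior hKs hp hx
    have h5 := eventually_mem_interior hLs hp' (openFace_congr hKs hLs hp hp' h hx)
    rw [← h, ← h3] at h5
    obtain ⟨ε, hε1, hε2⟩ := (h4.and h5).exists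
    exact Set.disjoint_iff.1 (M.disjoint_interior hK hL hKL) ⟨hε1, hε2⟩
  · exact h3

variable (hΩ : IsConvexPolytopeDomain Ω)
include hΩ

/-- Some point `y` of the closed face lies in `Ω`. The segment from `y` to `x` can be prolonged a
little inside the face, so `x` lies strictly between an interior point and a closure point of a
convex set. -/
theorem openFace_subset {K : Finset (E (n + 1))} (hK : K ∈ M.cells) {p : E (n + 1)} (hp : p ∈ K)
    (hF : ¬ hull (K.erase p) ⊆ frontier Ω) : openFace K p ⊆ Ω := by
  intro x hx
  have hKs := M.isSimplex hK
  have hFcl : hull (K.erase p) ⊆ closure Ω := (convexHull_mono (by simp)).trans (M.hull_subset hK)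
  obtain ⟨y, hyF, hy⟩ := not_subset.1 hF
  have hyΩ : y ∈ interior Ω := by
    by_contra h
    exact hy ⟨hFcl hyF, h⟩
  have hyb := ((hKs.mem_hull_erase hp).1 hyF).2
  have hcont : ∀ q ∈ K.erase p, ∀ᶠ ε in 𝓝[>] (0 : ℝ), 0 < bary K q (x + ε • (x - y)) := by
    intro q hq
    refine Filter.Eventually.filter_mono nhdsWithin_le_nhds ?_
    have hc : Continuous fun ε : ℝ => bary K q (x + ε • (x - y)) := by
      have := continuous_bary K q
      fun_prop
    refine hc.continuousAt.eventually (lt_mem_nhds ?_)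
    simpa using hx.2 q hq
  obtain ⟨ε, hε, hε0⟩ := (((Finset.eventually_all _).2 hcont).and self_mem_nhdsWithin).exists
  have hε0 : 0 < ε := hε0
  have hz : x + ε • (x - y) ∈ closure Ω := by
    refine hFcl (openFace_subset_hull hKs hp ⟨?_, hε⟩)
    rw [bary_add_smul_sub, hx.1, hyb]; simp
  have h1 := hΩ.convex.openSegment_interior_closure_subset_interior hyΩ hz
  rw [hΩ.isOpen.interior_eq] at h1
  refine h1 ⟨ε / (1 + ε), 1 / (1 + ε), by positivity, by positivity, by field_simp; ring, ?_⟩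
  rw [smul_add, smul_smul, smul_sub]
  have h2 : 1 / (1 + ε) * ε = ε / (1 + ε) := by ring
  rw [h2]
  have h3 : x = (1 / (1 + ε) + ε / (1 + ε)) • x := by
    rw [show 1 / (1 + ε) + ε / (1 + ε) = 1 by field_simp, one_smul]
  conv_rhs => rw [h3, add_smul]
  abel

/-- A face that is not contained in the boundary belongs to two cells. -/
theorem exists_adj_ne {K F : Finset (E (n + 1))} (hF : F ∈ M.faces) (hK : K ∈ M.adj F)
    (hFΩ : ¬ hull F ⊆ frontier Ω) : ∃ L ∈ M.adj F, L ≠ K := by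
  rw [M.mem_adj] at hK
  obtain ⟨hK, hFK⟩ := hK
  obtain ⟨p, hp, rfl⟩ := M.exists_erase_eq hK hF hFK
  have hKs := M.isSimplex hK
  obtain ⟨x, hx⟩ := openFace_nonempty hKs hp
  have hxΩ := M.openFace_subset hΩ hK hp hFΩ hx
  set v := orient K (K.erase p) • unitNormal (K.erase p) with hv
  have h1 := eventually_mem_interior hKs hp hx
  have hc : Tendsto (fun ε : ℝ => x + ε • v) (𝓝[>] 0) (𝓝 x) := by
    refine Filter.Tendsto.mono_left ?_ nhdsWithin_le_nhds
    have : Continuous fun ε : ℝ => x + ε • v := by fun_prop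
    simpa using this.tendsto 0
  have h2 := hc.eventually (M.eventually_subset_of_mem_hull hK hp hx)
  have h3 := hc.eventually (hΩ.isOpen.mem_nhds hxΩ)
  -- A small outward step stays in `Ω`, hence in some cell, which must contain the face. It is not
  -- the original cell, since the coordinate of `p` has become negative.
  obtain ⟨ε, ⟨h1, h2⟩, h3⟩ := ((h1.and h2).and h3).exists
  have h4 := subset_closure h3
  rw [← M.cover] at h4
  simp only [mem_iUnion, exists_prop] at h4
  obtain ⟨L, hL, hxL⟩ := h4
  refine ⟨L, M.mem_adj.2 ⟨hL, h2 L hL hxL⟩, ?_⟩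
  rintro rfl
  rw [hKs.interior_hull_eq] at h1
  rw [hKs.hull_eq] at hxL
  have h5 := h1 p hp
  have h6 := hxL p hp
  have h7 : bary L p (x + ε • v) + bary L p (x - ε • v) = 0 := by
    have e1 := bary_linear_sub (K := L) p (x + ε • v) x
    have e2 := bary_linear_sub (K := L) p x (x - ε • v)
    rw [add_sub_cancel_left, hx.1] at e1
    rw [sub_sub_cancel, hx.1] at e2
    linarith
  linarith

/-- A face on the boundary belongs to one cell only. -/
theorem adj_eq_of_subset_frontier {K L F : Finset (E (n + 1))} (hF : F ∈ M.faces)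
    (hK : K ∈ M.adj F) (hL : L ∈ M.adj F) (hFΩ : hull F ⊆ frontier Ω) : L = K := by
  by_contra hne
  have hor := M.orient_eq_neg hF hK hL (fun h => hne h.symm)
  rw [M.mem_adj] at hK
  obtain ⟨hK, hFK⟩ := hK
  rw [M.mem_adj] at hL
  obtain ⟨hL, hFL⟩ := hL
  obtain ⟨p, hp, rfl⟩ := M.exists_erase_eq hK hF hFK
  obtain ⟨p', hp', h⟩ := M.exists_erase_eq hL hF hFL
  have hKs := M.isSimplex hK
  have hLs := M.isSimplex hL
  obtain ⟨x, hx⟩ := openFace_nonempty hKs hp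
  have hx' := openFace_congr hKs hLs hp hp' h hx
  obtain ⟨f, hf⟩ := hKs.erase_nonempty (p := p)
  -- The cells lie on opposite sides of the common hyperplane, so every point is on the closed inner
  -- side of one of them. Near `x` they then cover a full neighbourhood, which is impossible at a
  -- boundary point.
  have hsigns (y : E (n + 1)) : 0 ≤ bary K p y ∨ 0 ≤ bary L p' y := by
    have e1 := inner_unitNormal_sub hKs hp hf y
    have e2 := inner_unitNormal_sub hLs hp' (h ▸ hf) y
    rw [← offset_erase hKs hp hf] at e1
    rw [← offset_erase hLs hp' (h ▸ hf), ← h] at e2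
    have e3 := orient_mul_offset hKs hp
    have e4 := orient_mul_offset hLs hp'
    rw [← h] at e4
    have e5 := abs_pos.2 (offset_ne_zero hKs hp)
    have e6 := abs_pos.2 (offset_ne_zero hLs hp')
    rw [← h] at e6
    by_contra! hneg
    have e7 : bary K p y * |offset K (K.erase p)| + bary L p' y * |offset L (K.erase p)| = 0 := by
      rw [← e3, ← e4, mul_left_comm, ← e1, mul_left_comm, ← e2, hor]; ring
    have := mul_neg_of_neg_of_pos hneg.1 e5
    have := mul_neg_of_neg_of_pos hneg.2 e6
    linarith
  have hnear : ∀ᶠ y in 𝓝 x, y ∈ closure Ω := by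
    have h1 : ∀ q ∈ K.erase p, ∀ᶠ y in 𝓝 x, 0 < bary K q y := fun q hq =>
      (continuous_bary K q).continuousAt.eventually (lt_mem_nhds (hx.2 q hq))
    have h2 : ∀ q ∈ L.erase p', ∀ᶠ y in 𝓝 x, 0 < bary L q y := fun q hq =>
      (continuous_bary L q).continuousAt.eventually (lt_mem_nhds (hx'.2 q hq))
    filter_upwards [(Finset.eventually_all _).2 h1, (Finset.eventually_all _).2 h2] with y hy1 hy2
    rcases hsigns y with h3 | h3
    · refine M.hull_subset hK ?_
      rw [hKs.hull_eq]
      intro q hq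
      by_cases hqp : q = p
      · rwa [hqp]
      · exact (hy1 q (Finset.mem_erase.2 ⟨hqp, hq⟩)).le
    · refine M.hull_subset hL ?_
      rw [hLs.hull_eq]
      intro q hq
      by_cases hqp : q = p'
      · rwa [hqp]
      · exact (hy2 q (Finset.mem_erase.2 ⟨hqp, hq⟩)).le
  have hxint : x ∈ interior (closure Ω) := mem_interior_iff_mem_nhds.2 hnear
  have hxF := hFΩ (openFace_subset_hull hKs hp hx)
  rw [hΩ.interior_closure] at hxint
  rw [hΩ.isOpen.frontier_eq] at hxF
  exact hxF.2 hxint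

theorem adj_eq_singleton {K F : Finset (E (n + 1))} (hF : F ∈ M.faces) (hK : K ∈ M.adj F)
    (hFΩ : hull F ⊆ frontier Ω) : M.adj F = {K} :=
  Finset.eq_singleton_iff_unique_mem.2 ⟨hK, fun _ hL => M.adj_eq_of_subset_frontier hΩ hF hK hL hFΩ⟩

-- A third cell would be oriented oppositely to both `K` and `L`, which are themselves opposite, so
-- its orientation would be zero rather than $\pm1$.
omit hΩ in
theorem adj_eq_pair {K L F : Finset (E (n + 1))} (hF : F ∈ M.faces) (hK : K ∈ M.adj F)
    (hL : L ∈ M.adj F) (hKL : K ≠ L) : M.adj F = {K, L} := by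
  ext J
  simp only [Finset.mem_insert, Finset.mem_singleton]
  refine ⟨fun hJ => ?_, by rintro (rfl | rfl) <;> assumption⟩
  by_contra! hne
  have h1 := M.orient_eq_neg hF hK hL hKL
  have h2 := M.orient_eq_neg hF hJ hK hne.1
  have h3 := M.orient_eq_neg hF hJ hL hne.2
  rw [M.mem_adj] at hJ
  obtain ⟨hJ, hFJ⟩ := hJ
  obtain ⟨p, hp, rfl⟩ := M.exists_erase_eq hJ hF hFJ
  have h4 := orient_sq (M.isSimplex hJ) hp
  have h5 : orient J (J.erase p) = 0 := by linarith
  rw [h5] at h4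
  norm_num at h4

omit hΩ in
theorem adj_nonempty {F : Finset (E (n + 1))} (hF : F ∈ M.faces) : ∃ K, K ∈ M.adj F := by
  obtain ⟨K, hK, hFK, -⟩ := M.mem_faces.1 hF
  exact ⟨K, M.mem_adj.2 ⟨hK, hFK⟩⟩

omit hΩ in
theorem card_adj_le {F : Finset (E (n + 1))} (hF : F ∈ M.faces) : (M.adj F).card ≤ 2 := by
  obtain ⟨K, hK⟩ := M.adj_nonempty hF
  by_cases h : ∃ L ∈ M.adj F, L ≠ K
  · obtain ⟨L, hL, hne⟩ := h
    rw [M.adj_eq_pair hF hK hL hne.symm]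
    exact Finset.card_le_two
  · push Not at h
    rw [Finset.eq_singleton_iff_unique_mem.2 ⟨hK, h⟩]
    simp

end

end SimplicialMesh

end CauchyFEM

namespace CauchyFEM

/-! ### Piecewise functions -/

/-- The classical divergence of a vector field. -/
noncomputable def divg {d : ℕ} (f : E d → E d) (y : E d) : ℝ :=
  ∑ i, gradient (fun z => f z i) y i

theorem continuous_gradient {d : ℕ} {f : E d → ℝ} (hf : ContDiff ℝ 1 f) :
    Continuous (gradient f) := by
  unfold gradient
  exact (InnerProductSpace.toDual ℝ (E d)).symm.continuous.comp (hf.continuous_fderiv (by simp))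

theorem continuous_of_coord {d : ℕ} {f : E d → E d}
    (hf : ∀ i, Continuous fun y => f y i) : Continuous f :=
  (PiLp.continuous_toLp 2 _).comp (continuous_pi hf)

theorem continuous_divg {d : ℕ} {f : E d → E d} (hf : ∀ i, ContDiff ℝ 1 fun y => f y i) :
    Continuous (divg f) := by
  unfold divg
  refine continuous_finsetSum _ fun i _ => ?_
  have := continuous_gradient (hf i)
  fun_prop

theorem gradient_congr_of_eqOn {d : ℕ} {U : Set (E d)} (hU : IsOpen U) {f g : E d → ℝ}
    (h : EqOn f g U) {y : E d} (hy : y ∈ U) : gradient f y = gradient g y := by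
  have : f =ᶠ[𝓝 y] g := Filter.eventually_of_mem (hU.mem_nhds hy) h
  rw [gradient, gradient, this.fderiv_eq]

/-- Integration by parts on a simplex. -/
theorem gauss_simplex_mul {n : ℕ} {K : Finset (E (n + 1))} (hK : IsSimplex K)
    {f : E (n + 1) → E (n + 1)} (hf : ∀ i, ContDiff ℝ 1 fun y => f y i) {φ : E (n + 1) → ℝ}
    (hφ : ContDiff ℝ 1 φ) :
    ∫ x in hull K, (divg f x * φ x + ⟪f x, gradient φ x⟫_ℝ) = ∑ p ∈ K, orient K (K.erase p) *
      ∫ x, ⟪unitNormal (K.erase p), f x⟫_ℝ * φ x ∂faceMeasure (K.erase p) := by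
  have hg (i) : ContDiff ℝ 1 fun y => f y i * φ y := (hf i).mul hφ
  have h1 (x) : divg f x * φ x + ⟪f x, gradient φ x⟫_ℝ =
      ∑ i, fderiv ℝ (fun y => f y i * φ y) x (EuclideanSpace.single i 1) := by
    rw [divg, Finset.sum_mul, PiLp.inner_apply, ← Finset.sum_add_distrib]
    refine Finset.sum_congr rfl fun i _ => ?_
    rw [fderiv_fun_mul ((hf i).differentiable (by simp) x) (hφ.differentiable (by simp) x)]
    simp [gradient_apply_eq]
    ring
  have hcd (i : Fin (n + 1)) : Integrable (fun x => fderiv ℝ (fun y => f y i * φ y) x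
      (EuclideanSpace.single i 1)) (volume.restrict (hull K)) :=
    ((((hg i).continuous_fderiv (by simp)).clm_apply
      continuous_const).continuousOn.integrableOn_compact (isCompact_hull K))
  simp only [h1]
  rw [integral_finsetSum _ fun i _ => hcd i, Finset.sum_congr rfl fun i _ => gauss_simplex hK (hg i) _,
    Finset.sum_comm]
  refine Finset.sum_congr rfl fun p hp => ?_
  simp only [mul_assoc, ← Finset.mul_sum]
  congr 1
  simp only [← integral_const_mul]
  rw [← integral_finsetSum _ fun i _ => (integrable_faceMeasure hK hp (hg i).continuous).const_mul _]
  refine integral_congr_ae (Filter.Eventually.of_forall fun x => ?_)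
  simp only [PiLp.inner_apply, Finset.sum_mul]
  refine Finset.sum_congr rfl fun i _ => ?_
  simp
  ring

namespace SimplicialMesh

section

variable {d : ℕ} {Ω : Set (E d)} (M : SimplicialMesh Ω)

open Classical in
/-- The function equal to `f K` in the interior of every cell `K`. -/
noncomputable def glue {G : Type*} [AddCommMonoid G] (f : Finset (E d) → E d → G) (y : E d) : G :=
  ∑ K ∈ M.cells, (interior (hull K)).indicator (f K) y

theorem glue_eqOn {G : Type*} [AddCommMonoid G] (f : Finset (E d) → E d → G) {K : Finset (E d)}
    (hK : K ∈ M.cells) : EqOn (M.glue f) (f K) (interior (hull K)) := by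
  intro x hx
  rw [glue, Finset.sum_eq_single_of_mem K hK, indicator_of_mem hx]
  intro L hL hLK
  exact indicator_of_notMem (fun hx' => Set.disjoint_iff.1 (M.disjoint_interior hL hK hLK)
    ⟨hx', hx⟩) _

theorem cellTrace_eq {G : Type} [TopologicalSpace G] [T2Space G] {K : Finset (E d)}
    (hK : K ∈ M.cells) {f g : E d → G} (h : EqOn f g (interior (hull K))) (hg : Continuous g)
    {y : E d} (hy : y ∈ hull K) : cellTrace K f y = g y := by
  refine extendFrom_eq (by rwa [(M.isSimplex hK).closure_interior_hull]) ?_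
  refine (hg.continuousWithinAt (s := interior (hull K)) (x := y)).tendsto.congr' ?_
  filter_upwards [self_mem_nhdsWithin] with x hx using (h hx).symm

theorem memLp_of_eqOn (hΩ : IsConvexPolytopeDomain Ω) {G : Type*} [NormedAddCommGroup G]
    {f : E d → G} {g : Finset (E d) → E d → G}
    (h : ∀ K ∈ M.cells, EqOn f (g K) (interior (hull K))) (hg : ∀ K ∈ M.cells, Continuous (g K))
    (p : ENNReal) [SecondCountableTopology G] : MemLp f p (volume.restrict Ω) := by
  refine M.memLp_of_cells hΩ fun K hK => ?_
  rw [← restrict_interior_hull]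
  refine (memLp_congr_ae ?_).1 (memLp_restrict_of_continuous (hg K hK) (isCompact_hull K)
    interior_subset p)
  exact ae_restrict_of_forall_mem isOpen_interior.measurableSet fun x hx => (h K hK hx).symm

end

section

variable {n : ℕ} {Ω : Set (E (n + 1))} (M : SimplicialMesh Ω)

theorem sum_gauss {f : Finset (E (n + 1)) → E (n + 1) → E (n + 1)}
    {φ : Finset (E (n + 1)) → E (n + 1) → ℝ}
    (hf : ∀ K ∈ M.cells, ∀ i, ContDiff ℝ 1 fun y => f K y i)
    (hφ : ∀ K ∈ M.cells, ContDiff ℝ 1 (φ K)) :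
    ∑ K ∈ M.cells, ∫ x in hull K, (divg (f K) x * φ K x + ⟪f K x, gradient (φ K) x⟫_ℝ) =
      ∑ F ∈ M.faces, ∑ K ∈ M.adj F,
        orient K F * ∫ x, ⟪unitNormal F, f K x⟫_ℝ * φ K x ∂faceMeasure F := by
  rw [← M.sum_faces_eq fun K F => orient K F * ∫ x, ⟪unitNormal F, f K x⟫_ℝ * φ K x ∂faceMeasure F]
  exact Finset.sum_congr rfl fun K hK => gauss_simplex_mul (M.isSimplex hK) (hf K hK) (hφ K hK)

theorem sum_orient_eq_zero (hΩ : IsConvexPolytopeDomain Ω) {F : Finset (E (n + 1))}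
    (hF : F ∈ M.faces) (hFΩ : ¬ hull F ⊆ frontier Ω) : ∑ K ∈ M.adj F, orient K F = 0 := by
  obtain ⟨K, hK⟩ := M.adj_nonempty hF
  obtain ⟨L, hL, hne⟩ := M.exists_adj_ne hΩ hF hK hFΩ
  rw [M.adj_eq_pair hF hK hL hne.symm, Finset.sum_pair hne.symm, M.orient_eq_neg hF hK hL hne.symm,
    neg_add_cancel]

theorem integrableOn_inner_gradient_test {f : E (n + 1) → E (n + 1)} {φ : E (n + 1) → ℝ}
    (hf : Continuous f) (hφ : ContDiff ℝ 1 φ) (K : Finset (E (n + 1))) :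
    IntegrableOn (fun x => ⟪f x, gradient φ x⟫_ℝ) (hull K) :=
  (Continuous.inner hf (continuous_gradient hφ)).continuousOn.integrableOn_compact
    (isCompact_hull K)

/-- A piecewise smooth field with continuous normal components has a weak divergence. -/
theorem hasWeakDiv_of_normal (hΩ : IsConvexPolytopeDomain Ω) {q : E (n + 1) → E (n + 1)}
    {f : Finset (E (n + 1)) → E (n + 1) → E (n + 1)}
    (hf : ∀ K ∈ M.cells, ∀ i, ContDiff ℝ 1 fun y => f K y i)
    (hq : ∀ K ∈ M.cells, EqOn q (f K) (interior (hull K)))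
    {g : Finset (E (n + 1)) → E (n + 1) → ℝ}
    (hg : ∀ F ∈ M.faces, ∀ K ∈ M.adj F, ∀ y ∈ hull F, ⟪unitNormal F, f K y⟫_ℝ = g F y) :
    HasWeakDiv Ω q (M.glue fun K => divg (f K)) := by
  have hfc (K) (hK : K ∈ M.cells) : Continuous (f K) :=
    continuous_of_coord fun i => (hf K hK i).continuous
  have hdc (K) (hK : K ∈ M.cells) : Continuous (divg (f K)) := continuous_divg (hf K hK)
  have hgl (K) (hK : K ∈ M.cells) := M.glue_eqOn (fun K => divg (f K)) hK
  refine ⟨M.memLp_of_eqOn hΩ hq hfc 2, M.memLp_of_eqOn hΩ hgl hdc 2, ?_⟩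
  rintro φ ⟨hφ, hφc, hφs⟩
  have hφ1 : ContDiff ℝ 1 φ := hφ.of_le (by exact_mod_cast le_top)
  have hgc := continuous_gradient hφ1
  have hG := M.sum_gauss hf (φ := fun _ => φ) (fun _ _ => hφ1)
  -- Boundary faces drop out because the test function vanishes there. On the other faces the two
  -- cells carry the same normal trace with opposite signs.
  have hzero : ∑ F ∈ M.faces, ∑ K ∈ M.adj F,
      orient K F * ∫ x, ⟪unitNormal F, f K x⟫_ℝ * φ x ∂faceMeasure F = 0 := by
    refine Finset.sum_eq_zero fun F hF => ?_
    have hmF := (isCompact_hull F).isClosed.measurableSet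
    by_cases hFΩ : hull F ⊆ frontier Ω
    · refine Finset.sum_eq_zero fun K hK => ?_
      rw [faceMeasure, setIntegral_eq_zero_of_forall_eq_zero, mul_zero]
      intro x hx
      have h1 := hFΩ hx
      rw [hΩ.isOpen.frontier_eq] at h1
      rw [image_eq_zero_of_notMem_tsupport fun h => h1.2 (hφs h), mul_zero]
    · have h1 (K) (hK : K ∈ M.adj F) : orient K F * ∫ x, ⟪unitNormal F, f K x⟫_ℝ * φ x ∂faceMeasure F
          = orient K F * ∫ x, g F x * φ x ∂faceMeasure F := by
        congr 1
        exact setIntegral_congr_fun hmF fun x hx => by simp only [hg F hF K hK x hx]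
      rw [Finset.sum_congr rfl h1, ← Finset.sum_mul, M.sum_orient_eq_zero hΩ hF hFΩ, zero_mul]
  rw [hzero] at hG
  have hi1 (K) (hK : K ∈ M.cells) : IntegrableOn (fun x => divg (f K) x * φ x) (hull K) :=
    ((hdc K hK).mul hφ1.continuous).continuousOn.integrableOn_compact (isCompact_hull K)
  have hi2 (K) (hK : K ∈ M.cells) := integrableOn_inner_gradient_test (hfc K hK) hφ1 K
  rw [Finset.sum_congr rfl fun K hK => integral_add (hi1 K hK) (hi2 K hK),
    Finset.sum_add_distrib] at hG
  have hI1 : Integrable (fun x => ⟪q x, gradient φ x⟫_ℝ) (volume.restrict Ω) :=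
    memLp_one_iff_integrable.1 (M.memLp_of_eqOn hΩ (g := fun K x => ⟪f K x, gradient φ x⟫_ℝ)
      (fun K hK x hx => by simp only [hq K hK hx]) (fun K hK => (hfc K hK).inner hgc) 1)
  have hI2 : Integrable (fun x => M.glue (fun K => divg (f K)) x * φ x) (volume.restrict Ω) :=
    memLp_one_iff_integrable.1 (M.memLp_of_eqOn hΩ (g := fun K x => divg (f K) x * φ x)
      (fun K hK x hx => by simp only [hgl K hK hx]) (fun K hK => (hdc K hK).mul hφ1.continuous) 1)
  rw [M.setIntegral_eq_sum hΩ hI1, M.setIntegral_eq_sum hΩ hI2, eq_neg_iff_add_eq_zero, add_comm,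
    ← hG]
  congr 1
  · refine Finset.sum_congr rfl fun K hK => ?_
    rw [← restrict_interior_hull]
    exact setIntegral_congr_fun isOpen_interior.measurableSet fun x hx => by
      simp only [hgl K hK hx]
  · refine Finset.sum_congr rfl fun K hK => ?_
    rw [← restrict_interior_hull]
    exact setIntegral_congr_fun isOpen_interior.measurableSet fun x hx => by
      simp only [hq K hK hx]

/-- The weak divergence of a piecewise smooth field is the classical one in every cell. -/
theorem weakDiv_eq_on_cell (hΩ : IsConvexPolytopeDomain Ω) {q : E (n + 1) → E (n + 1)}
    {g : E (n + 1) → ℝ} (hqg : HasWeakDiv Ω q g) {K : Finset (E (n + 1))} (hK : K ∈ M.cells)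
    {f : E (n + 1) → E (n + 1)} (hf : ∀ i, ContDiff ℝ 1 fun y => f y i)
    (hq : EqOn q f (interior (hull K))) :
    ∀ᵐ x ∂volume.restrict (interior (hull K)), g x = divg f x := by
  have hKs := M.isSimplex hK
  have hfc := continuous_of_coord fun i => (hf i).continuous
  have hdc := continuous_divg hf
  have hKΩ := M.interior_hull_subset hΩ hK
  have hfin : IsFiniteMeasure (volume.restrict Ω) :=
    ⟨by simpa using hΩ.isBounded.measure_lt_top⟩
  have hgi : IntegrableOn g Ω := hqg.2.1.integrable (by norm_num)
  have hgK : IntegrableOn g (interior (hull K)) := hgi.mono_set hKΩ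
  have hdK : IntegrableOn (divg f) (interior (hull K)) :=
    (hdc.continuousOn.integrableOn_compact (isCompact_hull K)).mono_set interior_subset
  -- Fundamental lemma of the calculus of variations inside one cell: for test functions supported
  -- there, the Gauss theorem has no boundary terms.
  have h0 := isOpen_interior.ae_eq_zero_of_integral_contDiff_smul_eq_zero (μ := volume)
    (f := fun x => g x - divg f x) (U := interior (hull K))
    ((hgK.sub hdK).locallyIntegrableOn) ?_
  · rw [ae_restrict_iff' isOpen_interior.measurableSet]
    filter_upwards [h0] with x hx hxK
    exact sub_eq_zero.1 (hx hxK)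
  intro φ hφ hφc hφs
  have hφ1 : ContDiff ℝ 1 φ := hφ.of_le (by exact_mod_cast le_top)
  have hgc := continuous_gradient hφ1
  have hz (x) (hx : x ∉ interior (hull K)) : φ x = 0 :=
    image_eq_zero_of_notMem_tsupport fun h => hx (hφs h)
  have hz' (x) (hx : x ∉ interior (hull K)) : gradient φ x = 0 := by
    have : x ∉ tsupport (fderiv ℝ φ) := fun h => hx (hφs (tsupport_fderiv_subset ℝ h))
    rw [gradient, image_eq_zero_of_notMem_tsupport this, map_zero]
  have hw := hqg.2.2 φ ⟨hφ, hφc, hφs.trans hKΩ⟩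
  have hG := gauss_simplex_mul hKs hf hφ1
  rw [Finset.sum_eq_zero] at hG
  swap
  · intro p hp
    rw [faceMeasure, setIntegral_eq_zero_of_forall_eq_zero, mul_zero]
    intro x hx
    rw [hz x, mul_zero]
    intro hx'
    rw [hKs.interior_hull_eq] at hx'
    exact (hx' p hp).ne' ((hKs.mem_hull_erase hp).1 hx).2
  have hdφ0 : IntegrableOn (fun x => divg f x * φ x) (hull K) :=
    (hdc.mul hφ1.continuous).continuousOn.integrableOn_compact (isCompact_hull K)
  rw [integral_add hdφ0 (integrableOn_inner_gradient_test hfc hφ1 K), ← restrict_interior_hull] at hG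
  have hsub (u : E (n + 1) → ℝ) (hu : ∀ x ∉ interior (hull K), u x = 0) :
      ∫ x in Ω, u x = ∫ x in interior (hull K), u x :=
    setIntegral_eq_of_subset_of_forall_sdiff_eq_zero hΩ.isOpen.measurableSet hKΩ
      fun x hx => hu x hx.2
  have e1 : ∫ x in Ω, ⟪q x, gradient φ x⟫_ℝ = ∫ x in interior (hull K), ⟪f x, gradient φ x⟫_ℝ := by
    rw [hsub _ fun x hx => by rw [hz' x hx, inner_zero_right]]
    exact setIntegral_congr_fun isOpen_interior.measurableSet fun x hx => by simp only [hq hx]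
  have e2 : ∫ x in Ω, g x * φ x = ∫ x in interior (hull K), g x * φ x :=
    hsub _ fun x hx => by rw [hz x hx, mul_zero]
  have e3 : ∫ x, φ x • (g x - divg f x) =
      ∫ x in interior (hull K), (g x * φ x - divg f x * φ x) := by
    rw [← setIntegral_eq_integral_of_forall_compl_eq_zero (s := interior (hull K))
      (fun x hx => by rw [hz x hx, zero_smul])]
    exact integral_congr_ae (Filter.Eventually.of_forall fun x => by
      simp only [smul_eq_mul]; ring)
  have hgφ : IntegrableOn (fun x => g x * φ x) (interior (hull K)) := by
    obtain ⟨C, hC⟩ := hφc.exists_bound_of_continuous hφ1.continuous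
    exact hgK.mul_bdd hφ1.continuous.aestronglyMeasurable (Filter.Eventually.of_forall hC)
  have hdφ : IntegrableOn (fun x => divg f x * φ x) (interior (hull K)) :=
    hdφ0.mono_set interior_subset
  rw [e3, integral_sub hgφ hdφ, ← e2]
  rw [e1] at hw
  linarith

end

end SimplicialMesh

end CauchyFEM

namespace CauchyFEM

/-! ### Jumps and projections -/

/-- The jump over `F` with respect to the orientation given by the unit normal of `F`, expressed by
the extensions `g K` of the function in the cells. -/
noncomputable def SimplicialMesh.orientedJump {n : ℕ} {Ω : Set (E (n + 1))} (M : SimplicialMesh Ω)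
    (g : Finset (E (n + 1)) → E (n + 1) → ℝ) (F : Finset (E (n + 1))) (y : E (n + 1)) : ℝ :=
  ∑ K ∈ M.adj F, orient K F * g K y

/-- Up to a sign, the jump is the oriented jump almost everywhere on the face. -/
theorem SimplicialMesh.exists_jump_eq {n : ℕ} {Ω : Set (E (n + 1))} (M : SimplicialMesh Ω)
    (hΩ : IsConvexPolytopeDomain Ω) {x : E (n + 1) → ℝ} {g : Finset (E (n + 1)) → E (n + 1) → ℝ}
    (hx : ∀ K ∈ M.cells, EqOn x (g K) (interior (hull K))) (hg : ∀ K ∈ M.cells, Continuous (g K))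
    {F : Finset (E (n + 1))} (hF : F ∈ M.faces) :
    ∃ s : ℝ, s * s = 1 ∧ ∀ᵐ y ∂faceMeasure F, jump Ω x F y = s * M.orientedJump g F y := by
  obtain ⟨K, hK⟩ := M.adj_nonempty hF
  have hKa := hK
  rw [M.mem_adj] at hK
  obtain ⟨hK, hFK⟩ := hK
  obtain ⟨p, hp, rfl⟩ := M.exists_erase_eq hK hF hFK
  have hKs := M.isSimplex hK
  by_cases hFΩ : hull (K.erase p) ⊆ frontier Ω
  -- On a boundary face the jump is the plain trace, while the oriented jump carries the
  -- orientation, so this sign relates the two.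
  · refine ⟨orient K (K.erase p), orient_sq hKs hp, ?_⟩
    filter_upwards [ae_mem_openFace hKs hp] with y hy
    rw [SimplicialMesh.orientedJump, M.adj_eq_singleton hΩ hF hKa hFΩ, Finset.sum_singleton,
      ← mul_assoc, orient_sq hKs hp, one_mul, jump, if_pos hFΩ]
    have hyF := openFace_subset_hull hKs hp hy
    refine extendFrom_eq (frontier_subset_closure (hFΩ hyF)) ?_
    refine ((hg K hK).continuousWithinAt (s := Ω) (x := y)).tendsto.congr' ?_
    have h1 := M.eventually_subset_of_mem_hull hK hp hy
    rw [eventually_iff_exists_mem] at h1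
    obtain ⟨V, hV, h1⟩ := h1
    obtain ⟨U, hUV, hU, hyU⟩ := mem_nhds_iff.1 hV
    filter_upwards [self_mem_nhdsWithin, mem_nhdsWithin_of_mem_nhds (hU.mem_nhds hyU)] with z hz hzU
    refine (hx K hK ?_).symm
    -- Close to `y` no other cell occurs, so the part of `Ω` near `y` is an open subset of `K`.
    refine interior_maximal (s := hull K) (t := U ∩ Ω) ?_ (hU.inter hΩ.isOpen) ⟨hzU, hz⟩
    rintro w ⟨hw, hwΩ⟩
    have h2 := subset_closure hwΩ
    rw [← M.cover] at h2
    simp only [mem_iUnion, exists_prop] at h2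
    obtain ⟨L, hL, hwL⟩ := h2
    have h3 := M.adj_eq_of_subset_frontier hΩ hF hKa
      (M.mem_adj.2 ⟨hL, h1 w (hUV hw) L hL hwL⟩) hFΩ
    rwa [h3] at hwL
  -- The cell of orientation $+1$ is the one reached by subtracting the normal, which matches the
  -- order of the difference in `jump`.
  · refine ⟨1, by norm_num, ?_⟩
    obtain ⟨L, hL, hne⟩ := M.exists_adj_ne hΩ hF hKa hFΩ
    have hLa := hL
    rw [M.mem_adj] at hL
    obtain ⟨hL, hFL⟩ := hL
    obtain ⟨p', hp', h⟩ := M.exists_erase_eq hL hF hFL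
    have hLs := M.isSimplex hL
    have hor := M.orient_eq_neg hF hLa hKa hne
    filter_upwards [ae_mem_openFace hKs hp] with y hy
    have hy' := openFace_congr hKs hLs hp hp' h hy
    rw [SimplicialMesh.orientedJump, M.adj_eq_pair hF hKa hLa hne.symm, Finset.sum_pair hne.symm,
      hor, jump, if_neg hFΩ, one_mul]
    have h1 := eventually_mem_interior hKs hp hy
    have h2 := eventually_mem_interior hLs hp' hy'
    rw [← h, hor] at h2
    have hlim (s : ℝ) (J : Finset (E (n + 1))) (hJ : J ∈ M.cells)
        (hs : ∀ᶠ ε in 𝓝[>] (0 : ℝ), y - ε • s • unitNormal (K.erase p) ∈ interior (hull J)) :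
        Tendsto (fun ε : ℝ => x (y - ε • s • unitNormal (K.erase p))) (𝓝[>] 0) (𝓝 (g J y)) := by
      have hc : Continuous fun ε : ℝ => g J (y - ε • s • unitNormal (K.erase p)) := by
        have := hg J hJ
        fun_prop
      have h3 := (hc.tendsto 0).mono_left (nhdsWithin_le_nhds (s := Ioi 0))
      simp only [zero_smul, sub_zero] at h3
      refine h3.congr' ?_
      filter_upwards [hs] with ε hε using (hx J hJ hε).symm
    refine Tendsto.limUnder_eq ?_
    rcases mul_self_eq_one_iff.1 (orient_sq hKs hp) with h4 | h4
    · rw [h4] at h1 h2 ⊢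
      have := (hlim 1 K hK h1).sub (hlim (-1) L hL h2)
      simpa [sub_eq_add_neg] using this
    · rw [h4] at h1 h2 ⊢
      have := (hlim (- -1) L hL h2).sub (hlim (-1) K hK h1)
      simpa [sub_eq_add_neg, add_comm] using this

/-- Existence of the `L²`-projection onto a space of functions that, up to null sets, is the image
of a finite-dimensional space. -/
theorem l2proj_spec {d : ℕ} {G V : Type} [NormedAddCommGroup G] [InnerProductSpace ℝ G]
    [AddCommGroup V] [Module ℝ V] [Module.Finite ℝ V]
    {ν : Measure (E d)} {P : Set (E d → G)} (T : V →ₗ[ℝ] (E d → G))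
    (hT2 : ∀ v, MemLp (T v) 2 ν) (hTP : ∀ v, T v ∈ P) (hP : ∀ w ∈ P, ∃ v, w =ᵐ[ν] T v)
    {f : E d → G} (hf : MemLp f 2 ν) :
    l2proj ν P f ∈ P ∧ ∀ w ∈ P, ∫ y, ⟪l2proj ν P f y - f y, w y⟫_ℝ ∂ν = 0 := by
  refine Classical.epsilon_spec (p := fun g => g ∈ P ∧ ∀ w ∈ P, ∫ y, ⟪g y - f y, w y⟫_ℝ ∂ν = 0) ?_
  let S : V →ₗ[ℝ] Lp G 2 ν :=
    { toFun := fun v => (hT2 v).toLp (T v)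
      map_add' := fun v w => by
        rw [← MemLp.toLp_add]
        exact (MemLp.toLp_eq_toLp_iff _ _).2 (by rw [map_add])
      map_smul' := fun c v => by
        rw [RingHom.id_apply, ← MemLp.toLp_const_smul]
        exact (MemLp.toLp_eq_toLp_iff _ _).2 (by rw [map_smul]) }
  let U := LinearMap.range S
  have hU : FiniteDimensional ℝ U := inferInstance
  obtain ⟨v, hv⟩ := (U.starProjection_apply_mem (hf.toLp f))
  refine ⟨T v, hTP v, fun w hw => ?_⟩
  obtain ⟨u, hu⟩ := hP w hw
  have h1 := U.starProjection_inner_eq_zero (hf.toLp f) (S u) ⟨u, rfl⟩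
  rw [← hv] at h1
  rw [← neg_eq_zero, ← inner_neg_left, neg_sub, L2.inner_def] at h1
  rw [← h1]
  refine integral_congr_ae ?_
  filter_upwards [hu, (hT2 v).coeFn_toLp, (hT2 u).coeFn_toLp, hf.coeFn_toLp,
    Lp.coeFn_sub (S v) (hf.toLp f)] with y h2 h3 h4 h5 h6
  rw [h2, h6, Pi.sub_apply]
  change _ = ⟪(hT2 v).toLp (T v) y - _, (hT2 u).toLp (T u) y⟫_ℝ
  rw [h3, h4, h5]


end CauchyFEM

/-! ### Projections onto piecewise and face polynomials, and the broken norm -/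

namespace CauchyFEM

namespace SimplicialMesh

variable {d : ℕ} {Ω : Set (E d)} (M : SimplicialMesh Ω)

/-- Existence of the `L²(Ω)`-projection onto a space of piecewise defined functions. -/
theorem l2proj_glue_spec (hΩ : IsConvexPolytopeDomain Ω) {G V : Type} [NormedAddCommGroup G]
    [InnerProductSpace ℝ G] [SecondCountableTopology G] [AddCommGroup V] [Module ℝ V]
    [Module.Finite ℝ V] (T : V →ₗ[ℝ] (E d → G)) (hT : ∀ v, Continuous (T v)) {P : Set (E d → G)}
    (hP : ∀ q, q ∈ P ↔ ∀ K ∈ M.cells, ∃ v, EqOn q (T v) (interior (hull K))) {f : E d → G}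
    (hf : MemLp f 2 (volume.restrict Ω)) :
    l2proj (volume.restrict Ω) P f ∈ P ∧
      ∀ w ∈ P, ∫ y in Ω, ⟪l2proj (volume.restrict Ω) P f y - f y, w y⟫_ℝ = 0 := by
  classical
  let ext (v : M.cells → V) (K : Finset (E d)) : V := if h : K ∈ M.cells then v ⟨K, h⟩ else 0
  let S : (M.cells → V) →ₗ[ℝ] (E d → G) :=
    { toFun := fun v => M.glue fun K => T (ext v K)
      map_add' := fun v w => by
        ext1 y
        simp only [glue, Pi.add_apply, ← Finset.sum_add_distrib]
        refine Finset.sum_congr rfl fun K hK => ?_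
        by_cases hy : y ∈ interior (hull K) <;> simp [ext, hK, hy]
      map_smul' := fun c v => by
        ext1 y
        simp only [glue, Pi.smul_apply, Finset.smul_sum, RingHom.id_apply]
        refine Finset.sum_congr rfl fun K hK => ?_
        by_cases hy : y ∈ interior (hull K) <;> simp [ext, hK, hy] }
  have hS (v) (K) (hK : K ∈ M.cells) : EqOn (S v) (T (ext v K)) (interior (hull K)) :=
    M.glue_eqOn (fun K => T (ext v K)) hK
  refine l2proj_spec S (fun v => M.memLp_of_eqOn hΩ (hS v) (fun K _ => hT _) 2)
    (fun v => (hP _).2 fun K hK => ⟨_, hS v K hK⟩) (fun w hw => ?_) hf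
  choose! v hv using (hP w).1 hw
  refine ⟨fun K => v K, (M.ae_restrict_iff_cells hΩ).2 fun K hK => ?_⟩
  refine ae_restrict_of_forall_mem isOpen_interior.measurableSet fun y hy => ?_
  rw [hv K hK hy, hS _ K hK hy]
  simp [ext, hK]

theorem mem_X_iff {k : ℕ} {q : E d → ℝ} : q ∈ M.X k ↔ ∀ K ∈ M.cells,
    ∃ v : polySub d k, EqOn q ((polySub d k).subtype v) (interior (hull K)) := by
  refine forall₂_congr fun K hK => ⟨?_, ?_⟩
  · rintro ⟨f, hf, h⟩
    exact ⟨⟨f, mem_polySub.2 hf⟩, h⟩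
  · rintro ⟨v, h⟩
    exact ⟨v, mem_polySub.1 v.2, h⟩

theorem projX_mem (hΩ : IsConvexPolytopeDomain Ω) (k : ℕ) {f : E d → ℝ}
    (hf : MemLp f 2 (volume.restrict Ω)) : M.projX k f ∈ M.X k :=
  (M.l2proj_glue_spec hΩ (polySub d k).subtype (fun v => continuous_polyFun (mem_polySub.1 v.2))
    (fun _ => M.mem_X_iff) hf).1

/-- Vector fields with polynomial components. -/
noncomputable def _root_.CauchyFEM.polyVec (d k : ℕ) :
    (Fin d → polySub d k) →ₗ[ℝ] (E d → E d) where
  toFun p y := WithLp.toLp 2 fun i => (p i).1 y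
  map_add' p q := by ext y i; simp
  map_smul' c p := by ext y i; simp

theorem mem_XVec_iff {k : ℕ} {q : E d → E d} : q ∈ M.XVec k ↔ ∀ K ∈ M.cells,
    ∃ v : Fin d → polySub d k, EqOn q (polyVec d k v) (interior (hull K)) := by
  constructor
  · intro h K hK
    choose f hf hqf using fun i => h i K hK
    refine ⟨fun i => ⟨f i, mem_polySub.2 (hf i)⟩, fun y hy => ?_⟩
    ext i
    exact hqf i hy
  · intro h i K hK
    obtain ⟨v, hv⟩ := h K hK
    exact ⟨v i, mem_polySub.1 (v i).2, fun y hy => by simp [hv hy, polyVec]⟩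

/-- The projection `π_{X,l-1}` of vector fields yields piecewise polynomials, multiplication of which
by affine functions stays in degree `l`. -/
theorem projVecPred_spec (hΩ : IsConvexPolytopeDomain Ω) (l : ℕ) {f : E d → E d}
    (hf : MemLp f 2 (volume.restrict Ω)) :
    (∃ G : Finset (E d) → E d → E d,
      (∀ K ∈ M.cells, EqOn (M.projVecPred l f) (G K) (interior (hull K))) ∧
      ∀ K ∈ M.cells, ∀ i, ∀ c ∈ polyFun d 1, (fun y => c y * G K y i) ∈ polyFun d l) ∧
    ∀ g : E d → E d, MemLp g 2 (volume.restrict Ω) →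
      ∫ y in Ω, ⟪M.projVecPred l f y - f y, M.projVecPred l g y⟫_ℝ = 0 := by
  cases l with
  | zero =>
    -- For $l=0$ the convention $\pi_{X,-1}=0$ gives zero pieces, and zero times an affine function
    -- still has degree 0.
    refine ⟨⟨fun _ => 0, fun K _ y _ => rfl, fun K _ i c _ => ?_⟩, fun g _ => ?_⟩
    · simpa using polyFun_zero
    · simp [projVecPred]
  | succ l =>
    have hc (v) : Continuous (polyVec d l v) :=
      continuous_of_coord fun i => continuous_polyFun (mem_polySub.1 (v i).2)
    have h (g : E d → E d) (hg : MemLp g 2 (volume.restrict Ω)) :=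
      M.l2proj_glue_spec hΩ (polyVec d l) hc (fun _ => M.mem_XVec_iff) hg
    refine ⟨?_, fun g hg => (h f hf).2 _ (h g hg).1⟩
    choose! v hv using M.mem_XVec_iff.1 (h f hf).1
    refine ⟨fun K => polyVec d l (v K), hv, fun K _ i c hc => ?_⟩
    rw [add_comm l 1]
    exact polyFun_mul hc (mem_polySub.1 (v K i).2)

end SimplicialMesh

/-- The defining property of the face projection. -/
theorem faceProj_spec {n : ℕ} {K : Finset (E (n + 1))} (hK : IsSimplex K) {p : E (n + 1)}
    (hp : p ∈ K) (l : ℕ) {f : E (n + 1) → ℝ} (hf : MemLp f 2 (faceMeasure (K.erase p))) :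
    faceProj l (K.erase p) f ∈ polyFun (n + 1) l ∧ ∀ w ∈ polyFun (n + 1) l,
      ∫ y, (faceProj l (K.erase p) f y - f y) * w y ∂faceMeasure (K.erase p) = 0 := by
  have h := l2proj_spec (ν := faceMeasure (K.erase p)) (P := polyFun (n + 1) l)
    (polySub (n + 1) l).subtype
    (fun v => memLp_faceMeasure hK hp (continuous_polyFun (mem_polySub.1 v.2)) 2)
    (fun v => mem_polySub.1 v.2) (fun w hw => ⟨⟨w, mem_polySub.2 hw⟩, Filter.EventuallyEq.rfl⟩) hf
  refine ⟨h.1, fun w hw => ?_⟩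
  rw [← h.2 w hw]
  refine integral_congr_ae (Filter.Eventually.of_forall fun y => ?_)
  simp [faceProj, mul_comm]

theorem SimplicialMesh.h_nonneg {d : ℕ} {Ω : Set (E d)} (M : SimplicialMesh Ω) : 0 ≤ M.h := by
  refine Real.sSup_nonneg ?_
  rintro _ ⟨K, _, rfl⟩
  exact Metric.diam_nonneg

/-- The broken norm of a piecewise polynomial, in terms of the projected oriented jumps. -/
theorem SimplicialMesh.brokenH1Norm_sq {n : ℕ} {Ω : Set (E (n + 1))} (M : SimplicialMesh Ω)
    (hΩ : IsConvexPolytopeDomain Ω) (Sig : Set (E (n + 1))) (l : ℕ) {x : E (n + 1) → ℝ}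
    {g : Finset (E (n + 1)) → E (n + 1) → ℝ}
    (hx : ∀ K ∈ M.cells, EqOn x (g K) (interior (hull K))) (hg : ∀ K ∈ M.cells, Continuous (g K)) :
    ∃ γ : Finset (E (n + 1)) → E (n + 1) → ℝ,
      (∀ F ∈ M.faces, γ F ∈ polyFun (n + 1) l ∧ ∀ w ∈ polyFun (n + 1) l,
        ∫ y, γ F y * w y ∂faceMeasure F = ∫ y, M.orientedJump g F y * w y ∂faceMeasure F) ∧
      M.brokenH1Norm Sig l x ^ 2 = (∑ K ∈ M.cells, ∫ y in hull K, ‖gradient (g K) y‖ ^ 2) +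
        ∑ F ∈ M.faces \ M.facesOn Sig, M.h⁻¹ * ∫ y, γ F y ^ 2 ∂faceMeasure F := by
  have key (F) (hF : F ∈ M.faces) : ∃ γ : E (n + 1) → ℝ, (γ ∈ polyFun (n + 1) l ∧
      ∀ w ∈ polyFun (n + 1) l,
        ∫ y, γ y * w y ∂faceMeasure F = ∫ y, M.orientedJump g F y * w y ∂faceMeasure F) ∧
      ∫ y, (M.h ^ (-(1 / 2) : ℝ) * faceProj l F (jump Ω x F) y) ^ 2 ∂faceMeasure F =
        M.h⁻¹ * ∫ y, γ y ^ 2 ∂faceMeasure F := by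
    obtain ⟨s, hs, hj⟩ := M.exists_jump_eq hΩ hx hg hF
    obtain ⟨K, hK⟩ := M.adj_nonempty hF
    rw [M.mem_adj] at hK
    obtain ⟨hK, hFK⟩ := hK
    obtain ⟨p, hp, rfl⟩ := M.exists_erase_eq hK hF hFK
    have hKs := M.isSimplex hK
    have hJc : Continuous (M.orientedJump g (K.erase p)) := by
      unfold SimplicialMesh.orientedJump
      refine continuous_finsetSum _ fun L hL => ?_
      have := hg L (M.mem_adj.1 hL).1
      fun_prop
    have hJm : MemLp (jump Ω x (K.erase p)) 2 (faceMeasure (K.erase p)) :=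
      (memLp_congr_ae hj).2 (memLp_faceMeasure hKs hp (hJc.const_mul s) 2)
    obtain ⟨h1, h2⟩ := faceProj_spec hKs hp l hJm
    have hpc := continuous_polyFun h1
    -- Since $s^2=1$, this factor changes the projected jump into a projection of the oriented jump
    -- and leaves its square unchanged.
    refine ⟨fun y => s * faceProj l (K.erase p) (jump Ω x (K.erase p)) y,
      ⟨polyFun_const_mul s h1, fun w hw => ?_⟩, ?_⟩
    · have hwc := continuous_polyFun hw
      have h3 := h2 w hw
      have h4 : ∫ y, (faceProj l (K.erase p) (jump Ω x (K.erase p)) y -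
          s * M.orientedJump g (K.erase p) y) * w y ∂faceMeasure (K.erase p) = 0 := by
        rw [← h3]
        refine integral_congr_ae ?_
        filter_upwards [hj] with y hy
        rw [hy]
      rw [← sub_eq_zero, ← integral_sub (integrable_faceMeasure hKs hp (by fun_prop))
        (integrable_faceMeasure hKs hp (by fun_prop)), ← mul_zero s, ← h4, ← integral_const_mul]
      refine integral_congr_ae (Filter.Eventually.of_forall fun y => ?_)
      change s * _ * w y - _ * w y = s * ((_ - s * _) * w y)
      linear_combination (M.orientedJump g (K.erase p) y * w y) * hs
    · rw [← integral_const_mul]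
      refine integral_congr_ae (Filter.Eventually.of_forall fun y => ?_)
      have h5 : (M.h ^ (-(1 / 2) : ℝ)) ^ 2 = M.h⁻¹ := by
        rw [← Real.rpow_natCast, ← Real.rpow_mul M.h_nonneg]
        norm_num
        exact Real.rpow_neg_one _
      change (_ * _) ^ 2 = _ * (s * _) ^ 2
      rw [mul_pow, h5, mul_pow, pow_two s, hs, one_mul]
  choose! γ hγ hγ2 using key
  refine ⟨γ, hγ, ?_⟩
  rw [SimplicialMesh.brokenH1Norm, Real.sq_sqrt]
  · congr 1
    · refine Finset.sum_congr rfl fun K hK => ?_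
      rw [← restrict_interior_hull]
      refine setIntegral_congr_fun isOpen_interior.measurableSet fun y hy => ?_
      simp only [gradient_congr_of_eqOn isOpen_interior (hx K hK) hy]
    · exact Finset.sum_congr rfl fun F hF => hγ2 F (Finset.mem_sdiff.1 hF).1
  · refine add_nonneg (Finset.sum_nonneg fun K _ => integral_nonneg fun y => ?_)
      (Finset.sum_nonneg fun F _ => integral_nonneg fun y => ?_) <;> positivity

end CauchyFEM

namespace CauchyFEM

/-! ### Square integrable functions -/

section L2

variable {X G : Type*} [MeasurableSpace X] [NormedAddCommGroup G] [InnerProductSpace ℝ G]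
  {μ : Measure X} {f g : X → G}

theorem integrable_inner_of_memLp (hf : MemLp f 2 μ) (hg : MemLp g 2 μ) :
    Integrable (fun x => ⟪f x, g x⟫_ℝ) μ := by
  refine (L2.integrable_inner (𝕜 := ℝ) (hf.toLp f) (hg.toLp g)).congr ?_
  filter_upwards [hf.coeFn_toLp, hg.coeFn_toLp] with x h1 h2
  rw [h1, h2]

theorem integrable_norm_sq_of_memLp (hf : MemLp f 2 μ) : Integrable (fun x => ‖f x‖ ^ 2) μ := by
  simpa only [real_inner_self_eq_norm_sq] using integrable_inner_of_memLp hf hf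

end L2

/-! ### Raviart-Thomas fields -/

theorem weakDiv_spec {d : ℕ} {Ω : Set (E d)} {q : E d → E d} (h : MemHdiv Ω q) :
    HasWeakDiv Ω q (weakDiv Ω q) := Classical.epsilon_spec h

theorem weakGrad_spec {d : ℕ} {Ω : Set (E d)} {v : E d → ℝ} (h : MemH1 Ω v) :
    HasWeakGrad Ω v (weakGrad Ω v) := Classical.epsilon_spec h

theorem memLp_testFunction {d : ℕ} {Ω : Set (E d)} {φ : E d → ℝ} (h : IsTestFunction Ω φ)
    {p : ENNReal} {ν : Measure (E d)} [IsFiniteMeasureOnCompacts ν] :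
    MemLp φ p ν ∧ MemLp (gradient φ) p ν := by
  have hφ1 : ContDiff ℝ 1 φ := h.1.of_le (by exact_mod_cast le_top)
  have hs : HasCompactSupport (gradient φ) := by
    refine (h.2.1.fderiv (𝕜 := ℝ)).comp_left (g := (InnerProductSpace.toDual ℝ (E d)).symm) ?_
    simp
  exact ⟨hφ1.continuous.memLp_of_hasCompactSupport h.2.1,
    (continuous_gradient hφ1).memLp_of_hasCompactSupport hs⟩

theorem HasWeakDiv.add_smul {d : ℕ} {Ω : Set (E d)} {q η : E d → E d} {g g' : E d → ℝ}
    (hq : HasWeakDiv Ω q g) (hη : HasWeakDiv Ω η g') (δ : ℝ) :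
    HasWeakDiv Ω (fun y => q y + δ • η y) fun y => g y + δ * g' y := by
  obtain ⟨hg1, hg2, hg3⟩ := hq
  obtain ⟨hg1', hg2', hg3'⟩ := hη
  refine ⟨hg1.add (hg1'.const_smul δ), hg2.add (hg2'.const_smul δ), fun φ hφ => ?_⟩
  obtain ⟨h1, h2⟩ := memLp_testFunction hφ (p := 2) (ν := volume.restrict Ω)
  have e1 := hg3 φ hφ
  have e2 := hg3' φ hφ
  simp only [inner_add_left, real_inner_smul_left, add_mul, mul_assoc]
  have hi : Integrable (fun y => ⟪q y, gradient φ y⟫_ℝ) (volume.restrict Ω) := integrable_inner_of_memLp hg1 h2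
  have hi' : Integrable (fun y => ⟪η y, gradient φ y⟫_ℝ) (volume.restrict Ω) :=
    integrable_inner_of_memLp hg1' h2
  have hj : Integrable (fun y => g y * φ y) (volume.restrict Ω) := hg2.integrable_mul h1
  have hj' : Integrable (fun y => g' y * φ y) (volume.restrict Ω) := hg2'.integrable_mul h1
  rw [integral_add hi (hi'.const_mul δ), integral_add hj (hj'.const_mul δ), integral_const_mul,
    integral_const_mul, e1, e2]
  ring

namespace SimplicialMesh

variable {d : ℕ} {Ω : Set (E d)} (M : SimplicialMesh Ω)

/-- For the estimates only degrees matter: the components have degree $l+1$, so differentiating them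
brings the divergence back to degree $l$. -/
theorem exists_pieces_of_mem_RT {l : ℕ} {q : E d → E d} (hq : q ∈ M.RT l) :
    ∃ f : Finset (E d) → E d → E d, (∀ K ∈ M.cells, EqOn q (f K) (interior (hull K))) ∧
      (∀ K ∈ M.cells, ∀ i, (fun y => f K y i) ∈ polyFun d (l + 1)) ∧
      ∀ K ∈ M.cells, divg (f K) ∈ polyFun d l := by
  choose! a b ha hb hab using hq.2
  have hf (K) (hK : K ∈ M.cells) (i) : (fun y : E d =>
      MvPolynomial.eval y (a K i) + y i * MvPolynomial.eval y (b K)) ∈ polyFun d (l + 1) := by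
    refine polyFun_add ⟨a K i, (ha K hK i).trans (by omega), fun _ => rfl⟩ ?_
    rw [add_comm l 1]
    exact polyFun_mul (polyFun_coord i) ⟨b K, (hb K hK).totalDegree_le, fun _ => rfl⟩
  refine ⟨fun K y => WithLp.toLp 2 fun i => MvPolynomial.eval y (a K i) +
    y i * MvPolynomial.eval y (b K), fun K hK y hy => ?_, hf, fun K hK => ?_⟩
  · ext i
    exact hab K hK y hy i
  · exact polyFun_sum fun i _ => polyFun_gradient (hf K hK i) i

theorem mem_facesOn {Sig : Set (E d)} {F : Finset (E d)} :
    F ∈ M.facesOn Sig ↔ F ∈ M.faces ∧ hull F ⊆ closure Sig := by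
  simp [facesOn]

theorem continuous_pieces {k : ℕ} {f : E d → E d} (hf : ∀ i, (fun y => f y i) ∈ polyFun d k) :
    Continuous f :=
  continuous_of_coord fun i => continuous_polyFun (hf i)

theorem add_smul_mem_D0 {Sig : Set (E d)} {l : ℕ} {q η : E d → E d} (hq : q ∈ M.D0 Sig l)
    (hη : η ∈ M.D0 Sig l) (δ : ℝ) : (fun y => q y + δ • η y) ∈ M.D0 Sig l := by
  refine ⟨⟨⟨_, (weakDiv_spec hq.1.1).add_smul (weakDiv_spec hη.1.1) δ⟩, fun K hK => ?_⟩, fun F hF K hK hFK y hy => ?_⟩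
  · obtain ⟨a, b, ha, hb, hab⟩ := hq.1.2 K hK
    obtain ⟨a', b', ha', hb', hab'⟩ := hη.1.2 K hK
    refine ⟨fun i => a i + MvPolynomial.C δ * a' i, b + MvPolynomial.C δ * b', fun i => ?_, ?_, ?_⟩
    · refine (MvPolynomial.totalDegree_add _ _).trans (max_le (ha i) ?_)
      refine (MvPolynomial.totalDegree_mul _ _).trans ?_
      simpa using ha' i
    · refine hb.add ?_
      simpa using (MvPolynomial.isHomogeneous_C (Fin d) δ).mul hb'
    · intro y hy i
      have h1 := hab y hy i
      have h2 := hab' y hy i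
      simp only [PiLp.add_apply, PiLp.smul_apply, h1, h2, map_add, map_mul, MvPolynomial.eval_C,
        smul_eq_mul]
      ring
  · obtain ⟨f, hf, hfp, -⟩ := M.exists_pieces_of_mem_RT hq.1
    obtain ⟨f', hf', hfp', -⟩ := M.exists_pieces_of_mem_RT hη.1
    have hc := continuous_pieces (hfp K hK)
    have hc' := continuous_pieces (hfp' K hK)
    have hyK : y ∈ hull K := convexHull_mono (by exact_mod_cast hFK) hy
    have h1 := hq.2 F hF K hK hFK y hy
    have h2 := hη.2 F hF K hK hFK y hy
    rw [M.cellTrace_eq hK (hf K hK) hc hyK] at h1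
    rw [M.cellTrace_eq hK (hf' K hK) hc' hyK] at h2
    rw [M.cellTrace_eq hK (g := fun y => f K y + δ • f' K y)
      (fun z hz => by simp only [hf K hK hz, hf' K hK hz]) (by fun_prop) hyK, inner_add_left,
      real_inner_smul_left, h1, h2]
    simp

/-- A sum of fields `c_p(y) (y - p)` with polynomials `c_p` of degree at most `l` has the form of a
Raviart-Thomas field. -/
theorem _root_.CauchyFEM.exists_RT_form {l : ℕ} (K : Finset (E d)) {c : E d → E d → ℝ}
    (hc : ∀ p ∈ K, c p ∈ polyFun d l) :
    ∃ (a : Fin d → MvPolynomial (Fin d) ℝ) (b : MvPolynomial (Fin d) ℝ),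
      (∀ i, (a i).totalDegree ≤ l) ∧ b.IsHomogeneous l ∧
      ∀ y : E d, ∀ i, (∑ p ∈ K, c p y • (y - p)) i =
        MvPolynomial.eval y (a i) + y i * MvPolynomial.eval y b := by
  choose! C hC hCe using hc
  -- In $c_p(y)(y_i-p_i)$ only the degree-$l$ part of $c_p$ times $y_i$ exceeds degree $l$. These
  -- parts form $b$ and the rest goes into $a$.
  refine ⟨fun i => ∑ p ∈ K, ((C p - MvPolynomial.homogeneousComponent l (C p)) * MvPolynomial.X i -
    MvPolynomial.C (p i) * C p), ∑ p ∈ K, MvPolynomial.homogeneousComponent l (C p),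
    fun i => ?_, ?_, fun y i => ?_⟩
  · refine MvPolynomial.totalDegree_finsetSum_le fun p hp => ?_
    refine (MvPolynomial.totalDegree_sub _ _).trans (max_le ?_ ?_)
    · have hdeg : ∀ s ∈ (C p - MvPolynomial.homogeneousComponent l (C p)).support,
          s.degree < l := by
        intro s hs
        rw [MvPolynomial.mem_support_iff, MvPolynomial.coeff_sub,
          MvPolynomial.coeff_homogeneousComponent] at hs
        by_contra! hle
        rcases hle.eq_or_lt with h | h
        · simp [← h] at hs
        · rw [if_neg h.ne', sub_zero] at hs
          have : s.degree ≤ (C p).totalDegree :=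
            MvPolynomial.le_totalDegree (MvPolynomial.mem_support_iff.2 hs)
          exact absurd (this.trans (hC p hp)) (not_le.2 h)
      by_cases h0 : C p - MvPolynomial.homogeneousComponent l (C p) = 0
      · simp [h0]
      · refine (MvPolynomial.totalDegree_mul _ _).trans ?_
        rw [MvPolynomial.totalDegree_X]
        obtain ⟨s, hs⟩ := MvPolynomial.support_nonempty.2 h0
        have hl : 0 < l := (Nat.zero_le _).trans_lt (hdeg s hs)
        have : (C p - MvPolynomial.homogeneousComponent l (C p)).totalDegree < l :=
          (Finset.sup_lt_iff hl).2 hdeg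
        omega
    · refine (MvPolynomial.totalDegree_mul _ _).trans ?_
      simpa using hC p hp
  · exact MvPolynomial.IsHomogeneous.sum _ _ _ fun p _ =>
      MvPolynomial.homogeneousComponent_isHomogeneous l (C p)
  · simp only [WithLp.ofLp_sum, Finset.sum_apply, map_sum, map_sub, map_mul, MvPolynomial.eval_X,
      MvPolynomial.eval_C, Finset.mul_sum, ← Finset.sum_add_distrib]
    refine Finset.sum_congr rfl fun p hp => ?_
    rw [hCe p hp]
    simp
    ring

end SimplicialMesh

namespace SimplicialMesh

variable {n : ℕ} {Ω : Set (E (n + 1))} (M : SimplicialMesh Ω) (hΩ : IsConvexPolytopeDomain Ω)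
include hΩ

theorem weakDiv_eq_divg {q : E (n + 1) → E (n + 1)} (hq : MemHdiv Ω q)
    {f : Finset (E (n + 1)) → E (n + 1) → E (n + 1)}
    (hf : ∀ K ∈ M.cells, ∀ i, ContDiff ℝ 1 fun y => f K y i)
    (hqf : ∀ K ∈ M.cells, EqOn q (f K) (interior (hull K))) :
    weakDiv Ω q =ᵐ[volume.restrict Ω] M.glue fun K => divg (f K) := by
  refine (M.ae_restrict_iff_cells hΩ).2 fun K hK => ?_
  filter_upwards [M.weakDiv_eq_on_cell hΩ (weakDiv_spec hq) hK (hf K hK) (hqf K hK),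
    ae_restrict_mem isOpen_interior.measurableSet] with y hy hyK
  rw [hy]
  exact (M.glue_eqOn (fun K => divg (f K)) hK hyK).symm

/-- Gluing Raviart-Thomas fields with common normal components. -/
theorem glue_mem_D0 {Sig : Set (E (n + 1))} {l : ℕ}
    {c : Finset (E (n + 1)) → E (n + 1) → E (n + 1) → ℝ}
    (hc : ∀ K ∈ M.cells, ∀ p ∈ K, c K p ∈ polyFun (n + 1) l)
    {g : Finset (E (n + 1)) → E (n + 1) → ℝ}
    (hg : ∀ F ∈ M.faces, ∀ K ∈ M.adj F, ∀ y ∈ hull F,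
      ⟪unitNormal F, ∑ p ∈ K, c K p y • (y - p)⟫_ℝ = g F y)
    (hgS : ∀ F ∈ M.facesOn Sig, ∀ y, g F y = 0) :
    (M.glue fun K y => ∑ p ∈ K, c K p y • (y - p)) ∈ M.D0 Sig l := by
  set f : Finset (E (n + 1)) → E (n + 1) → E (n + 1) := fun K y => ∑ p ∈ K, c K p y • (y - p)
  have hgl (K) (hK : K ∈ M.cells) := M.glue_eqOn f hK
  have hf (K) (hK : K ∈ M.cells) (i) : (fun y => f K y i) ∈ polyFun (n + 1) (l + 1) := by
    have : (fun y => f K y i) = fun y => ∑ p ∈ K, c K p y * (y i - p i) := by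
      ext y; simp [f]
    rw [this]
    exact polyFun_sum fun p hp => polyFun_mul (hc K hK p hp)
      (polyFun_sub (polyFun_coord i) (polyFun_const _))
  refine ⟨⟨⟨_, M.hasWeakDiv_of_normal hΩ (fun K hK i => contDiff_polyFun (hf K hK i)) hgl hg⟩,
    fun K hK => ?_⟩, fun F hF K hK hFK y hy => ?_⟩
  · obtain ⟨a, b, ha, hb, hab⟩ := exists_RT_form K (hc K hK)
    refine ⟨a, b, ha, hb, fun y hy i => ?_⟩
    rw [hgl K hK hy]
    exact hab y i
  · have hyK : y ∈ hull K := convexHull_mono (by exact_mod_cast hFK) hy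
    rw [M.cellTrace_eq hK (hgl K hK) (continuous_pieces (hf K hK)) hyK, real_inner_comm,
      hg F (M.mem_facesOn.1 hF).1 K (M.mem_adj.2 ⟨hK, hFK⟩) y hy, hgS F hF]

end SimplicialMesh

end CauchyFEM

namespace CauchyFEM

/-! ### Inverse and trace estimates on a shape regular cell -/

/-- A simplex of diameter at most `h` containing a ball of radius `ρ h`. -/
structure CellReg {d : ℕ} (ρ h : ℝ) (K : Finset (E d)) : Prop where
  simplex : IsSimplex K
  h_pos : 0 < h
  dist_le : ∀ x ∈ hull K, ∀ y ∈ hull K, dist x y ≤ h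
  exists_ball : ∃ c, Metric.ball c (ρ * h) ⊆ hull K

theorem continuous_polyFun_sq {d N : ℕ} {p : E d → ℝ} (hp : p ∈ polyFun d N) :
    Continuous fun y => p y ^ 2 :=
  (continuous_polyFun hp).pow 2

theorem integrableOn_hull {d : ℕ} {G : Type*} [NormedAddCommGroup G] {u : E d → G}
    (hu : Continuous u) (K : Finset (E d)) : IntegrableOn u (hull K) :=
  hu.continuousOn.integrableOn_compact (isCompact_hull K)

theorem measurableSet_hull {d : ℕ} (K : Finset (E d)) : MeasurableSet (hull K) :=
  (isCompact_hull K).isClosed.measurableSet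

theorem setIntegral_mono_of_continuous {d : ℕ} {u : E d → ℝ} (hu : Continuous u) (h0 : ∀ x, 0 ≤ u x)
    {s : Set (E d)} {K : Finset (E d)} (hs : s ⊆ hull K) :
    ∫ x in s, u x ≤ ∫ x in hull K, u x :=
  setIntegral_mono_set (integrableOn_hull hu K)
    (Filter.Eventually.of_forall h0) (Filter.Eventually.of_forall hs)

namespace CellReg

variable {d : ℕ} {ρ h : ℝ} {K : Finset (E d)}

theorem setIntegral_hull_le (hR : CellReg ρ h K) {u : E d → ℝ} (hu : Continuous u) {C : ℝ}
    (hC : 0 ≤ C) (huC : ∀ x ∈ hull K, u x ≤ C) :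
    ∫ x in hull K, u x ≤ C * (h ^ d * volume.real (Metric.ball (0 : E d) 1)) := by
  have h1 : ∫ x in hull K, u x ≤ ∫ x in hull K, C :=
    setIntegral_mono_on (integrableOn_hull hu K)
      (integrableOn_const (isCompact_hull K).measure_lt_top.ne) (measurableSet_hull K) huC
  refine h1.trans ?_
  rw [setIntegral_const, smul_eq_mul, mul_comm]
  refine mul_le_mul_of_nonneg_left ?_ hC
  obtain ⟨y, hy⟩ := hR.simplex.interior_nonempty
  have hy := interior_subset hy
  calc volume.real (hull K) ≤ volume.real (Metric.closedBall y h) :=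
        measureReal_mono (fun x hx => hR.dist_le x hx y hy)
          Metric.isBounded_closedBall.measure_lt_top.ne
    _ = _ := by rw [Measure.addHaar_real_closedBall _ _ hR.h_pos.le]; simp

end CellReg

/-- The cell contains a ball of radius $\rho h$ and lies in the concentric closed ball of radius
$h$, so the estimate on balls extrapolates from the former to the latter. -/
theorem exists_cell_sq_le (d N : ℕ) {ρ : ℝ} (hρ : 0 < ρ) :
    ∃ C : ℝ, 0 < C ∧ ∀ (K : Finset (E d)) (h : ℝ), CellReg ρ h K → ∀ p ∈ polyFun d N,
      ∀ x ∈ hull K, p x ^ 2 ≤ C * ((h ^ d)⁻¹ * ∫ y in hull K, p y ^ 2) := by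
  obtain ⟨C, hC, H⟩ := exists_sq_le_ball d N 1 hρ
  refine ⟨C, hC, fun K h hR p hp x hx => ?_⟩
  obtain ⟨c, hc⟩ := hR.exists_ball
  have hh := hR.h_pos
  have hcK : c ∈ hull K := hc (Metric.mem_ball_self (by positivity))
  refine (H p hp c h hh x (by simpa using hR.dist_le x hx c hcK)).trans ?_
  have := setIntegral_mono_of_continuous (continuous_polyFun_sq hp) (fun x => sq_nonneg _) hc
  gcongr

theorem exists_cell_gradient_le (d N : ℕ) {ρ : ℝ} (hρ : 0 < ρ) :
    ∃ C : ℝ, 0 < C ∧ ∀ (K : Finset (E d)) (h : ℝ), CellReg ρ h K → ∀ p ∈ polyFun d N,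
      ∫ y in hull K, ‖gradient p y‖ ^ 2 ≤ C * ((h ^ 2)⁻¹ * ∫ y in hull K, p y ^ 2) := by
  obtain ⟨C, hC, H⟩ := exists_gradient_sq_le_ball d N 1 hρ
  refine ⟨C * (volume.real (Metric.ball (0 : E d) 1) + 1), by positivity, fun K h hR p hp => ?_⟩
  obtain ⟨c, hc⟩ := hR.exists_ball
  have hh := hR.h_pos
  have hcK : c ∈ hull K := hc (Metric.mem_ball_self (by positivity))
  have hI := setIntegral_mono_of_continuous (continuous_polyFun_sq hp) (fun x => sq_nonneg _) hc
  have hI0 : 0 ≤ ∫ y in hull K, p y ^ 2 := integral_nonneg fun y => sq_nonneg _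
  refine (hR.setIntegral_hull_le ((continuous_gradient (contDiff_polyFun hp)).norm.pow 2)
    (C := C * ((h ^ 2)⁻¹ * ((h ^ d)⁻¹ * ∫ y in hull K, p y ^ 2))) (by positivity)
    fun x hx => ?_).trans ?_
  · refine (H p hp c h hh x (by simpa using hR.dist_le x hx c hcK)).trans ?_
    gcongr
  · have : C * ((h ^ 2)⁻¹ * ((h ^ d)⁻¹ * ∫ y in hull K, p y ^ 2)) *
        (h ^ d * volume.real (Metric.ball (0 : E d) 1)) =
        C * volume.real (Metric.ball (0 : E d) 1) * ((h ^ 2)⁻¹ * ∫ y in hull K, p y ^ 2) := by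
      field_simp
    rw [this]
    have : 0 ≤ C * ((h ^ 2)⁻¹ * ∫ y in hull K, p y ^ 2) := by positivity
    nlinarith

theorem ae_faceMeasure_mem {d : ℕ} (F : Finset (E d)) : ∀ᵐ x ∂faceMeasure F, x ∈ hull F :=
  ae_restrict_mem (measurableSet_hull F)

theorem hull_mono {d : ℕ} {F K : Finset (E d)} (h : F ⊆ K) : hull F ⊆ hull K :=
  convexHull_mono (Finset.coe_subset.2 h)

/-- The pointwise bound costs $h^{-(n+1)}$ and the area of the face is at most a multiple of $h^n$.
-/
theorem exists_trace_sq_le (n N : ℕ) {ρ : ℝ} (hρ : 0 < ρ) :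
    ∃ C : ℝ, 0 < C ∧ ∀ (K : Finset (E (n + 1))) (h : ℝ), CellReg ρ h K → ∀ p ∈ polyFun (n + 1) N,
      ∀ p₀ ∈ K, ∫ y, p y ^ 2 ∂faceMeasure (K.erase p₀) ≤ C * (h⁻¹ * ∫ y in hull K, p y ^ 2) := by
  obtain ⟨C, hC, H⟩ := exists_cell_sq_le (n + 1) N hρ
  refine ⟨C * (volume.real (Metric.ball (0 : E n) 1) + 1), by positivity,
    fun K h hR p hp p₀ hp₀ => ?_⟩
  have hK := hR.simplex
  have hh := hR.h_pos
  obtain ⟨f, hf⟩ := hK.erase_nonempty (p := p₀)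
  have hsub : hull (K.erase p₀) ⊆ hull K := hull_mono (Finset.erase_subset _ _)
  have hfK : f ∈ hull K := IsSimplex.mem_hull (Finset.mem_of_mem_erase hf)
  have hfin := isFiniteMeasure_faceMeasure hK hp₀
  have hI0 : 0 ≤ ∫ y in hull K, p y ^ 2 := integral_nonneg fun y => sq_nonneg _
  have hμ : (faceMeasure (K.erase p₀)).real univ ≤ h ^ n * volume.real (Metric.ball (0 : E n) 1) := by
    have := faceMeasure_univ_le hK hp₀ hf (D := h) fun x hx => hR.dist_le x (hsub hx) f hfK
    have h2 := ENNReal.toReal_mono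
      (ENNReal.mul_ne_top ENNReal.ofReal_ne_top (measure_ball_lt_top).ne) this
    rwa [ENNReal.toReal_mul, ENNReal.toReal_ofReal (by positivity)] at h2
  calc ∫ y, p y ^ 2 ∂faceMeasure (K.erase p₀)
      ≤ ∫ y, C * ((h ^ (n + 1))⁻¹ * ∫ y in hull K, p y ^ 2) ∂faceMeasure (K.erase p₀) := by
        refine integral_mono_ae (integrable_faceMeasure hK hp₀ (continuous_polyFun_sq hp))
          (integrable_const _) ?_
        filter_upwards [ae_faceMeasure_mem _] with x hx using H K h hR p hp x (hsub hx)
    _ = (faceMeasure (K.erase p₀)).real univ * (C * ((h ^ (n + 1))⁻¹ * ∫ y in hull K, p y ^ 2)) := by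
        rw [integral_const, smul_eq_mul]
    _ ≤ (h ^ n * (volume.real (Metric.ball (0 : E n) 1) + 1)) *
          (C * ((h ^ (n + 1))⁻¹ * ∫ y in hull K, p y ^ 2)) := by
        gcongr
        refine hμ.trans ?_
        gcongr
        linarith
    _ = _ := by rw [pow_succ]; field_simp

theorem exists_divg_sq_le (d N : ℕ) {ρ : ℝ} (hρ : 0 < ρ) :
    ∃ C : ℝ, 0 < C ∧ ∀ (K : Finset (E d)) (h : ℝ), CellReg ρ h K → ∀ f : E d → E d,
      (∀ i, (fun y => f y i) ∈ polyFun d N) →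
      ∫ y in hull K, divg f y ^ 2 ≤ C * ((h ^ 2)⁻¹ * ∫ y in hull K, ‖f y‖ ^ 2) := by
  obtain ⟨C, hC, H⟩ := exists_cell_gradient_le d N hρ
  refine ⟨(d + 1) * C, by positivity, fun K h hR f hf => ?_⟩
  have hc (i : Fin d) : Continuous fun y => ‖gradient (fun z => f z i) y‖ ^ 2 :=
    (continuous_gradient (contDiff_polyFun (hf i))).norm.pow 2
  have h1 : ∫ y in hull K, divg f y ^ 2 ≤
      ∫ y in hull K, (d : ℝ) * ∑ i, ‖gradient (fun z => f z i) y‖ ^ 2 := by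
    refine integral_mono (integrableOn_hull ((continuous_divg fun i => contDiff_polyFun (hf i)).pow 2) K)
      (integrableOn_hull (continuous_const.mul (continuous_finsetSum _ fun i _ => hc i)) K) fun y => ?_
    have := sq_sum_le_card_mul_sum_sq (s := Finset.univ)
      (f := fun i => gradient (fun z => f z i) y i)
    simp only [Finset.card_univ, Fintype.card_fin] at this
    refine this.trans ?_
    refine mul_le_mul_of_nonneg_left (Finset.sum_le_sum fun i _ => ?_) (Nat.cast_nonneg d)
    rw [← sq_abs]
    refine pow_le_pow_left₀ (abs_nonneg _) ?_ 2
    exact PiLp.norm_apply_le (gradient (fun z => f z i) y) i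
  have h2 : ∫ y in hull K, ‖f y‖ ^ 2 = ∑ i, ∫ y in hull K, f y i ^ 2 := by
    rw [← integral_finsetSum _ fun i _ => integrableOn_hull (continuous_polyFun_sq (hf i)) K]
    simp only [EuclideanSpace.real_norm_sq_eq]
  have hh := hR.h_pos
  rw [integral_const_mul, integral_finsetSum _ fun i _ => integrableOn_hull (hc i) K] at h1
  refine h1.trans ?_
  have h3 : C * ((h ^ 2)⁻¹ * ∫ y in hull K, ‖f y‖ ^ 2) =
      ∑ i, C * ((h ^ 2)⁻¹ * ∫ y in hull K, f y i ^ 2) := by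
    rw [h2, Finset.mul_sum, Finset.mul_sum]
  rw [mul_assoc, h3]
  have hn : 0 ≤ ∑ i, C * ((h ^ 2)⁻¹ * ∫ y in hull K, f y i ^ 2) := by positivity
  have := Finset.sum_le_sum fun i (_ : i ∈ Finset.univ) => H K h hR _ (hf i)
  calc _ ≤ (d : ℝ) * ∑ i, C * ((h ^ 2)⁻¹ * ∫ y in hull K, f y i ^ 2) := by gcongr
    _ ≤ (d + 1 : ℝ) * ∑ i, C * ((h ^ 2)⁻¹ * ∫ y in hull K, f y i ^ 2) := by exact mul_le_mul_of_nonneg_right (by linarith) hn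

end CauchyFEM

namespace CauchyFEM

/-! ### Geometry of a shape regular cell -/

namespace CellReg

variable {d : ℕ} {ρ h : ℝ} {K : Finset (E d)}

/-- The point $x-\frac\rho2(p-x)$ is still in the larger ball. There the coordinate of `p` equals
$(1+\frac\rho2)\lambda_p(x)-\frac\rho2$ and must be nonnegative. -/
theorem le_bary (hR : CellReg ρ h K) (hρ : 0 < ρ) {c : E d} (hc : Metric.ball c (ρ * h) ⊆ hull K)
    {x : E d} (hx : x ∈ Metric.ball c (ρ / 2 * h)) {p : E d} (hp : p ∈ K) :
    ρ / (2 + ρ) ≤ bary K p x := by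
  have hh := hR.h_pos
  have hxK : x ∈ hull K := hc (Metric.ball_subset_ball (by nlinarith) hx)
  have hpK : p ∈ hull K := IsSimplex.mem_hull hp
  have hx' : x + (-(ρ / 2)) • (p - x) ∈ hull K := by
    refine hc ?_
    have h1 := hR.dist_le x hxK p hpK
    rw [Metric.mem_ball, dist_eq_norm] at hx ⊢
    rw [dist_eq_norm] at h1
    calc ‖x + (-(ρ / 2)) • (p - x) - c‖ = ‖(x - c) + (ρ / 2) • (x - p)‖ := by
          congr 1; module
      _ ≤ ‖x - c‖ + ρ / 2 * ‖x - p‖ := (norm_add_le _ _).trans (by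
          rw [norm_smul, Real.norm_of_nonneg (by positivity)])
      _ < ρ * h := by nlinarith
  rw [hR.simplex.hull_eq] at hx'
  have h2 := hx' p hp
  rw [bary_add_smul_sub, hR.simplex.bary_self hp] at h2
  rw [div_le_iff₀ (by positivity)]
  linarith

/-- With $S$ the sum on the right, all vertices, hence the cell, lie in the half-space $\langle
g,z\rangle\ge\langle g,x\rangle-\sqrt S$. The cell contains the point at distance $\frac\rho2h$ from
$x$ in direction $-g$. -/
theorem sq_norm_le_sum (hR : CellReg ρ h K) (hρ : 0 < ρ) {c : E d}
    (hc : Metric.ball c (ρ * h) ⊆ hull K) {x : E d} (hx : x ∈ Metric.ball c (ρ / 2 * h)) (g : E d) :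
    (ρ / 2 * h) ^ 2 * ‖g‖ ^ 2 ≤ ∑ p ∈ K, ⟪g, x - p⟫_ℝ ^ 2 := by
  have hh := hR.h_pos
  rcases eq_or_ne g 0 with rfl | hg
  · simp
  have hg' : 0 < ‖g‖ := norm_pos_iff.2 hg
  set S := ∑ p ∈ K, ⟪g, x - p⟫_ℝ ^ 2
  have hS : hull K ⊆ {z | ⟪g, x⟫_ℝ - √S ≤ ⟪g, z⟫_ℝ} := by
    refine convexHull_min (fun p hp => ?_)
      (convex_halfSpace_ge (innerₛₗ ℝ g).isLinear _)
    have h1 : ⟪g, x - p⟫_ℝ ≤ √S := Real.le_sqrt_of_sq_le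
      (Finset.single_le_sum (f := fun p => ⟪g, x - p⟫_ℝ ^ 2) (fun q _ => sq_nonneg _) hp)
    rw [inner_sub_right] at h1
    simp only [mem_ofPred_eq]
    linarith
  have hz : x - (ρ / 2 * h / ‖g‖) • g ∈ hull K := by
    refine hc ?_
    rw [Metric.mem_ball, dist_eq_norm] at hx ⊢
    calc ‖x - (ρ / 2 * h / ‖g‖) • g - c‖ = ‖(x - c) - (ρ / 2 * h / ‖g‖) • g‖ := by congr 1; abel
      _ ≤ ‖x - c‖ + ρ / 2 * h / ‖g‖ * ‖g‖ := (norm_sub_le _ _).trans (by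
          rw [norm_smul, Real.norm_of_nonneg (by positivity)])
      _ < ρ * h := by rw [div_mul_cancel₀ _ hg'.ne']; linarith
  have h3 := hS hz
  simp only [mem_ofPred_eq, inner_sub_right, real_inner_smul_right, real_inner_self_eq_norm_sq] at h3
  have h4 : ρ / 2 * h * ‖g‖ ≤ √S := by
    have : ρ / 2 * h / ‖g‖ * ‖g‖ ^ 2 = ρ / 2 * h * ‖g‖ := by field_simp
    linarith
  rw [← mul_pow]
  exact (Real.le_sqrt' (by positivity)).1 h4

end CellReg

/-- Coercivity of the bubble form. On the half-size inner ball the weights are bounded below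
(`le_bary`) and the directions to the vertices control every vector (`sq_norm_le_sum`). The
polynomial on the whole cell is controlled by that ball. -/
theorem exists_vertex_form_ge (d N : ℕ) {ρ : ℝ} (hρ : 0 < ρ) :
    ∃ C : ℝ, 0 < C ∧ ∀ (K : Finset (E d)) (h : ℝ), CellReg ρ h K → ∀ G : E d → E d,
      (∀ i, (fun y => G y i) ∈ polyFun d N) →
      h ^ 2 * ∫ y in hull K, ‖G y‖ ^ 2 ≤
        C * ∫ y in hull K, ∑ p ∈ K, bary K p y * ⟪G y, y - p⟫_ℝ ^ 2 := by
  obtain ⟨C, hC, H⟩ := exists_sq_le_ball d N 1 (half_pos hρ)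
  set V := volume.real (Metric.ball (0 : E d) 1)
  refine ⟨C * (V + 1) * ((2 + ρ) / ρ * (2 / ρ) ^ 2), by positivity, fun K h hR G hG => ?_⟩
  obtain ⟨c, hc⟩ := hR.exists_ball
  have hh := hR.h_pos
  have hK := hR.simplex
  have hcK : c ∈ hull K := hc (Metric.mem_ball_self (by positivity))
  have hGc : Continuous G := continuous_of_coord fun i => continuous_polyFun (hG i)
  have hG2 : Continuous fun y => ‖G y‖ ^ 2 := hGc.norm.pow 2
  have hsub : Metric.ball c (ρ / 2 * h) ⊆ hull K :=
    (Metric.ball_subset_ball (by nlinarith)).trans hc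
  set B := Metric.ball c (ρ / 2 * h)
  have hi {u : E d → ℝ} (hu : Continuous u) : IntegrableOn u B :=
    (integrableOn_hull hu K).mono_set hsub
  have h1 : ∫ y in hull K, ‖G y‖ ^ 2 ≤ C * (V + 1) * ∫ y in B, ‖G y‖ ^ 2 := by
    have h2 : ∀ x ∈ hull K, ‖G x‖ ^ 2 ≤ C * ((h ^ d)⁻¹ * ∫ y in B, ‖G y‖ ^ 2) := fun x hx => by
      simp only [EuclideanSpace.real_norm_sq_eq]
      rw [integral_finsetSum _ fun i _ => hi (continuous_polyFun_sq (hG i)), Finset.mul_sum,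
        Finset.mul_sum]
      exact Finset.sum_le_sum fun i _ => H _ (hG i) c h hh x (by simpa using hR.dist_le x hx c hcK)
    have hI : 0 ≤ ∫ y in B, ‖G y‖ ^ 2 := integral_nonneg fun y => sq_nonneg _
    refine (hR.setIntegral_hull_le hG2 (by positivity) h2).trans ?_
    have : C * ((h ^ d)⁻¹ * ∫ y in B, ‖G y‖ ^ 2) * (h ^ d * V) = C * V * ∫ y in B, ‖G y‖ ^ 2 := by
      field_simp
    rw [this]
    gcongr
    linarith
  have hcu : Continuous fun y => ∑ p ∈ K, bary K p y * ⟪G y, y - p⟫_ℝ ^ 2 :=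
    continuous_finsetSum _ fun p _ => (continuous_bary K p).mul
      ((hGc.inner (continuous_id.sub continuous_const)).pow 2)
  have h3 : ∫ y in B, ‖G y‖ ^ 2 ≤ ((2 + ρ) / ρ * (2 / ρ) ^ 2 * (h ^ 2)⁻¹) *
      ∫ y in B, ∑ p ∈ K, bary K p y * ⟪G y, y - p⟫_ℝ ^ 2 := by
    rw [← integral_const_mul]
    refine setIntegral_mono_on (hi hG2) (hi (continuous_const.mul hcu)) Metric.isOpen_ball.measurableSet
      fun y hy => ?_
    have h4 := hR.sq_norm_le_sum hρ hc hy (G y)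
    have h5 : ρ / (2 + ρ) * ∑ p ∈ K, ⟪G y, y - p⟫_ℝ ^ 2 ≤
        ∑ p ∈ K, bary K p y * ⟪G y, y - p⟫_ℝ ^ 2 := by
      rw [Finset.mul_sum]
      exact Finset.sum_le_sum fun p hp =>
        mul_le_mul_of_nonneg_right (hR.le_bary hρ hc hy hp) (sq_nonneg _)
    calc ‖G y‖ ^ 2 = ((2 + ρ) / ρ * (2 / ρ) ^ 2 * (h ^ 2)⁻¹) *
          (ρ / (2 + ρ) * ((ρ / 2 * h) ^ 2 * ‖G y‖ ^ 2)) := by field_simp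
      _ ≤ ((2 + ρ) / ρ * (2 / ρ) ^ 2 * (h ^ 2)⁻¹) *
          (ρ / (2 + ρ) * ∑ p ∈ K, ⟪G y, y - p⟫_ℝ ^ 2) := by gcongr
      _ ≤ _ := by gcongr
  have h6 : ∫ y in B, ∑ p ∈ K, bary K p y * ⟪G y, y - p⟫_ℝ ^ 2 ≤
      ∫ y in hull K, ∑ p ∈ K, bary K p y * ⟪G y, y - p⟫_ℝ ^ 2 := by
    refine setIntegral_mono_set (integrableOn_hull hcu K) ?_ (Filter.Eventually.of_forall hsub)
    filter_upwards [ae_restrict_mem (measurableSet_hull K)] with y hy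
    rw [hK.hull_eq] at hy
    exact Finset.sum_nonneg fun p hp => mul_nonneg (hy p hp) (sq_nonneg _)
  calc h ^ 2 * ∫ y in hull K, ‖G y‖ ^ 2
      ≤ h ^ 2 * (C * (V + 1) * (((2 + ρ) / ρ * (2 / ρ) ^ 2 * (h ^ 2)⁻¹) *
        ∫ y in hull K, ∑ p ∈ K, bary K p y * ⟪G y, y - p⟫_ℝ ^ 2)) := by
        gcongr
        refine h1.trans ?_
        gcongr
        refine h3.trans ?_
        gcongr
    _ = _ := by field_simp

namespace CellReg

variable {n : ℕ} {ρ h : ℝ} {K : Finset (E (n + 1))}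

/-- Along a normal segment of length $t<\rho h$ inside the inner ball the coordinate of `p` changes
by $t/|\mathrm{offset}|$, yet it stays in $[0,1]$. -/
theorem le_abs_offset (hR : CellReg ρ h K) {p : E (n + 1)} (hp : p ∈ K) :
    ρ * h ≤ |offset K (K.erase p)| := by
  have hh := hR.h_pos
  have hK := hR.simplex
  obtain ⟨c, hc⟩ := hR.exists_ball
  obtain ⟨hν, -⟩ := unitNormal_spec hK hp
  set ν := unitNormal (K.erase p)
  have hb (t : ℝ) (ht : |t| < ρ * h) : bary K p (c + t • ν) ∈ Icc (0 : ℝ) 1 := by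
    have hx : c + t • ν ∈ hull K := hc (by simpa [dist_eq_norm, norm_smul, hν] using ht)
    rw [hK.hull_eq] at hx
    refine ⟨hx p hp, ?_⟩
    rw [← hK.sum_bary (c + t • ν)]
    exact Finset.single_le_sum (f := fun q => bary K q (c + t • ν)) hx hp
  refine le_of_forall_lt_imp_le_of_dense fun t ht => ?_
  rcases le_or_gt t 0 with h0 | h0
  · exact h0.trans (abs_nonneg _)
  have h1 := hb (t / 2) (by rw [abs_of_pos (by positivity)]; linarith)
  have h2 := hb (-(t / 2)) (by rw [abs_neg, abs_of_pos (by positivity)]; linarith)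
  have h3 := inner_unitNormal_linear hK hp (t • ν)
  have h4 : (bary K p).linear (t • ν) = bary K p (c + (t / 2) • ν) - bary K p (c + (-(t / 2)) • ν) := by
    rw [← bary_linear_sub]; congr 1; module
  rw [real_inner_smul_right, real_inner_self_eq_norm_sq, hν, h4] at h3
  rw [one_pow, mul_one] at h3
  have h5 := congrArg abs h3
  rw [neg_mul, abs_neg, abs_mul, abs_of_pos h0] at h5
  rw [h5]
  refine mul_le_of_le_one_left (abs_nonneg _) ?_
  rw [abs_le]
  constructor <;> linarith [h1.1, h1.2, h2.1, h2.2]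

/-- Central projection from `p` maps the slice of the inner ball parallel to the face into the face.
It is a homothety with ratio $1/(1-\lambda_p(c))>1$, so the radius does not shrink. -/
theorem exists_face_ball (hR : CellReg ρ h K) (hρ : 0 < ρ) {p : E (n + 1)} (hp : p ∈ K) :
    ∃ y ∈ hull (K.erase p), ∀ w, (bary K p).linear w = 0 → ‖w‖ < ρ * h →
      y + w ∈ hull (K.erase p) := by
  have hh := hR.h_pos
  have hK := hR.simplex
  obtain ⟨c, hc⟩ := hR.exists_ball
  set b := bary K p c
  have hci : c ∈ interior (hull K) := interior_mono hc (by
    rw [Metric.isOpen_ball.interior_eq]; exact Metric.mem_ball_self (by positivity))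
  rw [hK.interior_hull_eq] at hci
  have hb0 : 0 < b := hci p hp
  have hb1 : b < 1 := by
    have := hK.sum_bary c
    rw [← Finset.add_sum_erase K _ hp] at this
    have h2 : 0 < ∑ q ∈ K.erase p, bary K q c :=
      Finset.sum_pos (fun q hq => hci q (Finset.mem_of_mem_erase hq)) hK.erase_nonempty
    simp only [b]
    linarith
  have hs : 0 < 1 - b := by linarith
  have key (w : E (n + 1)) (hw : (bary K p).linear w = 0) (hwn : ‖w‖ < ρ * h) :
      c + (1 - b)⁻¹ • (b • (c - p)) + w ∈ hull (K.erase p) := by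
    have hy : c + (1 - b) • w ∈ hull K := hc (by
      rw [Metric.mem_ball, dist_eq_norm, add_sub_cancel_left, norm_smul, Real.norm_of_nonneg hs.le]
      nlinarith [norm_nonneg w])
    have e : c + (1 - b)⁻¹ • (b • (c - p)) + w =
        (c + (1 - b) • w) + (-(b / (1 - b))) • (p - (c + (1 - b) • w)) := by
      ext i
      simp only [PiLp.add_apply, PiLp.smul_apply, PiLp.sub_apply, smul_eq_mul]
      field_simp
      ring
    have hlin : bary K p (c + (1 - b) • w) = b := by
      have := (bary K p).map_vadd c ((1 - b) • w)
      rw [vadd_eq_add, vadd_eq_add, map_smul, hw, smul_zero, zero_add] at this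
      rw [add_comm c, this]
    rw [hK.mem_hull_erase hp, hK.hull_eq]
    rw [hK.hull_eq] at hy
    have hp0 : bary K p (c + (1 - b)⁻¹ • (b • (c - p)) + w) = 0 := by
      rw [e, bary_add_smul_sub, hK.bary_self hp, hlin]
      field_simp
      ring
    refine ⟨fun q hq => ?_, hp0⟩
    rcases eq_or_ne q p with rfl | hqp
    · exact hp0.ge
    rw [e, bary_add_smul_sub, hK.bary_of_ne hq hp hqp]
    have := hy q hq
    have h6 : 0 ≤ b / (1 - b) := by positivity
    nlinarith
  refine ⟨c + (1 - b)⁻¹ • (b • (c - p)), ?_, key⟩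
  simpa using key 0 (by simp) (by simp; positivity)

end CellReg

/-- The extension is constant along the normal: precomposition with the orthogonal projection onto
the hyperplane, which keeps the degree and does not increase distances. The cell thus projects
within distance $h$ of the centre of the face ball, and the estimate on balls applies in dimension
$n$. -/
theorem exists_face_extension (n l : ℕ) {ρ : ℝ} (hρ : 0 < ρ) :
    ∃ C : ℝ, 0 < C ∧ ∀ (K : Finset (E (n + 1))) (h : ℝ), CellReg ρ h K → ∀ p ∈ K,
      ∀ γ ∈ polyFun (n + 1) l, ∃ β ∈ polyFun (n + 1) l, (∀ y ∈ hull (K.erase p), β y = γ y) ∧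
        ∀ x ∈ hull K, β x ^ 2 ≤ C * ((h ^ n)⁻¹ * ∫ y, γ y ^ 2 ∂faceMeasure (K.erase p)) := by
  obtain ⟨C, hC, H⟩ := exists_sq_le_ball n l 1 hρ
  refine ⟨C, hC, fun K h hR p hp γ hγ => ?_⟩
  have hh := hR.h_pos
  have hK := hR.simplex
  obtain ⟨f, hf⟩ := hK.erase_nonempty (p := p)
  obtain ⟨L, hL0, hL, hLb, hm, -⟩ := exists_face_coords hK hp hf
  obtain ⟨hν, -⟩ := unitNormal_spec hK hp
  set ν := unitNormal (K.erase p)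
  -- the orthogonal projection onto the hyperplane of the face
  set P : E (n + 1) →ᵃ[ℝ] E (n + 1) :=
    (LinearMap.id - (innerₛₗ ℝ ν).smulRight ν).toAffineMap + AffineMap.const ℝ _ (⟪ν, f⟫_ℝ • ν)
  have hP (x) : P x = x - ⟪ν, x - f⟫_ℝ • ν := by
    simp [P, inner_sub_right, sub_smul]; abel
  have hPz (x) : ∃ z, f + L z = P x ∧ ⟪ν, P x - f⟫_ℝ = 0 := by
    have h0 : ⟪ν, P x - f⟫_ℝ = 0 := by
      rw [hP, sub_right_comm, inner_sub_right, real_inner_smul_right, real_inner_self_eq_norm_sq, hν]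
      ring
    obtain ⟨z, hz⟩ := hL _ h0
    exact ⟨z, by rw [hz]; abel, h0⟩
  have hPface (y) (hy : y ∈ hull (K.erase p)) : P y = y := by
    have := inner_unitNormal_sub hK hp hf y
    rw [((hK.mem_hull_erase hp).1 hy).2, zero_mul] at this
    rw [hP, ← neg_sub f y, inner_neg_right, this, neg_zero, zero_smul, sub_zero]
  have hPn (x y) : ‖P x - P y‖ ≤ ‖x - y‖ := by
    have e : P x - P y = (x - y) - ⟪ν, x - y⟫_ℝ • ν := by
      rw [hP, hP]; simp only [inner_sub_right]; module
    rw [e]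
    refine le_of_sq_le_sq ?_ (norm_nonneg _)
    rw [norm_sub_sq_real, real_inner_smul_right, norm_smul, hν, real_inner_comm (x - y) ν,
      Real.norm_eq_abs, mul_one, sq_abs]
    nlinarith [sq_nonneg ⟪ν, x - y⟫_ℝ]
  obtain ⟨y₀, hy₀, hball⟩ := hR.exists_face_ball hρ hp
  obtain ⟨z₀, hz₀, -⟩ := hPz y₀
  rw [hPface y₀ hy₀] at hz₀
  have hg : (fun z => γ (f + L z)) ∈ polyFun n l :=
    polyFun_comp hγ fun i => by
      simpa using polyFun_affineMap_coord
        (AffineMap.const ℝ (E n) f + L.toLinearMap.toAffineMap) i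
  have hmap : Continuous fun z => f + L z := continuous_const.add L.continuous
  refine ⟨fun x => γ (P x), polyFun_comp hγ fun i => polyFun_affineMap_coord P i,
    fun y hy => by simp only [hPface y hy], fun x hx => ?_⟩
  obtain ⟨z, hz, -⟩ := hPz x
  have hzb : z ∈ Metric.closedBall z₀ (1 * h) := by
    rw [Metric.mem_closedBall, dist_eq_norm, ← L.norm_map, map_sub, ← add_sub_add_left_eq_sub _ _ f,
      hz, hz₀, one_mul]
    have h1 := hPn x y₀
    rw [hPface y₀ hy₀] at h1
    refine h1.trans ?_
    rw [← dist_eq_norm]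
    exact hR.dist_le x hx y₀ (hull_mono (Finset.erase_subset _ _) hy₀)
  have h2 := H _ hg z₀ h hh z hzb
  simp only [hz] at h2
  refine h2.trans ?_
  have h3 : ∫ y, γ y ^ 2 ∂faceMeasure (K.erase p) =
      ∫ z in (fun z => f + L z) ⁻¹' hull (K.erase p), γ (f + L z) ^ 2 := by
    rw [hm, integral_map hmap.aemeasurable (continuous_polyFun_sq hγ).aestronglyMeasurable]
  rw [h3]
  have hcomp : IsCompact ((fun z => f + L z) ⁻¹' hull (K.erase p)) :=
    ((Homeomorph.addLeft f).isClosedEmbedding.comp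
      L.isometry.isClosedEmbedding).isCompact_preimage (isCompact_hull _)
  have h4 : ∫ z in Metric.ball z₀ (ρ * h), γ (f + L z) ^ 2 ≤
      ∫ z in (fun z => f + L z) ⁻¹' hull (K.erase p), γ (f + L z) ^ 2 := by
    refine setIntegral_mono_set
      ((continuous_polyFun_sq hg).continuousOn.integrableOn_compact hcomp)
      (Filter.Eventually.of_forall fun z => sq_nonneg _) (Filter.Eventually.of_forall fun z hz => ?_)
    have hw : (bary K p).linear (L (z - z₀)) = 0 := by
      have h6 : L (z - z₀) = (f + L z) - (f + L z₀) := by rw [map_sub]; abel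
      rw [h6, bary_linear_sub, hLb, hLb, sub_zero]
    have := hball _ hw (by rw [L.norm_map, ← dist_eq_norm]; exact hz)
    rw [← hz₀, add_assoc, ← map_add, add_sub_cancel] at this
    exact this
  gcongr

end CauchyFEM

namespace CauchyFEM

/-! ### The test field on a cell -/

namespace IsSimplex

variable {d : ℕ} {K : Finset (E d)} (hK : IsSimplex K)
include hK

/-- Because $\sum_p\lambda_p(y-p)=0$, a term independent of $p$ may be added to the coefficients.
The left form raises the degree of $g$ by only one, as membership in $RT^l$ requires, while the
right form shows sign and size. -/
theorem sum_bary_inner_smul_sub (g y : E d) : ∑ p ∈ K, (bary K p y * ⟪g, p⟫_ℝ) • (y - p) =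
    -∑ p ∈ K, (bary K p y * ⟪g, y - p⟫_ℝ) • (y - p) := by
  have h1 : ∑ p ∈ K, (bary K p y * ⟪g, p⟫_ℝ) • (y - p) = ⟪g, y⟫_ℝ • ∑ p ∈ K, bary K p y • (y - p) -
      ∑ p ∈ K, (bary K p y * ⟪g, y - p⟫_ℝ) • (y - p) := by
    rw [Finset.smul_sum, ← Finset.sum_sub_distrib]
    refine Finset.sum_congr rfl fun p _ => ?_
    rw [inner_sub_right]
    module
  rw [h1, hK.sum_bary_smul_sub, smul_zero, zero_sub]

theorem inner_sum_bary_inner_smul_sub (g y : E d) :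
    ⟪∑ p ∈ K, (bary K p y * ⟪g, p⟫_ℝ) • (y - p), g⟫_ℝ =
      -∑ p ∈ K, bary K p y * ⟪g, y - p⟫_ℝ ^ 2 := by
  rw [hK.sum_bary_inner_smul_sub, inner_neg_left, sum_inner]
  congr 1
  refine Finset.sum_congr rfl fun p _ => ?_
  rw [real_inner_smul_left, real_inner_comm]
  ring

theorem norm_sum_bary_inner_smul_sub_le {h : ℝ} (g : E d) {y : E d} (hy : y ∈ hull K)
    (hd : ∀ p ∈ K, ‖y - p‖ ≤ h) :
    ‖∑ p ∈ K, (bary K p y * ⟪g, p⟫_ℝ) • (y - p)‖ ≤ h ^ 2 * ‖g‖ := by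
  rw [hK.sum_bary_inner_smul_sub, norm_neg]
  rw [hK.hull_eq] at hy
  calc ‖∑ p ∈ K, (bary K p y * ⟪g, y - p⟫_ℝ) • (y - p)‖
      ≤ ∑ p ∈ K, bary K p y * (h ^ 2 * ‖g‖) := by
        refine norm_sum_le_of_le _ fun p hp => ?_
        rw [norm_smul, norm_mul, Real.norm_of_nonneg (hy p hp), mul_assoc]
        refine mul_le_mul_of_nonneg_left ?_ (hy p hp)
        have h1 := norm_inner_le_norm (𝕜 := ℝ) g (y - p)
        have h2 := hd p hp
        calc ‖⟪g, y - p⟫_ℝ‖ * ‖y - p‖ ≤ (‖g‖ * ‖y - p‖) * ‖y - p‖ := by gcongr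
          _ ≤ (‖g‖ * h) * h := by
            have := (norm_nonneg _).trans h2
            gcongr
          _ = _ := by ring
    _ = _ := by rw [← Finset.sum_mul, hK.sum_bary, one_mul]

end IsSimplex

/-- At a point of the hyperplane opposite `p`, the vectors to the other vertices are tangential. -/
theorem inner_unitNormal_sum_smul_sub {n : ℕ} {K : Finset (E (n + 1))} (hK : IsSimplex K)
    {p : E (n + 1)} (hp : p ∈ K) (c : E (n + 1) → ℝ) {y : E (n + 1)} (hy : bary K p y = 0) :
    ⟪unitNormal (K.erase p), ∑ q ∈ K, c q • (y - q)⟫_ℝ = c p * offset K (K.erase p) := by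
  obtain ⟨f, hf⟩ := hK.erase_nonempty (p := p)
  rw [inner_sum, ← Finset.add_sum_erase K _ hp, Finset.sum_eq_zero fun q hq => ?_, add_zero,
    real_inner_smul_right, inner_unitNormal_sub_vertex hK hp hf, hy, sub_zero, one_mul,
    offset_erase hK hp hf]
  rw [real_inner_smul_right, ← neg_sub, inner_neg_right, inner_unitNormal_sub hK hp hq, hy]
  simp

/-- Each coefficient is the normal-constant extension of $\gamma_p$ divided by $h$ and the offset.
As the offset is at least $\rho h$ and $|y-p|\le h$, the field has size $h^{-1}|\beta_p|$.
Integration then gives $h^{-2}\cdot h^{-n}\cdot h^{n+1}=h^{-1}$. -/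
theorem exists_face_lifting (n l : ℕ) {ρ : ℝ} (hρ : 0 < ρ) :
    ∃ C : ℝ, 0 < C ∧ ∀ (K : Finset (E (n + 1))) (h : ℝ), CellReg ρ h K →
      ∀ γ : E (n + 1) → E (n + 1) → ℝ, (∀ p ∈ K, γ p ∈ polyFun (n + 1) l) →
      ∃ c : E (n + 1) → E (n + 1) → ℝ, (∀ p ∈ K, c p ∈ polyFun (n + 1) l) ∧
        (∀ p ∈ K, ∀ y ∈ hull (K.erase p), c p y * offset K (K.erase p) = h⁻¹ * γ p y) ∧
        ∫ y in hull K, ‖∑ p ∈ K, c p y • (y - p)‖ ^ 2 ≤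
          C * (h⁻¹ * ∑ p ∈ K, ∫ y, γ p y ^ 2 ∂faceMeasure (K.erase p)) := by
  obtain ⟨C, hC, H⟩ := exists_face_extension n l hρ
  set V := volume.real (Metric.ball (0 : E (n + 1)) 1)
  refine ⟨(n + 2) * (ρ ^ 2)⁻¹ * C * (V + 1), by positivity, fun K h hR γ hγ => ?_⟩
  have hh := hR.h_pos
  have hK := hR.simplex
  have H' := fun p => fun hp : p ∈ K => H K h hR p hp (γ p) (hγ p hp)
  choose! β hβ hβF hβK using H'
  have hc (p) (hp : p ∈ K) : (fun y => (h⁻¹ * (offset K (K.erase p))⁻¹) * β p y) ∈ polyFun (n + 1) l :=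
    polyFun_const_mul _ (hβ p hp)
  refine ⟨fun p y => (h⁻¹ * (offset K (K.erase p))⁻¹) * β p y, hc, fun p hp y hy => ?_, ?_⟩
  · have := offset_ne_zero hK hp
    simp only [hβF p hp y hy]
    field_simp
  set S := ∑ p ∈ K, ∫ y, γ p y ^ 2 ∂faceMeasure (K.erase p)
  have hS : 0 ≤ S := Finset.sum_nonneg fun p _ => integral_nonneg fun y => sq_nonneg _
  have hcont : Continuous fun y => ‖∑ p ∈ K, ((h⁻¹ * (offset K (K.erase p))⁻¹) * β p y) • (y - p)‖ ^ 2 :=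
    (continuous_finsetSum _ fun p hp => (continuous_polyFun (hc p hp)).smul
      (continuous_id.sub continuous_const)).norm.pow 2
  refine (hR.setIntegral_hull_le hcont (C := (n + 2) * ((ρ * h) ^ 2)⁻¹ * (C * ((h ^ n)⁻¹ * S)))
    (by positivity) fun y hy => ?_).trans ?_
  · have h1 : ‖∑ p ∈ K, ((h⁻¹ * (offset K (K.erase p))⁻¹) * β p y) • (y - p)‖ ≤
        ∑ p ∈ K, (ρ * h)⁻¹ * |β p y| := by
      refine norm_sum_le_of_le _ fun p hp => ?_
      have h2 := hR.le_abs_offset hp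
      have h3 := hR.dist_le y hy p (IsSimplex.mem_hull hp)
      rw [dist_eq_norm] at h3
      rw [norm_smul, norm_mul, norm_mul, norm_inv, norm_inv, Real.norm_of_nonneg hh.le,
        Real.norm_eq_abs, Real.norm_eq_abs]
      have h4 : |offset K (K.erase p)|⁻¹ ≤ (ρ * h)⁻¹ := inv_anti₀ (by positivity) h2
      calc h⁻¹ * |offset K (K.erase p)|⁻¹ * |β p y| * ‖y - p‖
          ≤ h⁻¹ * (ρ * h)⁻¹ * |β p y| * h := by gcongr
        _ = _ := by field_simp
    calc ‖∑ p ∈ K, ((h⁻¹ * (offset K (K.erase p))⁻¹) * β p y) • (y - p)‖ ^ 2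
        ≤ (∑ p ∈ K, (ρ * h)⁻¹ * |β p y|) ^ 2 := by gcongr
      _ ≤ (K.card : ℝ) * ∑ p ∈ K, ((ρ * h)⁻¹ * |β p y|) ^ 2 := sq_sum_le_card_mul_sum_sq
      _ ≤ (n + 2) * ∑ p ∈ K, ((ρ * h) ^ 2)⁻¹ *
          (C * ((h ^ n)⁻¹ * ∫ y, γ p y ^ 2 ∂faceMeasure (K.erase p))) := by
        rw [hK.1]
        push_cast
        rw [add_assoc, one_add_one_eq_two]
        refine mul_le_mul_of_nonneg_left (Finset.sum_le_sum fun p hp => ?_) (by positivity)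
        rw [mul_pow, sq_abs, inv_pow]
        exact mul_le_mul_of_nonneg_left (hβK p hp y hy) (by positivity)
      _ = _ := by simp only [S, Finset.mul_sum, mul_assoc]
  · have : (n + 2) * ((ρ * h) ^ 2)⁻¹ * (C * ((h ^ n)⁻¹ * S)) * (h ^ (n + 1) * V) =
        (n + 2) * (ρ ^ 2)⁻¹ * C * V * (h⁻¹ * S) := by
      rw [pow_succ h n]; field_simp
    rw [this]
    gcongr
    linarith

section pairing

variable {d : ℕ} {K : Finset (E d)} {G Y₁ Y₂ : E d → E d} (hG : Continuous G)
  (hY₁ : Continuous Y₁) (hY₂ : Continuous Y₂) (hY₂G : ∀ y ∈ hull K, ‖Y₂ y‖ ≤ ‖G y‖)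
  {C₁ C₂ S : ℝ} (hC₁ : 0 < C₁) (hC₂ : 0 < C₂) (hS : ∫ y in hull K, ‖Y₁ y‖ ^ 2 ≤ C₁ * S)
include hG hY₁ hY₂ hY₂G hC₁ hC₂ hS

omit hC₁ hC₂ in
theorem setIntegral_norm_sq_smul_add_le {B : ℝ} (hB : 0 ≤ B) :
    ∫ y in hull K, ‖B • Y₂ y + Y₁ y‖ ^ 2 ≤
      2 * B ^ 2 * (∫ y in hull K, ‖G y‖ ^ 2) + 2 * C₁ * S := by
  have hI {u : E d → ℝ} (hu : Continuous u) : IntegrableOn u (hull K) := integrableOn_hull hu K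
  have h1 : ∫ y in hull K, ‖B • Y₂ y + Y₁ y‖ ^ 2 ≤
      ∫ y in hull K, (2 * B ^ 2 * ‖G y‖ ^ 2 + 2 * ‖Y₁ y‖ ^ 2) := by
    refine setIntegral_mono_on (hI (by fun_prop)) (hI (by fun_prop)) (measurableSet_hull K)
      fun y hy => ?_
    have h2 : ‖B • Y₂ y + Y₁ y‖ ≤ B * ‖G y‖ + ‖Y₁ y‖ := (norm_add_le _ _).trans (by
      rw [norm_smul, Real.norm_of_nonneg hB]; gcongr; exact hY₂G y hy)
    have := pow_le_pow_left₀ (norm_nonneg _) h2 2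
    nlinarith [sq_nonneg (B * ‖G y‖ - ‖Y₁ y‖)]
  rw [integral_add (hI (by fun_prop)) (hI (by fun_prop)), integral_const_mul,
    integral_const_mul] at h1
  linarith

/-- Balance of Young inequalities. The factor $4C_2(C_1+1)$ turns the coercive form into
$4(C_1+1)\|G\|^2$. Half of it pays for replacing $u$ by $G$ in the pairing with $Y_2$. The other
half dominates $(C_1+1)\|u\|^2$ up to $\|u-G\|^2$, which covers the price $C_1\|u\|^2$ of keeping
the $Y_1$ term below $\frac14S$. -/
theorem le_neg_setIntegral_inner_smul_add {q : E d → ℝ} (hq : Continuous q)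
    (hqG : ∀ y, ⟪Y₂ y, G y⟫_ℝ = -q y)
    (hqI : ∫ y in hull K, ‖G y‖ ^ 2 ≤ C₂ * ∫ y in hull K, q y)
    {u : E d → E d} (hu : Continuous u) :
    (1 / 2) * (∫ y in hull K, ‖u y‖ ^ 2) - (2 * C₂ ^ 2 * (C₁ + 1) + 2 * (C₁ + 1)) *
        (∫ y in hull K, ‖u y - G y‖ ^ 2) - (1 / 4) * S ≤
      -∫ y in hull K, ⟪(4 * C₂ * (C₁ + 1)) • Y₂ y + Y₁ y, u y⟫_ℝ := by
  have hI {u : E d → ℝ} (hu : Continuous u) : IntegrableOn u (hull K) := integrableOn_hull hu K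
  have h1 : ∫ y in hull K, ⟪(4 * C₂ * (C₁ + 1)) • Y₂ y + Y₁ y, u y⟫_ℝ ≤ ∫ y in hull K,
      ((-(4 * C₂ * (C₁ + 1))) * q y + (2 * (C₁ + 1)) * ‖G y‖ ^ 2 +
        (2 * C₂ ^ 2 * (C₁ + 1)) * ‖u y - G y‖ ^ 2 + (1 / (4 * C₁)) * ‖Y₁ y‖ ^ 2 +
        C₁ * ‖u y‖ ^ 2) := by
    refine setIntegral_mono_on (hI (by fun_prop)) (hI (by fun_prop)) (measurableSet_hull K)
      fun y hy => ?_
    have e : ⟪(4 * C₂ * (C₁ + 1)) • Y₂ y + Y₁ y, u y⟫_ℝ = (4 * C₂ * (C₁ + 1)) * ⟪Y₂ y, G y⟫_ℝ +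
        (4 * C₂ * (C₁ + 1)) * ⟪Y₂ y, u y - G y⟫_ℝ + ⟪Y₁ y, u y⟫_ℝ := by
      rw [inner_add_left, real_inner_smul_left, inner_sub_right]; ring
    rw [e, hqG]
    have h2 : ⟪Y₂ y, u y - G y⟫_ℝ ≤ ‖G y‖ * ‖u y - G y‖ :=
      (real_inner_le_norm _ _).trans (by gcongr; exact hY₂G y hy)
    have h3 : ‖G y‖ * ‖u y - G y‖ ≤ 1 / (2 * C₂) * ‖G y‖ ^ 2 + C₂ / 2 * ‖u y - G y‖ ^ 2 := by
      have : 1 / (2 * C₂) * ‖G y‖ ^ 2 + C₂ / 2 * ‖u y - G y‖ ^ 2 - ‖G y‖ * ‖u y - G y‖ =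
          1 / (2 * C₂) * (‖G y‖ - C₂ * ‖u y - G y‖) ^ 2 := by field_simp; ring
      linarith [show 0 ≤ 1 / (2 * C₂) * (‖G y‖ - C₂ * ‖u y - G y‖) ^ 2 by positivity]
    have h4 : ⟪Y₁ y, u y⟫_ℝ ≤ ‖Y₁ y‖ * ‖u y‖ := real_inner_le_norm _ _
    have h5 : ‖Y₁ y‖ * ‖u y‖ ≤ 1 / (4 * C₁) * ‖Y₁ y‖ ^ 2 + C₁ * ‖u y‖ ^ 2 := by
      have : 1 / (4 * C₁) * ‖Y₁ y‖ ^ 2 + C₁ * ‖u y‖ ^ 2 - ‖Y₁ y‖ * ‖u y‖ =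
          1 / (4 * C₁) * (‖Y₁ y‖ - 2 * C₁ * ‖u y‖) ^ 2 := by field_simp; ring
      linarith [show 0 ≤ 1 / (4 * C₁) * (‖Y₁ y‖ - 2 * C₁ * ‖u y‖) ^ 2 by positivity]
    have h6 : (4 * C₂ * (C₁ + 1)) * ⟪Y₂ y, u y - G y⟫_ℝ ≤
        2 * (C₁ + 1) * ‖G y‖ ^ 2 + 2 * C₂ ^ 2 * (C₁ + 1) * ‖u y - G y‖ ^ 2 :=
      (mul_le_mul_of_nonneg_left (h2.trans h3) (by positivity)).trans
        (le_of_eq (by field_simp; ring))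
    linarith
  rw [integral_add (by exact hI (by fun_prop)) (by exact hI (by fun_prop)),
    integral_add (by exact hI (by fun_prop)) (by exact hI (by fun_prop)),
    integral_add (by exact hI (by fun_prop)) (by exact hI (by fun_prop)),
    integral_add (by exact hI (by fun_prop)) (by exact hI (by fun_prop)),
    integral_const_mul, integral_const_mul, integral_const_mul, integral_const_mul,
    integral_const_mul] at h1
  have h7 : ∫ y in hull K, ‖u y‖ ^ 2 ≤ 2 * (∫ y in hull K, ‖G y‖ ^ 2) +
      2 * ∫ y in hull K, ‖u y - G y‖ ^ 2 := by
    rw [← integral_const_mul, ← integral_const_mul,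
      ← integral_add (hI (by fun_prop)) (hI (by fun_prop))]
    refine integral_mono (hI (by fun_prop)) (hI (by fun_prop)) fun y => ?_
    have h8 : ‖u y‖ ≤ ‖G y‖ + ‖u y - G y‖ := by simpa using norm_add_le (G y) (u y - G y)
    have := pow_le_pow_left₀ (norm_nonneg _) h8 2
    nlinarith [sq_nonneg (‖G y‖ - ‖u y - G y‖)]
  have h10 : 1 / (4 * C₁) * ∫ y in hull K, ‖Y₁ y‖ ^ 2 ≤ 1 / 4 * S := by
    refine (mul_le_mul_of_nonneg_left hS (by positivity)).trans (le_of_eq ?_)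
    field_simp
  have h12 := mul_le_mul_of_nonneg_left hqI (show 0 ≤ 4 * (C₁ + 1) by positivity)
  have h13 := mul_le_mul_of_nonneg_left h7 (show 0 ≤ C₁ + 1 by positivity)
  have h14 : 0 ≤ ∫ y in hull K, ‖u y‖ ^ 2 := integral_nonneg fun y => sq_nonneg _
  linarith

end pairing

/-- The lifting carries the normal traces. The bubble part has none, since $\lambda_p=0$ on the face
opposite `p`, and it supplies the control of $G$. The condition on $G$ keeps $\lambda_pG$ in degree
$l$; it is what $\pi_{X,l-1}$ provides, including $l=0$. -/
theorem exists_cell_field (n l : ℕ) {ρ : ℝ} (hρ : 0 < ρ) :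
    ∃ C : ℝ, 0 < C ∧ ∀ (K : Finset (E (n + 1))) (h : ℝ), CellReg ρ h K →
      ∀ G : E (n + 1) → E (n + 1),
      (∀ i, ∀ c ∈ polyFun (n + 1) 1, (fun y => c y * G y i) ∈ polyFun (n + 1) l) →
      ∀ γ : E (n + 1) → E (n + 1) → ℝ, (∀ p ∈ K, γ p ∈ polyFun (n + 1) l) →
      ∃ c : E (n + 1) → E (n + 1) → ℝ, (∀ p ∈ K, c p ∈ polyFun (n + 1) l) ∧
        (∀ p ∈ K, ∀ y ∈ hull (K.erase p),
          ⟪unitNormal (K.erase p), ∑ q ∈ K, c q y • (y - q)⟫_ℝ = h⁻¹ * γ p y) ∧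
        (∀ u : E (n + 1) → E (n + 1), Continuous u →
          (1 / 2) * (∫ y in hull K, ‖u y‖ ^ 2) - C * (∫ y in hull K, ‖u y - G y‖ ^ 2) -
            (1 / 4) * (h⁻¹ * ∑ p ∈ K, ∫ y, γ p y ^ 2 ∂faceMeasure (K.erase p)) ≤
          -∫ y in hull K, ⟪∑ q ∈ K, c q y • (y - q), u y⟫_ℝ) ∧
        ∫ y in hull K, ‖∑ p ∈ K, c p y • (y - p)‖ ^ 2 ≤ C * ((∫ y in hull K, ‖G y‖ ^ 2) +
          h⁻¹ * ∑ p ∈ K, ∫ y, γ p y ^ 2 ∂faceMeasure (K.erase p)) := by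
  obtain ⟨C₁, hC₁, H₁⟩ := exists_face_lifting n l hρ
  obtain ⟨C₂, hC₂, H₂⟩ := exists_vertex_form_ge (n + 1) l hρ
  have hB : 0 < 4 * C₂ * (C₁ + 1) := by positivity
  refine ⟨2 * (4 * C₂ * (C₁ + 1)) ^ 2 + 2 * C₁ + (2 * C₂ ^ 2 * (C₁ + 1) + 2 * (C₁ + 1)), by positivity,
    fun K h hR G hG γ hγ => ?_⟩
  have hh := hR.h_pos
  have hK := hR.simplex
  obtain ⟨c, hc, hcF, hcK⟩ := H₁ K h hR γ hγ
  set S := h⁻¹ * ∑ p ∈ K, ∫ y, γ p y ^ 2 ∂faceMeasure (K.erase p)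
  have hS : 0 ≤ S := mul_nonneg (by positivity)
    (Finset.sum_nonneg fun p _ => integral_nonneg fun y => sq_nonneg _)
  have hG0 (i) : (fun y => G y i) ∈ polyFun (n + 1) l := by
    simpa using hG i _ (polyFun_const (k := 1) 1)
  have hGc : Continuous G := continuous_of_coord fun i => continuous_polyFun (hG0 i)
  set Y₁ : E (n + 1) → E (n + 1) := fun y => ∑ p ∈ K, c p y • (y - p)
  set Y₂ : E (n + 1) → E (n + 1) := fun y =>
    (h ^ 2)⁻¹ • ∑ p ∈ K, (bary K p y * ⟪G y, p⟫_ℝ) • (y - p)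
  have hsum (y) : ∑ p ∈ K, (4 * C₂ * (C₁ + 1) * (h ^ 2)⁻¹ * (bary K p y * ⟪G y, p⟫_ℝ) + c p y) • (y - p) =
      (4 * C₂ * (C₁ + 1)) • Y₂ y + Y₁ y := by
    simp only [Y₁, Y₂, Finset.smul_sum, ← Finset.sum_add_distrib]
    exact Finset.sum_congr rfl fun p _ => by module
  have hY₁c : Continuous Y₁ := continuous_finsetSum _ fun p hp =>
    (continuous_polyFun (hc p hp)).smul (continuous_id.sub continuous_const)
  have hY₂c : Continuous Y₂ := by
    have := fun p => continuous_bary K p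
    fun_prop
  have hY₂ (y) (hy : y ∈ hull K) : ‖Y₂ y‖ ≤ ‖G y‖ := by
    simp only [Y₂]
    rw [norm_smul, Real.norm_of_nonneg (by positivity), inv_mul_le_iff₀ (by positivity)]
    refine hK.norm_sum_bary_inner_smul_sub_le _ hy fun p hp => ?_
    rw [← dist_eq_norm]
    exact hR.dist_le y hy p (IsSimplex.mem_hull hp)
  have hY₂G (y) : ⟪Y₂ y, G y⟫_ℝ = -((h ^ 2)⁻¹ * ∑ p ∈ K, bary K p y * ⟪G y, y - p⟫_ℝ ^ 2) := by
    simp only [Y₂]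
    rw [real_inner_smul_left, hK.inner_sum_bary_inner_smul_sub, mul_neg]
  have hform := H₂ K h hR G hG0
  have hformc : Continuous fun y => (h ^ 2)⁻¹ * ∑ p ∈ K, bary K p y * ⟪G y, y - p⟫_ℝ ^ 2 := by
    have := fun p => continuous_bary K p
    fun_prop
  have hGi : 0 ≤ ∫ y in hull K, ‖G y‖ ^ 2 := integral_nonneg fun y => sq_nonneg _
  refine ⟨fun p y => 4 * C₂ * (C₁ + 1) * (h ^ 2)⁻¹ * (bary K p y * ⟪G y, p⟫_ℝ) + c p y,
    fun p hp => ?_, fun p hp y hy => ?_, fun u hu => ?_, ?_⟩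
  · refine polyFun_add (polyFun_const_mul _ ?_) (hc p hp)
    have : (fun y => bary K p y * ⟪G y, p⟫_ℝ) = fun y => ∑ i, p i * (bary K p y * G y i) := by
      funext y
      rw [PiLp.inner_apply, Finset.mul_sum]
      exact Finset.sum_congr rfl fun i _ => by simp; ring
    rw [this]
    exact polyFun_sum fun i _ => polyFun_const_mul _ (hG i _ (polyFun_affineMap _))
  · have h0 := ((hK.mem_hull_erase hp).1 hy).2
    rw [inner_unitNormal_sum_smul_sub hK hp _ h0]
    simp only [h0, zero_mul, mul_zero, zero_add]
    exact hcF p hp y hy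
  · simp only [hsum]
    refine le_trans ?_ (le_neg_setIntegral_inner_smul_add hGc hY₁c hY₂c hY₂ hC₁ hC₂ hcK hformc
      hY₂G ?_ hu)
    · have h1 : 0 ≤ ∫ y in hull K, ‖u y - G y‖ ^ 2 := integral_nonneg fun y => sq_nonneg _
      have : 0 ≤ (2 * (4 * C₂ * (C₁ + 1)) ^ 2 + 2 * C₁) * ∫ y in hull K, ‖u y - G y‖ ^ 2 := by
        positivity
      linarith
    · rw [integral_const_mul]
      have := mul_le_mul_of_nonneg_left hform (show 0 ≤ (h ^ 2)⁻¹ by positivity)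
      rw [inv_mul_cancel_left₀ (by positivity)] at this
      linarith
  · simp only [hsum]
    refine (setIntegral_norm_sq_smul_add_le hGc hY₁c hY₂c hY₂ hcK hB.le).trans ?_
    have h1 : 0 ≤ (2 * C₁ + (2 * C₂ ^ 2 * (C₁ + 1) + 2 * (C₁ + 1))) * ∫ y in hull K, ‖G y‖ ^ 2 := by
      positivity
    have h2 : 0 ≤ (2 * (4 * C₂ * (C₁ + 1)) ^ 2 + (2 * C₂ ^ 2 * (C₁ + 1) + 2 * (C₁ + 1))) * S := by
      positivity
    linarith

end CauchyFEM

namespace CauchyFEM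

/-! ### The global test field -/

namespace SimplicialMesh

section

variable {d : ℕ} {Ω : Set (E d)} (M : SimplicialMesh Ω) (hΩ : IsConvexPolytopeDomain Ω)
include hΩ

theorem setIntegral_eq_sum_of_ae {u : E d → ℝ} {w : Finset (E d) → E d → ℝ}
    (h : ∀ K ∈ M.cells, ∀ᵐ y ∂volume.restrict (interior (hull K)), u y = w K y)
    (hw : ∀ K ∈ M.cells, Continuous (w K)) :
    ∫ y in Ω, u y = ∑ K ∈ M.cells, ∫ y in hull K, w K y := by
  have h1 : u =ᵐ[volume.restrict Ω] M.glue w := by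
    refine (M.ae_restrict_iff_cells hΩ).2 fun K hK => ?_
    filter_upwards [h K hK, ae_restrict_mem isOpen_interior.measurableSet] with y hy hyK
    rw [hy, M.glue_eqOn w hK hyK]
  have h2 : Integrable (M.glue w) (volume.restrict Ω) :=
    memLp_one_iff_integrable.1 (M.memLp_of_eqOn hΩ (fun K hK => M.glue_eqOn w hK) hw 1)
  rw [integral_congr_ae h1, M.setIntegral_eq_sum hΩ h2]
  refine Finset.sum_congr rfl fun K hK => ?_
  rw [← restrict_interior_hull]
  exact setIntegral_congr_fun isOpen_interior.measurableSet (M.glue_eqOn w hK)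

theorem setIntegral_eq_sum_of_eqOn {u : E d → ℝ} {w : Finset (E d) → E d → ℝ}
    (h : ∀ K ∈ M.cells, EqOn u (w K) (interior (hull K)))
    (hw : ∀ K ∈ M.cells, Continuous (w K)) :
    ∫ y in Ω, u y = ∑ K ∈ M.cells, ∫ y in hull K, w K y :=
  M.setIntegral_eq_sum_of_ae hΩ
    (fun K hK => ae_restrict_of_forall_mem isOpen_interior.measurableSet (h K hK)) hw

/-- Pythagoras: the projection error is orthogonal to the projection. -/
theorem setIntegral_norm_projVecPred_sq_le (l : ℕ) {f : E d → E d}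
    (hf : MemLp f 2 (volume.restrict Ω)) (hπ : MemLp (M.projVecPred l f) 2 (volume.restrict Ω)) :
    ∫ y in Ω, ‖M.projVecPred l f y‖ ^ 2 ≤ ∫ y in Ω, ‖f y‖ ^ 2 := by
  have h1 := (M.projVecPred_spec hΩ l hf).2 f hf
  have h2 : ∫ y in Ω, ‖f y‖ ^ 2 = (∫ y in Ω, ‖M.projVecPred l f y‖ ^ 2) +
      (∫ y in Ω, ‖M.projVecPred l f y - f y‖ ^ 2) -
      2 * ∫ y in Ω, ⟪M.projVecPred l f y - f y, M.projVecPred l f y⟫_ℝ := by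
    have ha := integrable_norm_sq_of_memLp hπ
    have hb : Integrable (fun y => ‖M.projVecPred l f y - f y‖ ^ 2) (volume.restrict Ω) :=
      integrable_norm_sq_of_memLp (hπ.sub hf)
    have hc : Integrable (fun y => ⟪M.projVecPred l f y - f y, M.projVecPred l f y⟫_ℝ)
      (volume.restrict Ω) := integrable_inner_of_memLp (hπ.sub hf) hπ
    rw [← integral_const_mul, ← integral_add ha hb, ← integral_sub (by exact ha.add hb)
      (hc.const_mul 2)]
    refine integral_congr_ae (Filter.Eventually.of_forall fun y => ?_)
    have h3 := norm_sub_sq_real (M.projVecPred l f y) (M.projVecPred l f y - f y)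
    rw [sub_sub_cancel, real_inner_comm] at h3
    change ‖f y‖ ^ 2 = _ + _ - _
    linarith
  rw [h1, mul_zero, sub_zero] at h2
  rw [h2]
  exact le_add_of_nonneg_right (integral_nonneg fun y => sq_nonneg _)

end

variable {n : ℕ} {Ω : Set (E (n + 1))} (M : SimplicialMesh Ω)

theorem integrable_faceMeasure_of_mem {F : Finset (E (n + 1))} (hF : F ∈ M.faces)
    {u : E (n + 1) → ℝ} (hu : Continuous u) : Integrable u (faceMeasure F) := by
  obtain ⟨K, hK⟩ := M.adj_nonempty hF
  obtain ⟨hKc, hFK⟩ := M.mem_adj.1 hK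
  obtain ⟨p, hp, rfl⟩ := M.exists_erase_eq hKc hF hFK
  exact integrable_faceMeasure (M.isSimplex hKc) hp hu

theorem sum_adj_orient_mul_integral {F : Finset (E (n + 1))} (hF : F ∈ M.faces)
    {g : Finset (E (n + 1)) → E (n + 1) → ℝ} (hg : ∀ K ∈ M.cells, Continuous (g K))
    {q : Finset (E (n + 1)) → E (n + 1) → ℝ} {w : E (n + 1) → ℝ} (hw : Continuous w)
    (hq : ∀ K ∈ M.adj F, ∀ y ∈ hull F, q K y = w y) :
    ∑ K ∈ M.adj F, orient K F * ∫ y, q K y * g K y ∂faceMeasure F =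
      ∫ y, M.orientedJump g F y * w y ∂faceMeasure F := by
  simp only [orientedJump, Finset.sum_mul]
  rw [integral_finsetSum _ fun K hK => M.integrable_faceMeasure_of_mem hF (by
    have := hg K (M.mem_adj.1 hK).1
    fun_prop)]
  refine Finset.sum_congr rfl fun K hK => ?_
  rw [← integral_const_mul]
  refine integral_congr_ae ?_
  filter_upwards [ae_faceMeasure_mem F] with y hy
  rw [hq K hK y hy]
  ring

theorem sum_cells_sum_faces_le {J : Finset (E (n + 1)) → ℝ} (hJ : ∀ F, 0 ≤ J F) :
    ∑ K ∈ M.cells, ∑ p ∈ K, J (K.erase p) ≤ 2 * ∑ F ∈ M.faces, J F := by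
  rw [M.sum_faces_eq fun _ F => J F, Finset.mul_sum]
  refine Finset.sum_le_sum fun F hF => ?_
  rw [Finset.sum_const, nsmul_eq_mul]
  exact mul_le_mul_of_nonneg_right (by exact_mod_cast M.card_adj_le hF) (hJ F)

end SimplicialMesh

-- The cell fields for $G=\pi_{X,l-1}\nabla x$ and the projected oriented jumps share normal traces
-- across faces, so they glue to a member of $D_0^l$. The Gauss theorem gives
-- $(\nabla\cdot\eta,x)=J-(\eta,\nabla x)$ with the jump part $J$ of the broken norm, and
-- `exists_cell_field` bounds the last term from below. The divergence bound is an inverse estimate.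
open Classical in
theorem exists_test_field (n l m : ℕ) {ρ : ℝ} (hρ : 0 < ρ) :
    ∃ C : ℝ, 0 < C ∧ ∀ (Ω Sig : Set (E (n + 1))), IsConvexPolytopeDomain Ω →
      ∀ M : SimplicialMesh Ω, (∀ K ∈ M.cells, CellReg ρ M.h K) → ∀ x ∈ M.X m,
      ∃ η ∈ M.D0 Sig l,
        (1 / 2) * M.brokenH1Norm Sig l x ^ 2 -
          C * (∫ y in Ω, ‖gradient x y - M.projVecPred l (gradient x) y‖ ^ 2) ≤
            ∫ y in Ω, weakDiv Ω η y * x y ∧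
        ∫ y in Ω, ‖η y‖ ^ 2 ≤ C * M.brokenH1Norm Sig l x ^ 2 ∧
        M.h ^ 2 * ∫ y in Ω, weakDiv Ω η y ^ 2 ≤ C * M.brokenH1Norm Sig l x ^ 2 := by
  obtain ⟨C₁, hC₁, H₁⟩ := exists_cell_field n l hρ
  obtain ⟨C₂, hC₂, H₂⟩ := exists_divg_sq_le (n + 1) (l + 1) hρ
  refine ⟨2 * C₁ + C₂ * (2 * C₁), by positivity, fun Ω Sig hΩ M hreg x hx => ?_⟩
  choose! g hg hxg using hx
  have hgc (K) (hK : K ∈ M.cells) : Continuous (g K) := continuous_polyFun (hg K hK)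
  have hgrc (K) (hK : K ∈ M.cells) : Continuous (gradient (g K)) :=
    continuous_gradient (contDiff_polyFun (hg K hK))
  have hgr (K) (hK : K ∈ M.cells) : EqOn (gradient x) (gradient (g K)) (interior (hull K)) :=
    fun y hy => gradient_congr_of_eqOn isOpen_interior (hxg K hK) hy
  have hgrL : MemLp (gradient x) 2 (volume.restrict Ω) := M.memLp_of_eqOn hΩ hgr hgrc 2
  obtain ⟨⟨G, hGeq, hGp⟩, -⟩ := M.projVecPred_spec hΩ l hgrL
  have hGc (K) (hK : K ∈ M.cells) : Continuous (G K) := continuous_of_coord fun i =>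
    continuous_polyFun (by simpa using hGp K hK i _ (polyFun_const (k := 1) 1))
  have hGL : MemLp (M.projVecPred l (gradient x)) 2 (volume.restrict Ω) :=
    M.memLp_of_eqOn hΩ hGeq hGc 2
  have hstab := M.setIntegral_norm_projVecPred_sq_le hΩ l hgrL hGL
  obtain ⟨γ, hγ, hB⟩ := M.brokenH1Norm_sq hΩ Sig l hxg hgc
  -- Zero normal trace is prescribed on `Sig`, as $D_0^l$ requires; the broken norm omits exactly
  -- these faces.
  obtain ⟨γ', hγ'⟩ : ∃ γ' : Finset (E (n + 1)) → E (n + 1) → ℝ,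
      ∀ F, γ' F = if F ∈ M.facesOn Sig then fun _ => 0 else γ F := ⟨_, fun _ => rfl⟩
  have hγp (F) (hF : F ∈ M.faces) : γ' F ∈ polyFun (n + 1) l := by
    rw [hγ']
    split_ifs
    · exact polyFun_zero
    · exact (hγ F hF).1
  have H := fun K (hK : K ∈ M.cells) => H₁ K M.h (hreg K hK) (G K) (hGp K hK)
    (fun p => γ' (K.erase p)) fun p hp => hγp _ (M.erase_mem_faces hK hp)
  choose! c hc hcn hcu hcη using H
  obtain ⟨f, hf⟩ : ∃ f : Finset (E (n + 1)) → E (n + 1) → E (n + 1),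
      f = fun K y => ∑ p ∈ K, c K p y • (y - p) := ⟨_, rfl⟩
  have hfp (K) (hK : K ∈ M.cells) (i) : (fun y => f K y i) ∈ polyFun (n + 1) (l + 1) := by
    have : (fun y => f K y i) = fun y => ∑ p ∈ K, c K p y * (y i - p i) := by
      ext y; simp [hf]
    rw [this]
    exact polyFun_sum fun p hp => polyFun_mul (hc K hK p hp)
      (polyFun_sub (polyFun_coord i) (polyFun_const _))
  have hfc (K) (hK : K ∈ M.cells) : Continuous (f K) := SimplicialMesh.continuous_pieces (hfp K hK)
  have hfd (K) (hK : K ∈ M.cells) (i) : ContDiff ℝ 1 fun y => f K y i := contDiff_polyFun (hfp K hK i)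
  have hdc (K) (hK : K ∈ M.cells) : Continuous (divg (f K)) := continuous_divg (hfd K hK)
  have hnormal : ∀ F ∈ M.faces, ∀ K ∈ M.adj F, ∀ y ∈ hull F,
      ⟪unitNormal F, f K y⟫_ℝ = M.h⁻¹ * γ' F y := by
    intro F hF K hK y hy
    obtain ⟨hKc, hFK⟩ := M.mem_adj.1 hK
    obtain ⟨p, hp, rfl⟩ := M.exists_erase_eq hKc hF hFK
    rw [hf]
    exact hcn K hKc p hp y hy
  have hη : M.glue f ∈ M.D0 Sig l := by
    rw [hf] at hnormal ⊢
    refine M.glue_mem_D0 hΩ hc hnormal fun F hF y => ?_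
    rw [hγ', if_pos hF, mul_zero]
  have hηeq (K) (hK : K ∈ M.cells) : EqOn (M.glue f) (f K) (interior (hull K)) := M.glue_eqOn f hK
  have hdiv (K) (hK : K ∈ M.cells) : ∀ᵐ y ∂volume.restrict (interior (hull K)),
      weakDiv Ω (M.glue f) y = divg (f K) y :=
    M.weakDiv_eq_on_cell hΩ (weakDiv_spec hη.1.1) hK (hfd K hK) (hηeq K hK)
  -- the jump contributions
  obtain ⟨J, hJ⟩ : ∃ J, J = ∑ F ∈ M.faces \ M.facesOn Sig, M.h⁻¹ * ∫ y, γ F y ^ 2 ∂faceMeasure F :=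
    ⟨_, rfl⟩
  have hJγ' : J = ∑ F ∈ M.faces, M.h⁻¹ * ∫ y, γ' F y ^ 2 ∂faceMeasure F := by
    rw [hJ, ← Finset.sum_sdiff (fun F hF => (M.mem_facesOn.1 hF).1 : M.facesOn Sig ⊆ M.faces),
      Finset.sum_eq_zero (s := M.facesOn Sig) fun F hF => by simp [hγ', hF], add_zero]
    refine Finset.sum_congr rfl fun F hF => ?_
    rw [hγ', if_neg (Finset.mem_sdiff.1 hF).2]
  -- A face belongs to at most two cells, so the cellwise loss with factor $\frac14$ adds up to at
  -- most $\frac12J$ and half of the jump part remains.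
  have hcells : ∑ K ∈ M.cells, M.h⁻¹ * ∑ p ∈ K, ∫ y, γ' (K.erase p) y ^ 2 ∂faceMeasure (K.erase p) ≤
      2 * J := by
    have := M.sum_cells_sum_faces_le (J := fun F => M.h⁻¹ * ∫ y, γ' F y ^ 2 ∂faceMeasure F)
      fun F => mul_nonneg (inv_nonneg.2 M.h_nonneg) (integral_nonneg fun y => sq_nonneg _)
    rw [hJγ']
    simpa only [Finset.mul_sum] using this
  have hJ0 : 0 ≤ J := by
    rw [hJ]
    exact Finset.sum_nonneg fun F _ =>
      mul_nonneg (inv_nonneg.2 M.h_nonneg) (integral_nonneg fun y => sq_nonneg _)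
  -- The normal trace has degree $l$ on each face, so the jump tested against it may be replaced by
  -- its projection.
  have hgauss : (∑ K ∈ M.cells, ∫ y in hull K, divg (f K) y * g K y) +
      ∑ K ∈ M.cells, ∫ y in hull K, ⟪f K y, gradient (g K) y⟫_ℝ = J := by
    have h1 := M.sum_gauss hfd (φ := g) fun K hK => contDiff_polyFun (hg K hK)
    rw [← Finset.sum_add_distrib, hJγ']
    refine Eq.trans (Finset.sum_congr rfl fun K hK => ?_) (h1.trans
      (Finset.sum_congr rfl fun F hF => ?_))
    · exact (integral_add (integrableOn_hull ((hdc K hK).mul (hgc K hK)) K)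
        (integrableOn_hull ((hfc K hK).inner (hgrc K hK)) K)).symm
    · rw [M.sum_adj_orient_mul_integral hF hgc (w := fun y => M.h⁻¹ * γ' F y)
        (continuous_const.mul (continuous_polyFun (hγp F hF))) (hnormal F hF), ← integral_const_mul]
      have h2 := (hγ F hF).2 _ (polyFun_const_mul M.h⁻¹ (hγp F hF))
      rw [← h2]
      refine integral_congr_ae (Filter.Eventually.of_forall fun y => ?_)
      simp only [hγ']
      split_ifs
      · simp
      · ring
  have hN : ∫ y in Ω, ‖gradient x y‖ ^ 2 = ∑ K ∈ M.cells, ∫ y in hull K, ‖gradient (g K) y‖ ^ 2 :=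
    M.setIntegral_eq_sum_of_eqOn hΩ (fun K hK y hy => by simp only [hgr K hK hy])
      fun K hK => (hgrc K hK).norm.pow 2
  have hNG : ∫ y in Ω, ‖M.projVecPred l (gradient x) y‖ ^ 2 =
      ∑ K ∈ M.cells, ∫ y in hull K, ‖G K y‖ ^ 2 :=
    M.setIntegral_eq_sum_of_eqOn hΩ (fun K hK y hy => by simp only [hGeq K hK hy])
      fun K hK => (hGc K hK).norm.pow 2
  have hNe : ∫ y in Ω, ‖gradient x y - M.projVecPred l (gradient x) y‖ ^ 2 =
      ∑ K ∈ M.cells, ∫ y in hull K, ‖gradient (g K) y - G K y‖ ^ 2 :=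
    M.setIntegral_eq_sum_of_eqOn hΩ (fun K hK y hy => by simp only [hgr K hK hy, hGeq K hK hy])
      fun K hK => ((hgrc K hK).sub (hGc K hK)).norm.pow 2
  have hNη : ∫ y in Ω, ‖M.glue f y‖ ^ 2 = ∑ K ∈ M.cells, ∫ y in hull K, ‖f K y‖ ^ 2 :=
    M.setIntegral_eq_sum_of_eqOn hΩ (fun K hK y hy => by simp only [hηeq K hK hy])
      fun K hK => (hfc K hK).norm.pow 2
  have hNd : ∫ y in Ω, weakDiv Ω (M.glue f) y ^ 2 = ∑ K ∈ M.cells, ∫ y in hull K, divg (f K) y ^ 2 :=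
    M.setIntegral_eq_sum_of_ae hΩ (fun K hK => by
      filter_upwards [hdiv K hK] with y hy
      rw [hy]) fun K hK => (hdc K hK).pow 2
  have hNx : ∫ y in Ω, weakDiv Ω (M.glue f) y * x y =
      ∑ K ∈ M.cells, ∫ y in hull K, divg (f K) y * g K y :=
    M.setIntegral_eq_sum_of_ae hΩ (fun K hK => by
      filter_upwards [hdiv K hK, ae_restrict_mem isOpen_interior.measurableSet] with y hy hyK
      rw [hy, hxg K hK hyK]) fun K hK => (hdc K hK).mul (hgc K hK)
  rw [← hN, ← hJ] at hB
  have hsum1 := Finset.sum_le_sum fun K hK => hcu K hK (gradient (g K)) (hgrc K hK)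
  have hsum2 := Finset.sum_le_sum hcη
  have hbound : ∫ y in Ω, ‖M.glue f y‖ ^ 2 ≤ 2 * C₁ * M.brokenH1Norm Sig l x ^ 2 := by
    rw [← Finset.mul_sum, Finset.sum_add_distrib, ← hNG] at hsum2
    rw [hNη, hB]
    have hfe : ∀ K y, f K y = ∑ p ∈ K, c K p y • (y - p) := fun K y => by rw [hf]
    simp only [hfe]
    refine hsum2.trans ?_
    have h0 : 0 ≤ ∫ y in Ω, ‖gradient x y‖ ^ 2 := integral_nonneg fun y => sq_nonneg _
    calc _ ≤ C₁ * ((∫ y in Ω, ‖gradient x y‖ ^ 2) + 2 * J) := by gcongr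
      _ ≤ _ := by nlinarith [mul_nonneg hC₁.le h0]
  have hB0 : 0 ≤ M.brokenH1Norm Sig l x ^ 2 := sq_nonneg _
  refine ⟨M.glue f, hη, ?_, ?_, ?_⟩
  · rw [Finset.sum_neg_distrib, Finset.sum_sub_distrib, Finset.sum_sub_distrib, ← Finset.mul_sum,
      ← Finset.mul_sum, ← Finset.mul_sum, ← hN, ← hNe] at hsum1
    rw [hNx, hB]
    have hfe : ∀ K y, ∑ p ∈ K, c K p y • (y - p) = f K y := fun K y => by rw [hf]
    simp only [hfe] at hsum1
    have h0 : 0 ≤ ∫ y in Ω, ‖gradient x y - M.projVecPred l (gradient x) y‖ ^ 2 :=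
      integral_nonneg fun y => sq_nonneg _
    have h1 : 0 ≤ (C₁ + C₂ * (2 * C₁)) *
      ∫ y in Ω, ‖gradient x y - M.projVecPred l (gradient x) y‖ ^ 2 := by positivity
    linarith
  · refine hbound.trans ?_
    have : 0 ≤ C₂ * (2 * C₁) * M.brokenH1Norm Sig l x ^ 2 := by positivity
    linarith
  · obtain ⟨K₀, hK₀⟩ := M.cells_nonempty hΩ
    have hh := (hreg K₀ hK₀).h_pos
    have h1 : ∫ y in Ω, weakDiv Ω (M.glue f) y ^ 2 ≤
        C₂ * ((M.h ^ 2)⁻¹ * ∫ y in Ω, ‖M.glue f y‖ ^ 2) := by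
      rw [hNd, hNη, Finset.mul_sum, Finset.mul_sum]
      exact Finset.sum_le_sum fun K hK => H₂ K M.h (hreg K hK) (f K) (hfp K hK)
    calc M.h ^ 2 * ∫ y in Ω, weakDiv Ω (M.glue f) y ^ 2
        ≤ M.h ^ 2 * (C₂ * ((M.h ^ 2)⁻¹ * ∫ y in Ω, ‖M.glue f y‖ ^ 2)) := by gcongr
      _ = C₂ * ∫ y in Ω, ‖M.glue f y‖ ^ 2 := by field_simp
      _ ≤ C₂ * (2 * C₁ * M.brokenH1Norm Sig l x ^ 2) := by gcongr
      _ ≤ _ := by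
        have : 0 ≤ 2 * C₁ * M.brokenH1Norm Sig l x ^ 2 := by positivity
        linarith

end CauchyFEM

namespace CauchyFEM

/-! ### Inverse estimate and triangle inequality for the broken norm -/

/-- From $h\le\sigma\operatorname{diam}K\le\sigma^2r$ the ball has radius at least $h/(\sigma^2+1)$.
The added 1 makes the ratio positive before $\sigma>0$ is known. -/
theorem SimplicialMesh.IsRegular.cellReg {n : ℕ} {Ω : Set (E (n + 1))} {M : SimplicialMesh Ω}
    {σ : ℝ} (hM : M.IsRegular σ) : ∀ K ∈ M.cells, CellReg (1 / (σ ^ 2 + 1)) M.h K := by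
  intro K hK
  have hKs := M.isSimplex hK
  obtain ⟨h1, c, r, hr, hball, h2⟩ := hM K hK
  have hb : Bornology.IsBounded (hull K) := (isCompact_hull K).isBounded
  have hdiam : 0 < Metric.diam (hull K) := by
    obtain ⟨p, hp, q, hq, hpq⟩ := hKs.nontrivial
    exact (dist_pos.2 hpq).trans_le
      (Metric.dist_le_diam_of_mem hb (IsSimplex.mem_hull hp) (IsSimplex.mem_hull hq))
  have hle : Metric.diam (hull K) ≤ M.h :=
    le_csSup (M.cells.finite_toSet.image _).bddAbove (mem_image_of_mem _ hK)
  have hσ : 0 < σ := by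
    by_contra h
    nlinarith
  refine ⟨hKs, hdiam.trans_le hle, fun x hx y hy =>
    (Metric.dist_le_diam_of_mem hb hx hy).trans hle, c, ?_⟩
  refine (Metric.ball_subset_ball ?_).trans hball
  rw [one_div, inv_mul_le_iff₀ (by positivity)]
  nlinarith

namespace SimplicialMesh

variable {n : ℕ} {Ω : Set (E (n + 1))} (M : SimplicialMesh Ω)

theorem orient_sq_of_mem_adj {F K : Finset (E (n + 1))} (hF : F ∈ M.faces) (hK : K ∈ M.adj F) :
    orient K F ^ 2 = 1 := by
  obtain ⟨hKc, hFK⟩ := M.mem_adj.1 hK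
  obtain ⟨p, hp, rfl⟩ := M.exists_erase_eq hKc hF hFK
  rw [pow_two]
  exact orient_sq (M.isSimplex hKc) hp

theorem orientedJump_sq_le {F : Finset (E (n + 1))} (hF : F ∈ M.faces)
    (g : Finset (E (n + 1)) → E (n + 1) → ℝ) (y : E (n + 1)) :
    M.orientedJump g F y ^ 2 ≤ 2 * ∑ K ∈ M.adj F, g K y ^ 2 := by
  refine (sq_sum_le_card_mul_sum_sq (s := M.adj F)).trans ?_
  have h : ∑ K ∈ M.adj F, (orient K F * g K y) ^ 2 = ∑ K ∈ M.adj F, g K y ^ 2 :=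
    Finset.sum_congr rfl fun K hK => by rw [mul_pow, M.orient_sq_of_mem_adj hF hK, one_mul]
  rw [h]
  exact mul_le_mul_of_nonneg_right (by exact_mod_cast M.card_adj_le hF)
    (Finset.sum_nonneg fun K _ => sq_nonneg _)

theorem continuous_orientedJump {F : Finset (E (n + 1))}
    {g : Finset (E (n + 1)) → E (n + 1) → ℝ} (hg : ∀ K ∈ M.cells, Continuous (g K)) :
    Continuous (M.orientedJump g F) :=
  continuous_finsetSum _ fun K hK => continuous_const.mul (hg K (M.mem_adj.1 hK).1)

end SimplicialMesh

theorem gradient_neg_add_const_mul {d : ℕ} {u w : E d → ℝ} (hu : Differentiable ℝ u)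
    (hw : Differentiable ℝ w) (t : ℝ) (y : E d) :
    gradient (fun y => -u y + t * w y) y = -gradient u y + t • gradient w y := by
  have h : HasGradientAt (fun y => -u y + t * w y) (-gradient u y + t • gradient w y) y := by
    rw [hasGradientAt_iff_hasFDerivAt, map_add, map_neg, map_smul]
    exact ((hu y).hasGradientAt.hasFDerivAt.neg).add ((hw y).hasGradientAt.hasFDerivAt.const_mul t)
  exact h.gradient

/-- Contractivity of an orthogonal projection, extracted from the single relation
$\|\gamma\|^2=(w,\gamma)$. -/
theorem integral_sq_le_of_integral_sq_eq {X : Type*} [MeasurableSpace X] {ν : Measure X}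
    {γ w : X → ℝ} (hγ : Integrable (fun y => γ y ^ 2) ν) (hw : Integrable (fun y => w y ^ 2) ν)
    (hγw : Integrable (fun y => w y * γ y) ν) (h : ∫ y, γ y ^ 2 ∂ν = ∫ y, w y * γ y ∂ν) :
    ∫ y, γ y ^ 2 ∂ν ≤ ∫ y, w y ^ 2 ∂ν := by
  have h1 : ∫ y, 2 * (w y * γ y) ∂ν ≤ ∫ y, (w y ^ 2 + γ y ^ 2) ∂ν :=
    integral_mono (hγw.const_mul 2) (hw.add hγ) fun y => by
      change 2 * (w y * γ y) ≤ w y ^ 2 + γ y ^ 2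
      nlinarith [sq_nonneg (w y - γ y)]
  rw [integral_const_mul, integral_add hw hγ, ← h] at h1
  linarith

/-- Gradients cost $h^{-2}$. For jumps, the projection is a contraction, the jump is bounded by the
traces from the adjacent cells, and the trace estimate adds $h^{-1}$ to the weight $h^{-1}$. Each
cell has $n+2$ faces. -/
theorem exists_brokenH1Norm_sq_le (n l m : ℕ) {ρ : ℝ} (hρ : 0 < ρ) :
    ∃ C : ℝ, 0 < C ∧ ∀ (Ω Sig : Set (E (n + 1))), IsConvexPolytopeDomain Ω →
      ∀ M : SimplicialMesh Ω, (∀ K ∈ M.cells, CellReg ρ M.h K) → ∀ x ∈ M.X m,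
      M.h ^ 2 * M.brokenH1Norm Sig l x ^ 2 ≤ C * ∫ y in Ω, x y ^ 2 := by
  obtain ⟨C₁, hC₁, H₁⟩ := exists_cell_gradient_le (n + 1) m hρ
  obtain ⟨C₂, hC₂, H₂⟩ := exists_trace_sq_le n m hρ
  refine ⟨C₁ + 2 * ((n + 2) * C₂), by positivity, fun Ω Sig hΩ M hreg x hx => ?_⟩
  choose! g hg hxg using hx
  have hgc (K) (hK : K ∈ M.cells) : Continuous (g K) := continuous_polyFun (hg K hK)
  obtain ⟨γ, hγ, hB⟩ := M.brokenH1Norm_sq hΩ Sig l hxg hgc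
  obtain ⟨K₀, hK₀⟩ := M.cells_nonempty hΩ
  have hh := (hreg K₀ hK₀).h_pos
  have hI : ∫ y in Ω, x y ^ 2 = ∑ K ∈ M.cells, ∫ y in hull K, g K y ^ 2 :=
    M.setIntegral_eq_sum_of_eqOn hΩ (fun K hK y hy => by simp only [hxg K hK hy])
      fun K hK => (hgc K hK).pow 2
  have hgrad : ∑ K ∈ M.cells, ∫ y in hull K, ‖gradient (g K) y‖ ^ 2 ≤
      C₁ * ((M.h ^ 2)⁻¹ * ∫ y in Ω, x y ^ 2) := by
    rw [hI, Finset.mul_sum, Finset.mul_sum]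
    exact Finset.sum_le_sum fun K hK => H₁ K M.h (hreg K hK) _ (hg K hK)
  have hface (F) (hF : F ∈ M.faces) : ∫ y, γ F y ^ 2 ∂faceMeasure F ≤
      2 * ∑ K ∈ M.adj F, ∫ y, g K y ^ 2 ∂faceMeasure F := by
    have hγc := continuous_polyFun (hγ F hF).1
    have hJc := M.continuous_orientedJump (F := F) hgc
    have hint {u : E (n + 1) → ℝ} (hu : Continuous u) := M.integrable_faceMeasure_of_mem hF hu
    have h1 : ∫ y, γ F y ^ 2 ∂faceMeasure F ≤ ∫ y, M.orientedJump g F y ^ 2 ∂faceMeasure F :=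
      integral_sq_le_of_integral_sq_eq (hint (hγc.pow 2)) (hint (hJc.pow 2)) (hint (hJc.mul hγc))
        (by rw [← (hγ F hF).2 _ (hγ F hF).1]; simp only [pow_two])
    refine h1.trans ?_
    have hgi (K) (hK : K ∈ M.adj F) : Integrable (fun y => g K y ^ 2) (faceMeasure F) :=
      hint ((hgc K (M.mem_adj.1 hK).1).pow 2)
    rw [← integral_finsetSum _ hgi, ← integral_const_mul]
    exact integral_mono (hint (hJc.pow 2)) ((integrable_finsetSum _ hgi).const_mul 2)
      fun y => M.orientedJump_sq_le hF g y
  have hjump : ∑ F ∈ M.faces \ M.facesOn Sig, M.h⁻¹ * ∫ y, γ F y ^ 2 ∂faceMeasure F ≤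
      2 * ((n + 2) * C₂) * ((M.h ^ 2)⁻¹ * ∫ y in Ω, x y ^ 2) := by
    calc ∑ F ∈ M.faces \ M.facesOn Sig, M.h⁻¹ * ∫ y, γ F y ^ 2 ∂faceMeasure F
        ≤ ∑ F ∈ M.faces, M.h⁻¹ * ∫ y, γ F y ^ 2 ∂faceMeasure F :=
          Finset.sum_le_sum_of_subset_of_nonneg Finset.sdiff_subset fun F _ _ =>
            mul_nonneg (by positivity) (integral_nonneg fun y => sq_nonneg _)
      _ ≤ ∑ F ∈ M.faces, M.h⁻¹ * (2 * ∑ K ∈ M.adj F, ∫ y, g K y ^ 2 ∂faceMeasure F) :=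
          Finset.sum_le_sum fun F hF => mul_le_mul_of_nonneg_left (hface F hF) (by positivity)
      _ = 2 * M.h⁻¹ * ∑ K ∈ M.cells, ∑ p ∈ K, ∫ y, g K y ^ 2 ∂faceMeasure (K.erase p) := by
          rw [M.sum_faces_eq fun K F => ∫ y, g K y ^ 2 ∂faceMeasure F, Finset.mul_sum]
          exact Finset.sum_congr rfl fun F _ => by ring
      _ ≤ 2 * M.h⁻¹ * ∑ K ∈ M.cells, (n + 2) * (C₂ * (M.h⁻¹ * ∫ y in hull K, g K y ^ 2)) := by
          gcongr with K hK
          refine (Finset.sum_le_card_nsmul K _ _ fun p hp =>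
            H₂ K M.h (hreg K hK) _ (hg K hK) p hp).trans (le_of_eq ?_)
          rw [M.card_cell K hK, nsmul_eq_mul]
          push_cast
          ring
      _ = _ := by
          rw [hI, ← Finset.mul_sum, ← Finset.mul_sum, ← Finset.mul_sum]
          field_simp
  calc M.h ^ 2 * M.brokenH1Norm Sig l x ^ 2
      ≤ M.h ^ 2 * (C₁ * ((M.h ^ 2)⁻¹ * ∫ y in Ω, x y ^ 2) +
        2 * ((n + 2) * C₂) * ((M.h ^ 2)⁻¹ * ∫ y in Ω, x y ^ 2)) := by
        rw [hB]; gcongr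
    _ = _ := by field_simp

/-- The projected jumps are given only by their moments. Testing the combined one against itself
yields $\|\alpha\|^2=(-\gamma+t\beta,\alpha)$, so contractivity replaces linearity of the
projection. -/
theorem SimplicialMesh.brokenH1Norm_neg_add_sq_le {n : ℕ} {Ω : Set (E (n + 1))}
    (M : SimplicialMesh Ω) (hΩ : IsConvexPolytopeDomain Ω) (Sig : Set (E (n + 1))) (l : ℕ) {m : ℕ}
    {x R : E (n + 1) → ℝ} (hx : x ∈ M.X m) (hR : R ∈ M.X m) (t : ℝ) :
    M.brokenH1Norm Sig l (fun y => -x y + t * R y) ^ 2 ≤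
      2 * M.brokenH1Norm Sig l x ^ 2 + 2 * t ^ 2 * M.brokenH1Norm Sig l R ^ 2 := by
  choose! g hg hxg using hx
  choose! f hf hRf using hR
  have hgc (K) (hK : K ∈ M.cells) : Continuous (g K) := continuous_polyFun (hg K hK)
  have hfc (K) (hK : K ∈ M.cells) : Continuous (f K) := continuous_polyFun (hf K hK)
  obtain ⟨γ, hγ, hB⟩ := M.brokenH1Norm_sq hΩ Sig l hxg hgc
  obtain ⟨β, hβ, hB'⟩ := M.brokenH1Norm_sq hΩ Sig l hRf hfc
  obtain ⟨α, hα, hB''⟩ := M.brokenH1Norm_sq hΩ Sig l (x := fun y => -x y + t * R y)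
    (g := fun K y => -g K y + t * f K y) (fun K hK y hy => by simp only [hxg K hK hy, hRf K hK hy])
    fun K hK => (hgc K hK).neg.add (continuous_const.mul (hfc K hK))
  have hgrad (K) (hK : K ∈ M.cells) :
      ∫ y in hull K, ‖gradient (fun y => -g K y + t * f K y) y‖ ^ 2 ≤
        2 * (∫ y in hull K, ‖gradient (g K) y‖ ^ 2) +
          2 * t ^ 2 * ∫ y in hull K, ‖gradient (f K) y‖ ^ 2 := by
    have h1 := continuous_gradient (contDiff_polyFun (hg K hK))
    have h2 := continuous_gradient (contDiff_polyFun (hf K hK))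
    have h3 (y) : gradient (fun y => -g K y + t * f K y) y =
        -gradient (g K) y + t • gradient (f K) y :=
      gradient_neg_add_const_mul (differentiable_polyFun (hg K hK))
        (differentiable_polyFun (hf K hK)) t y
    simp only [h3]
    rw [← integral_const_mul, ← integral_const_mul,
      ← integral_add (integrableOn_hull (by fun_prop) K) (integrableOn_hull (by fun_prop) K)]
    refine integral_mono (integrableOn_hull (by fun_prop) K) (integrableOn_hull (by fun_prop) K)
      fun y => ?_
    have h4 : ‖-gradient (g K) y + t • gradient (f K) y‖ ≤
        ‖gradient (g K) y‖ + |t| * ‖gradient (f K) y‖ := (norm_add_le _ _).trans (by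
      rw [norm_neg, norm_smul, Real.norm_eq_abs])
    have h5 := pow_le_pow_left₀ (norm_nonneg _) h4 2
    have h6 : (|t| * ‖gradient (f K) y‖) ^ 2 = t ^ 2 * ‖gradient (f K) y‖ ^ 2 := by
      rw [mul_pow, sq_abs]
    change _ ≤ 2 * ‖gradient (g K) y‖ ^ 2 + 2 * t ^ 2 * ‖gradient (f K) y‖ ^ 2
    nlinarith [sq_nonneg (‖gradient (g K) y‖ - |t| * ‖gradient (f K) y‖)]
  have hface (F) (hF : F ∈ M.faces) : ∫ y, α F y ^ 2 ∂faceMeasure F ≤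
      2 * (∫ y, γ F y ^ 2 ∂faceMeasure F) + 2 * t ^ 2 * ∫ y, β F y ^ 2 ∂faceMeasure F := by
    have hint {u : E (n + 1) → ℝ} (hu : Continuous u) := M.integrable_faceMeasure_of_mem hF hu
    have h1 := continuous_polyFun (hα F hF).1
    have h2 := continuous_polyFun (hβ F hF).1
    have h3 := continuous_polyFun (hγ F hF).1
    have hJg := M.continuous_orientedJump (F := F) hgc
    have hJf := M.continuous_orientedJump (F := F) hfc
    have h4 : ∫ y, α F y ^ 2 ∂faceMeasure F = ∫ y, (-γ F y + t * β F y) * α F y ∂faceMeasure F := by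
      have e1 : ∫ y, (-γ F y + t * β F y) * α F y ∂faceMeasure F =
          -(∫ y, γ F y * α F y ∂faceMeasure F) + t * ∫ y, β F y * α F y ∂faceMeasure F := by
        rw [← integral_const_mul, ← integral_neg,
          ← integral_add (hint (by fun_prop)) (hint (by fun_prop))]
        exact integral_congr_ae (Filter.Eventually.of_forall fun y => by
          change _ = -(γ F y * α F y) + t * (β F y * α F y); ring)
      have e2 : ∫ y, α F y * α F y ∂faceMeasure F =
          -(∫ y, M.orientedJump g F y * α F y ∂faceMeasure F) +
            t * ∫ y, M.orientedJump f F y * α F y ∂faceMeasure F := by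
        rw [(hα F hF).2 _ (hα F hF).1, ← integral_const_mul, ← integral_neg,
          ← integral_add (hint (by fun_prop)) (hint (by fun_prop))]
        refine integral_congr_ae (Filter.Eventually.of_forall fun y => ?_)
        change _ = -(M.orientedJump g F y * α F y) + t * (M.orientedJump f F y * α F y)
        have : M.orientedJump (fun K y => -g K y + t * f K y) F y =
            -M.orientedJump g F y + t * M.orientedJump f F y := by
          simp only [orientedJump, Finset.mul_sum, ← Finset.sum_neg_distrib,
            ← Finset.sum_add_distrib]
          exact Finset.sum_congr rfl fun K _ => by ring
        simp only [this]
        ring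
      rw [e1, (hγ F hF).2 _ (hα F hF).1, (hβ F hF).2 _ (hα F hF).1, ← e2]
      simp only [pow_two]
    refine (integral_sq_le_of_integral_sq_eq (hint (by fun_prop)) (hint (by fun_prop))
      (hint (by fun_prop)) h4).trans ?_
    rw [← integral_const_mul, ← integral_const_mul,
      ← integral_add (hint (by fun_prop)) (hint (by fun_prop))]
    refine integral_mono (hint (by fun_prop)) (hint (by fun_prop)) fun y => ?_
    change (-γ F y + t * β F y) ^ 2 ≤ 2 * γ F y ^ 2 + 2 * t ^ 2 * β F y ^ 2
    nlinarith [sq_nonneg (γ F y + t * β F y)]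
  rw [hB, hB', hB'']
  have hs1 := Finset.sum_le_sum hgrad
  have hs2 := Finset.sum_le_sum fun F (hF : F ∈ M.faces \ M.facesOn Sig) =>
    mul_le_mul_of_nonneg_left (hface F (Finset.mem_sdiff.1 hF).1) (inv_nonneg.2 M.h_nonneg)
  simp only [mul_add, Finset.sum_add_distrib, mul_left_comm M.h⁻¹, ← Finset.mul_sum] at hs1 hs2 ⊢
  linarith

end CauchyFEM

namespace CauchyFEM

/-! ### The forms -/

section L2

variable {X G : Type*} [MeasurableSpace X] [NormedAddCommGroup G] [InnerProductSpace ℝ G]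
  {ν : Measure X} {f g : X → G}

theorem integral_norm_add_smul_sq_le (hf : MemLp f 2 ν) (hg : MemLp g 2 ν) (c : ℝ) :
    ∫ y, ‖f y + c • g y‖ ^ 2 ∂ν ≤ 2 * (∫ y, ‖f y‖ ^ 2 ∂ν) + 2 * c ^ 2 * ∫ y, ‖g y‖ ^ 2 ∂ν := by
  have h1 := integrable_norm_sq_of_memLp hf
  have h2 := integrable_norm_sq_of_memLp hg
  rw [← integral_const_mul, ← integral_const_mul, ← integral_add (h1.const_mul 2)
    (h2.const_mul _)]
  refine integral_mono (integrable_norm_sq_of_memLp (hf.add (hg.const_smul c)))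
    ((h1.const_mul 2).add (h2.const_mul _)) fun y => ?_
  have h4 : ‖f y + c • g y‖ ≤ ‖f y‖ + |c| * ‖g y‖ := (norm_add_le _ _).trans (by
    rw [norm_smul, Real.norm_eq_abs])
  have h5 := pow_le_pow_left₀ (norm_nonneg _) h4 2
  have h6 : (|c| * ‖g y‖) ^ 2 = c ^ 2 * ‖g y‖ ^ 2 := by rw [mul_pow, sq_abs]
  change ‖f y + c • g y‖ ^ 2 ≤ 2 * ‖f y‖ ^ 2 + 2 * c ^ 2 * ‖g y‖ ^ 2
  nlinarith [sq_nonneg (‖f y‖ - |c| * ‖g y‖)]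

theorem mul_integral_inner_le (hf : MemLp f 2 ν) (hg : MemLp g 2 ν) (c : ℝ) :
    c * ∫ y, ⟪f y, g y⟫_ℝ ∂ν ≤
      (1 / 2) * (∫ y, ‖f y‖ ^ 2 ∂ν) + (1 / 2) * (c ^ 2 * ∫ y, ‖g y‖ ^ 2 ∂ν) := by
  have h1 := integrable_norm_sq_of_memLp hf
  have h2 := integrable_norm_sq_of_memLp hg
  rw [← integral_const_mul, ← integral_const_mul, ← integral_const_mul, ← integral_const_mul,
    ← integral_add (h1.const_mul _) ((h2.const_mul _).const_mul _)]
  refine integral_mono ((integrable_inner_of_memLp hf hg).const_mul c)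
    ((h1.const_mul _).add ((h2.const_mul _).const_mul _)) fun y => ?_
  have h3 := norm_sub_sq_real (f y) (c • g y)
  rw [real_inner_smul_right, norm_smul, mul_pow, Real.norm_eq_abs, sq_abs] at h3
  change c * ⟪f y, g y⟫_ℝ ≤ 1 / 2 * ‖f y‖ ^ 2 + 1 / 2 * (c ^ 2 * ‖g y‖ ^ 2)
  nlinarith [sq_nonneg ‖f y - c • g y‖]

theorem integral_mul_sub_ge {D w : X → ℝ} (hD : MemLp D 2 ν) (hw : MemLp w 2 ν) :
    (1 / 2) * (∫ y, D y ^ 2 ∂ν) - (1 / 2) * (∫ y, w y ^ 2 ∂ν) ≤ ∫ y, D y * (D y - w y) ∂ν := by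
  rw [← integral_const_mul, ← integral_const_mul,
    ← integral_sub (hD.integrable_sq.const_mul _) (hw.integrable_sq.const_mul _)]
  refine integral_mono ((hD.integrable_sq.const_mul _).sub (hw.integrable_sq.const_mul _))
    (hD.integrable_mul (hD.sub hw)) fun y => ?_
  change 1 / 2 * D y ^ 2 - 1 / 2 * w y ^ 2 ≤ D y * (D y - w y)
  nlinarith [sq_nonneg (D y - w y)]

end L2

namespace SimplicialMesh

variable {d : ℕ} {Ω : Set (E d)} (M : SimplicialMesh Ω)

theorem tripleNorm_sFull_sq (k m : ℕ) (A : Matrix (Fin d) (Fin d) ℝ) (μ : ℝ) {γT : ℝ}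
    (hγT : 0 ≤ γT) (v : E d → ℝ) (q : E d → E d) :
    M.tripleNorm (M.sFull k m A μ γT) μ 1 v q ^ 2 =
      (1 / 2) * (∫ y in Ω, ‖Matrix.toEuclideanLin A (weakGrad Ω v y) - q y‖ ^ 2) +
      ((1 / 2) * μ ^ 2 * M.h ^ 2 * (∫ y in Ω, (v y - M.projX m v y) ^ 2) +
        γT * M.h ^ (2 * k) * ∫ y in Ω, ‖weakGrad Ω v y‖ ^ 2) +
      M.h ^ 2 * ∫ y in Ω, (weakDiv Ω q y + μ * v y) ^ 2 := by
  have hh := M.h_nonneg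
  have h1 : M.sFull k m A μ γT v q v q =
      (1 / 2) * (∫ y in Ω, ‖Matrix.toEuclideanLin A (weakGrad Ω v y) - q y‖ ^ 2) +
      ((1 / 2) * μ ^ 2 * M.h ^ 2 * (∫ y in Ω, (v y - M.projX m v y) ^ 2) +
        γT * M.h ^ (2 * k) * ∫ y in Ω, ‖weakGrad Ω v y‖ ^ 2) := by
    simp only [sFull, fluxStab, tFull, real_inner_self_eq_norm_sq, ← pow_two]
  rw [tripleNorm, Real.sq_sqrt, h1]
  · simp only [pow_one, mul_pow, integral_const_mul]
  · rw [h1]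
    positivity

theorem memLp_of_mem_X (hΩ : IsConvexPolytopeDomain Ω) {m : ℕ} {x : E d → ℝ} (hx : x ∈ M.X m) :
    MemLp x 2 (volume.restrict Ω) ∧ MemLp (gradient x) 2 (volume.restrict Ω) := by
  choose! g hg hxg using hx
  exact ⟨M.memLp_of_eqOn hΩ hxg (fun K hK => continuous_polyFun (hg K hK)) 2,
    M.memLp_of_eqOn hΩ (fun K hK y hy => gradient_congr_of_eqOn isOpen_interior (hxg K hK) hy)
      (fun K hK => continuous_gradient (contDiff_polyFun (hg K hK))) 2⟩

theorem memLp_projVecPred (hΩ : IsConvexPolytopeDomain Ω) (l : ℕ) {f : E d → E d}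
    (hf : MemLp f 2 (volume.restrict Ω)) : MemLp (M.projVecPred l f) 2 (volume.restrict Ω) := by
  obtain ⟨⟨G, hG, hGp⟩, -⟩ := M.projVecPred_spec hΩ l hf
  exact M.memLp_of_eqOn hΩ hG (fun K hK => continuous_of_coord fun i =>
    continuous_polyFun (by simpa using hGp K hK i _ (polyFun_const (k := 1) 1))) 2

theorem neg_add_mem_X {m : ℕ} {x R : E d → ℝ} (hx : x ∈ M.X m) (hR : R ∈ M.X m) (t : ℝ) :
    (fun y => -x y + t * R y) ∈ M.X m := by
  intro K hK
  obtain ⟨g, hg, hxg⟩ := hx K hK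
  obtain ⟨f, hf, hRf⟩ := hR K hK
  refine ⟨fun y => (-1) * g y + t * f y, polyFun_add (polyFun_const_mul _ hg)
    (polyFun_const_mul _ hf), fun y hy => ?_⟩
  simp only [hxg hy, hRf hy]
  ring

theorem gradient_neg_add_ae (hΩ : IsConvexPolytopeDomain Ω) {m : ℕ} {x R : E d → ℝ}
    (hx : x ∈ M.X m) (hR : R ∈ M.X m) (t : ℝ) :
    ∀ᵐ y ∂volume.restrict Ω,
      gradient (fun y => -x y + t * R y) y = -gradient x y + t • gradient R y := by
  refine (M.ae_restrict_iff_cells hΩ).2 fun K hK => ?_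
  obtain ⟨g, hg, hxg⟩ := hx K hK
  obtain ⟨f, hf, hRf⟩ := hR K hK
  refine ae_restrict_of_forall_mem isOpen_interior.measurableSet fun y hy => ?_
  rw [gradient_congr_of_eqOn isOpen_interior hxg hy, gradient_congr_of_eqOn isOpen_interior hRf hy,
    ← gradient_neg_add_const_mul (differentiable_polyFun hg) (differentiable_polyFun hf) t]
  exact gradient_congr_of_eqOn isOpen_interior
    (fun z hz => by simp only [hxg hz, hRf hz]) hy

/-- The error $(1-\pi_{X,l-1})\nabla x$ is orthogonal to every projected field, so the projection in
the second argument can be dropped. -/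
theorem sStar_neg_add (hΩ : IsConvexPolytopeDomain Ω) (l : ℕ) {m : ℕ} (γs : ℝ) {x R : E d → ℝ}
    (hx : x ∈ M.X m) (hR : R ∈ M.X m) (t : ℝ) :
    M.sStar l γs x (fun y => -x y + t * R y) = γs / 2 *
      (-(∫ y in Ω, ‖gradient x y - M.projVecPred l (gradient x) y‖ ^ 2) +
        t * ∫ y in Ω, ⟪gradient x y - M.projVecPred l (gradient x) y, gradient R y⟫_ℝ) := by
  have hgx := (M.memLp_of_mem_X hΩ hx).2
  have hgR := (M.memLp_of_mem_X hΩ hR).2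
  have hgr := (M.memLp_of_mem_X hΩ (M.neg_add_mem_X hx hR t)).2
  obtain ⟨e, he⟩ : ∃ e, e = fun y => gradient x y - M.projVecPred l (gradient x) y := ⟨_, rfl⟩
  have heL : MemLp e 2 (volume.restrict Ω) := by
    rw [he]; exact hgx.sub (M.memLp_projVecPred hΩ l hgx)
  have horth (f : E d → E d) (hf : MemLp f 2 (volume.restrict Ω)) :
      ∫ y in Ω, ⟪e y, M.projVecPred l f y⟫_ℝ = 0 := by
    have := (M.projVecPred_spec hΩ l hgx).2 f hf
    rw [← neg_eq_zero, ← this, ← integral_neg]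
    refine integral_congr_ae (Filter.Eventually.of_forall fun y => ?_)
    simp only [he]
    rw [← inner_neg_left, neg_sub]
  have hsub (f : E d → E d) (hf : MemLp f 2 (volume.restrict Ω)) :
      ∫ y in Ω, ⟪e y, f y - M.projVecPred l f y⟫_ℝ = ∫ y in Ω, ⟪e y, f y⟫_ℝ := by
    simp only [inner_sub_right]
    rw [integral_sub (integrable_inner_of_memLp heL hf)
      (integrable_inner_of_memLp heL (M.memLp_projVecPred hΩ l hf)), horth f hf, sub_zero]
  have h1 : ∫ y in Ω, ‖e y‖ ^ 2 = ∫ y in Ω, ⟪e y, gradient x y⟫_ℝ := by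
    rw [← hsub _ hgx]
    simp only [← real_inner_self_eq_norm_sq]
    simp only [he]
  have h2 : ∫ y in Ω, ⟪e y, gradient (fun y => -x y + t * R y) y⟫_ℝ =
      -(∫ y in Ω, ⟪e y, gradient x y⟫_ℝ) + t * ∫ y in Ω, ⟪e y, gradient R y⟫_ℝ := by
    have hi := integrable_inner_of_memLp heL hgx
    have hi' := integrable_inner_of_memLp heL hgR
    rw [← integral_const_mul, ← integral_neg, ← integral_add (by exact hi.neg) (hi'.const_mul t)]
    refine integral_congr_ae ?_
    filter_upwards [M.gradient_neg_add_ae hΩ hx hR t] with y hy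
    rw [hy, inner_add_right, inner_neg_right, real_inner_smul_right]
  have h3 : ∀ y, gradient x y - M.projVecPred l (gradient x) y = e y := fun y => by rw [he]
  simp only [sStar, h3]
  rw [hsub _ hgr, h2, ← h1]
  ring

end SimplicialMesh

namespace SimplicialMesh

variable {n : ℕ} {Ω : Set (E (n + 1))} (M : SimplicialMesh Ω)

theorem setIntegral_gradient_sq_le (hΩ : IsConvexPolytopeDomain Ω) (Sig : Set (E (n + 1)))
    (l : ℕ) {m : ℕ} {x : E (n + 1) → ℝ} (hx : x ∈ M.X m) :
    ∫ y in Ω, ‖gradient x y‖ ^ 2 ≤ M.brokenH1Norm Sig l x ^ 2 := by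
  choose! g hg hxg using hx
  obtain ⟨γ, -, hB⟩ := M.brokenH1Norm_sq hΩ Sig l hxg fun K hK => continuous_polyFun (hg K hK)
  rw [hB, M.setIntegral_eq_sum_of_eqOn hΩ (w := fun K y => ‖gradient (g K) y‖ ^ 2)
    (fun K hK y hy => by simp only [gradient_congr_of_eqOn isOpen_interior (hxg K hK) hy])
    fun K hK => (continuous_gradient (contDiff_polyFun (hg K hK))).norm.pow 2]
  exact le_add_of_nonneg_right (Finset.sum_nonneg fun F _ =>
    mul_nonneg (inv_nonneg.2 M.h_nonneg) (integral_nonneg fun y => sq_nonneg _))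

/-- `weakDiv` is a choice among functions equal almost everywhere, so linearity is obtained by
comparing both sides with the classical divergence in each cell. -/
theorem weakDiv_add_smul_ae (hΩ : IsConvexPolytopeDomain Ω) {Sig : Set (E (n + 1))} {l : ℕ}
    {q η : E (n + 1) → E (n + 1)} (hq : q ∈ M.D0 Sig l) (hη : η ∈ M.D0 Sig l) (δ : ℝ) :
    ∀ᵐ y ∂volume.restrict Ω,
      weakDiv Ω (fun y => q y + δ • η y) y = weakDiv Ω q y + δ * weakDiv Ω η y := by
  have hy := (M.add_smul_mem_D0 hq hη δ).1
  obtain ⟨f, hf, hfp, -⟩ := M.exists_pieces_of_mem_RT hy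
  refine (M.ae_restrict_iff_cells hΩ).2 fun K hK => ?_
  have hfd := fun i => contDiff_polyFun (n := 1) (hfp K hK i)
  filter_upwards [M.weakDiv_eq_on_cell hΩ (weakDiv_spec hy.1) hK hfd (hf K hK),
    M.weakDiv_eq_on_cell hΩ ((weakDiv_spec hq.1.1).add_smul (weakDiv_spec hη.1.1) δ) hK hfd
      (hf K hK)] with y h1 h2
  rw [h1, h2]

/-- This is $\nabla\cdot q+\mu\pi_{X,m}v$, a member of $W^m$ because the divergence has degree $l\le
m$ on every cell. -/
theorem exists_discrete_residual (hΩ : IsConvexPolytopeDomain Ω) {Sig : Set (E (n + 1))} {l m : ℕ}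
    (hlm : l ≤ m) {q : E (n + 1) → E (n + 1)} (hq : q ∈ M.D0 Sig l) (μ : ℝ)
    {v : E (n + 1) → ℝ} (hv : MemLp v 2 (volume.restrict Ω)) :
    ∃ R ∈ M.X m, ∀ᵐ y ∂volume.restrict Ω,
      R y = (weakDiv Ω q y + μ * v y) - μ * (v y - M.projX m v y) := by
  obtain ⟨f, hf, hfp, hfd⟩ := M.exists_pieces_of_mem_RT hq.1
  have hP := M.projX_mem hΩ m hv
  -- Membership in `M.X m` asks for equality at every interior point of a cell, so the glued
  -- classical divergence stands in for `weakDiv`.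
  refine ⟨fun y => M.glue (fun K => divg (f K)) y + μ * M.projX m v y, fun K hK => ?_, ?_⟩
  · obtain ⟨p, hp, hPp⟩ := hP K hK
    refine ⟨fun y => divg (f K) y + μ * p y, polyFun_add (polyFun_mono hlm (hfd K hK))
      (polyFun_const_mul _ hp), fun y hy => ?_⟩
    simp only [M.glue_eqOn (fun K => divg (f K)) hK hy, hPp hy]
  · filter_upwards [M.weakDiv_eq_divg hΩ hq.1.1
      (fun K hK i => contDiff_polyFun (hfp K hK i)) hf] with y hy
    rw [hy]
    ring

end SimplicialMesh

end CauchyFEM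

namespace CauchyFEM

/-! ### Stability -/

/-- The absorption scheme. `B2` is $\|x\|_{1,h}^2$, `e2` the dual projection error, `Dh` the scaled
residual, `T` and `Γ` the two parts of $t$, and `S2` the flux misfit. `X1`, `P`, `Q`, `W` come from
$\eta$ and $R$. After absorption `B2` keeps at least $\frac\delta4$, `Dh` at least
$\frac\varepsilon4$, and `T`, `S2` at least $\frac14$, while the coefficient of `e2` is at least
$\frac{\gamma^*}4-\delta C\ge0$. -/
theorem stability_arith {α δ ε γs C CR B2 e2 Dh T Γ S2 X1 P Q W : ℝ} (hδ : 0 < δ) (hε : 0 < ε)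
    (hγs : 0 < γs) (hB2 : 0 ≤ B2) (he2 : 0 ≤ e2) (hDh : 0 ≤ Dh) (hT : 0 ≤ T) (hΓ : 0 ≤ Γ)
    (hS2 : 0 ≤ S2) (hX : (1 / 2) * B2 - C * e2 ≤ X1) (hP : ε * ((1 / 2) * Dh - T) ≤ P)
    (hQ : Q ≤ (1 / 2) * e2 + (1 / 2) * (ε ^ 2 * (CR * (2 * Dh + 4 * T))))
    (hW : W ≤ (1 / 2) * S2 + (1 / 2) * (δ ^ 2 * (C * B2)))
    (hδC : δ * C ≤ 1) (hδγ : 4 * (δ * C) ≤ γs) (hεC : 2 * γs * ε * CR ≤ 1) (hε2 : ε ≤ 1 / 2)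
    (h1 : α ≤ δ / 4) (h2 : α ≤ ε / 4) (h3 : α ≤ 1 / 4) :
    α * ((1 / 2) * S2 + (T + Γ) + Dh + B2) ≤
      δ * X1 + P - γs / 2 * (-e2 + Q) + ((1 / 2) * S2 - (1 / 2) * W) + (T + Γ) := by
  have a1 := mul_le_mul_of_nonneg_left hX hδ.le
  have a2 := mul_le_mul_of_nonneg_left hQ (show 0 ≤ γs / 2 by positivity)
  have a3 := mul_le_mul_of_nonneg_right hδC (mul_nonneg hδ.le hB2)
  have a4 := mul_le_mul_of_nonneg_right hδγ he2
  have a5 := mul_le_mul_of_nonneg_right hεC (mul_nonneg hε.le hDh)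
  have a6 := mul_le_mul_of_nonneg_right hεC (mul_nonneg hε.le hT)
  have a7 := mul_le_mul_of_nonneg_right h1 hB2
  have a8 := mul_le_mul_of_nonneg_right h2 hDh
  have a9 := mul_le_mul_of_nonneg_right h3 hT
  have a10 := mul_le_mul_of_nonneg_right h3 hΓ
  have a11 := mul_le_mul_of_nonneg_right h3 hS2
  have a12 := mul_le_mul_of_nonneg_right hε2 hT
  linarith

theorem add_le_of_sq_le {a b c e K : ℝ} (hc : 0 ≤ c) (he : 0 ≤ e) (hK : 1 ≤ K)
    (ha : a ^ 2 ≤ K * (c ^ 2 + e ^ 2)) (hb : b ^ 2 ≤ K * (c ^ 2 + e ^ 2)) :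
    a + b ≤ 2 * K * (c + e) := by
  have h1 : K * (c ^ 2 + e ^ 2) ≤ (K * (c + e)) ^ 2 := by
    have h2 : c ^ 2 + e ^ 2 ≤ (c + e) ^ 2 := by nlinarith [mul_nonneg hc he]
    have h3 : K ≤ K ^ 2 := by nlinarith
    rw [mul_pow]
    exact mul_le_mul h3 h2 (by positivity) (by positivity)
  have h0 : 0 ≤ K * (c + e) := by positivity
  have h4 := abs_le_of_sq_le_sq (ha.trans h1) h0
  have h5 := abs_le_of_sq_le_sq (hb.trans h1) h0
  linarith [(le_abs_self a).trans h4, (le_abs_self b).trans h5]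

/-- The choice gives $\delta C=\gamma^*/(4(1+\gamma^*))$, which is below both 1 and $\gamma^*/4$.
The factor $1+\gamma^*$ in the denominator of $\varepsilon$ compensates a large $\gamma^*$. -/
theorem exists_stability_constants {γs C CR : ℝ} (hγs : 0 < γs) (hC : 0 < C) (hCR : 0 < CR) :
    ∃ δ ε α : ℝ, 0 < δ ∧ 0 < ε ∧ 0 < α ∧ δ * C ≤ 1 ∧ 4 * (δ * C) ≤ γs ∧ 2 * γs * ε * CR ≤ 1 ∧
      ε ≤ 1 / 2 ∧ α ≤ δ / 4 ∧ α ≤ ε / 4 ∧ α ≤ 1 / 4 := by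
  have e1 : γs / (4 * C * (1 + γs)) * C = γs / (4 * (1 + γs)) := by field_simp
  refine ⟨γs / (4 * C * (1 + γs)), 1 / (2 * (1 + γs) * (1 + CR)),
    min (γs / (4 * C * (1 + γs)) / 4) (min (1 / (2 * (1 + γs) * (1 + CR)) / 4) (1 / 4)),
    by positivity, by positivity, by positivity, ?_, ?_, ?_, ?_, min_le_left _ _,
    (min_le_right _ _).trans (min_le_left _ _), (min_le_right _ _).trans (min_le_right _ _)⟩
  · rw [e1, div_le_one (by positivity)]; linarith
  · rw [e1, ← mul_div_assoc, div_le_iff₀ (by positivity)]; nlinarith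
  · rw [show 2 * γs * (1 / (2 * (1 + γs) * (1 + CR))) * CR = (γs * CR) / ((1 + γs) * (1 + CR)) by
      field_simp, div_le_one (by positivity)]
    nlinarith
  · rw [one_div, one_div]
    exact inv_anti₀ (by positivity) (by nlinarith [mul_pos hγs hCR])

/-- Keeping the primal test function equal to $v$ reproduces $t(v,v)$ exactly, so only the flux and
the multiplier have to be constructed. -/
theorem exists_stable_test (n k l m : ℕ) (hlm : l ≤ m) (σ : ℝ) {γs : ℝ} (hγs : 0 < γs) :
    ∃ α C : ℝ, 0 < α ∧ 0 < C ∧ ∀ (Ω Sig : Set (E (n + 1))), IsConvexPolytopeDomain Ω →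
      ∀ (A : Matrix (Fin (n + 1)) (Fin (n + 1)) ℝ) (μ γT : ℝ), 0 ≤ γT →
      ∀ M : SimplicialMesh Ω, M.IsRegular σ →
      ∀ v, MemH1 Ω v → ∀ q ∈ M.D0 Sig l, ∀ x ∈ M.X m,
      ∃ y ∈ M.D0 Sig l, ∃ r ∈ M.X m,
        α * (M.tripleNorm (M.sFull k m A μ γT) μ 1 v q ^ 2 + M.brokenH1Norm Sig l x ^ 2)
            ≤ M.formA k l m A μ γT γs v q x v y r ∧
        M.tripleNorm (M.sFull k m A μ γT) μ 1 v y + M.brokenH1Norm Sig l r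
            ≤ C * (M.tripleNorm (M.sFull k m A μ γT) μ 1 v q + M.brokenH1Norm Sig l x) := by
  have hρ : 0 < 1 / (σ ^ 2 + 1) := by positivity
  obtain ⟨C, hC, H⟩ := exists_test_field n l m hρ
  obtain ⟨CR, hCR, HR⟩ := exists_brokenH1Norm_sq_le n l m hρ
  obtain ⟨δ, ε, α, hδ, hε, hα, hδC, hδγ, hεC, hε2, h1, h2, h3⟩ :=
    exists_stability_constants hγs hC hCR
  -- This number bounds both squared test norms: $3\delta^2C$ collects the $\eta$ terms of flux
  -- misfit and residual, and $8\varepsilon^2C_R$ those of $R$.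
  have hK1 : 1 ≤ 2 + 3 * (δ ^ 2 * C) + 8 * (ε ^ 2 * CR) := by
    have : 0 ≤ 3 * (δ ^ 2 * C) + 8 * (ε ^ 2 * CR) := by positivity
    linarith
  refine ⟨α, 2 * (2 + 3 * (δ ^ 2 * C) + 8 * (ε ^ 2 * CR)), hα, by positivity,
    fun Ω Sig hΩ A μ γT hγT M hM v hv q hq x hx => ?_⟩
  have hreg := hM.cellReg
  obtain ⟨η, hη, hηx, hη2, hηd⟩ := H Ω Sig hΩ M hreg x hx
  have hvs := weakGrad_spec hv
  have hqs := weakDiv_spec hq.1.1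
  have hηs := weakDiv_spec hη.1.1
  obtain ⟨R, hR, hRae⟩ := M.exists_discrete_residual hΩ hlm hq μ hvs.1
  have hRB := HR Ω Sig hΩ M hreg R hR
  have hh := M.h_nonneg
  -- The weight $h^2$ produces the scaled residual in $t(D,R)$, and by the inverse estimate
  -- $t^2\|R\|_{1,h}^2$ is still only of order $\varepsilon^2h^2\|R\|^2$.
  set t := ε * M.h ^ 2 with ht
  have hyD := M.add_smul_mem_D0 hq hη δ
  have hrX := M.neg_add_mem_X hx hR t
  have hdy := M.weakDiv_add_smul_ae hΩ hq hη δ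
  have hPL : MemLp (M.projX m v) 2 (volume.restrict Ω) :=
    (M.memLp_of_mem_X hΩ (M.projX_mem hΩ m hvs.1)).1
  obtain ⟨hxL, hgxL⟩ := M.memLp_of_mem_X hΩ hx
  obtain ⟨hRL, hgRL⟩ := M.memLp_of_mem_X hΩ hR
  obtain ⟨D, hD⟩ : ∃ D, D = fun y => weakDiv Ω q y + μ * v y := ⟨_, rfl⟩
  obtain ⟨w, hw⟩ : ∃ w, w = fun y => μ * (v y - M.projX m v y) := ⟨_, rfl⟩
  obtain ⟨S, hS⟩ : ∃ S, S = fun y => Matrix.toEuclideanLin A (weakGrad Ω v y) - q y := ⟨_, rfl⟩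
  obtain ⟨e, he⟩ : ∃ e, e = fun y => gradient x y - M.projVecPred l (gradient x) y := ⟨_, rfl⟩
  have hDL : MemLp D 2 (volume.restrict Ω) := by
    rw [hD]; exact hqs.2.1.add (hvs.1.const_mul μ)
  have hwL : MemLp w 2 (volume.restrict Ω) := by
    rw [hw]; exact (hvs.1.sub hPL).const_mul μ
  have hSL : MemLp S 2 (volume.restrict Ω) := by
    rw [hS]
    exact ((Matrix.toEuclideanLin A).toContinuousLinearMap.comp_memLp' hvs.2.1).sub hqs.1
  have heL : MemLp e 2 (volume.restrict Ω) := by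
    rw [he]; exact hgxL.sub (M.memLp_projVecPred hΩ l hgxL)
  -- the terms of the form
  set X1 := ∫ y in Ω, weakDiv Ω η y * x y
  -- The term $(D,x)$ here cancels against its negative in `hb2`.
  have hb1 : bForm Ω μ (fun y => q y + δ • η y) v x = (∫ y in Ω, D y * x y) + δ * X1 := by
    have i1 : Integrable (fun y => D y * x y) (volume.restrict Ω) := hDL.integrable_mul hxL
    have i2 : Integrable (fun y => weakDiv Ω η y * x y) (volume.restrict Ω) :=
      hηs.2.1.integrable_mul hxL
    rw [← integral_const_mul, ← integral_add i1 (i2.const_mul δ)]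
    refine integral_congr_ae ?_
    filter_upwards [hdy] with y hy
    rw [hy, hD]
    ring
  have hb2 : bForm Ω μ q v (fun y => -x y + t * R y) =
      -(∫ y in Ω, D y * x y) + t * ∫ y in Ω, D y * R y := by
    have i1 : Integrable (fun y => D y * x y) (volume.restrict Ω) := hDL.integrable_mul hxL
    have i2 : Integrable (fun y => D y * R y) (volume.restrict Ω) := hDL.integrable_mul hRL
    rw [← integral_const_mul, ← integral_neg, ← integral_add (by exact i1.neg) (i2.const_mul t)]
    refine integral_congr_ae (Filter.Eventually.of_forall fun y => ?_)
    simp only [hD]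
    ring
  have hf : fluxStab Ω A v q v (fun y => q y + δ • η y) =
      (1 / 2) * (∫ y in Ω, ‖S y‖ ^ 2) - (1 / 2) * (δ * ∫ y in Ω, ⟪S y, η y⟫_ℝ) := by
    have i1 := integrable_norm_sq_of_memLp hSL
    have i2 := integrable_inner_of_memLp hSL hηs.1
    rw [← mul_sub, ← integral_const_mul, ← integral_sub i1 (i2.const_mul δ), fluxStab]
    congr 1
    refine integral_congr_ae (Filter.Eventually.of_forall fun y => ?_)
    simp only [hS]
    rw [← sub_sub, inner_sub_right, real_inner_smul_right, real_inner_self_eq_norm_sq]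
  have hT0 : M.tFull k m μ γT v v = (1 / 2) * μ ^ 2 * M.h ^ 2 * (∫ y in Ω, (v y - M.projX m v y) ^ 2) +
      γT * M.h ^ (2 * k) * ∫ y in Ω, ‖weakGrad Ω v y‖ ^ 2 := by
    simp only [SimplicialMesh.tFull, real_inner_self_eq_norm_sq, ← pow_two]
  have hstar := M.sStar_neg_add hΩ l γs hx hR t
  have hN := M.tripleNorm_sFull_sq k m A μ hγT v q
  have hNy := M.tripleNorm_sFull_sq k m A μ hγT v (fun y => q y + δ • η y)
  have hRr := M.brokenH1Norm_neg_add_sq_le hΩ Sig l hx hR t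
  -- abbreviations for the norms
  have hw2 : ∫ y in Ω, w y ^ 2 = μ ^ 2 * ∫ y in Ω, (v y - M.projX m v y) ^ 2 := by
    simp only [hw, mul_pow, integral_const_mul]
  set T := (1 / 2) * μ ^ 2 * M.h ^ 2 * (∫ y in Ω, (v y - M.projX m v y) ^ 2) with hT
  set Γ := γT * M.h ^ (2 * k) * ∫ y in Ω, ‖weakGrad Ω v y‖ ^ 2
  have hSe : ∀ y, Matrix.toEuclideanLin A (weakGrad Ω v y) - q y = S y := fun y => by rw [hS]
  have hDe : ∀ y, weakDiv Ω q y + μ * v y = D y := fun y => by rw [hD]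
  have hee : ∀ y, gradient x y - M.projVecPred l (gradient x) y = e y := fun y => by rw [he]
  simp only [hSe, hDe] at hN
  simp only [hee] at hstar hηx
  have hTn : 0 ≤ T := by positivity
  have hΓn : 0 ≤ Γ := by positivity
  have hDn : 0 ≤ M.h ^ 2 * ∫ y in Ω, D y ^ 2 := by positivity
  have hSn : 0 ≤ ∫ y in Ω, ‖S y‖ ^ 2 := by positivity
  have hen : 0 ≤ ∫ y in Ω, ‖e y‖ ^ 2 := by positivity
  have hBn : 0 ≤ M.brokenH1Norm Sig l x ^ 2 := sq_nonneg _
  have hTw : M.h ^ 2 * ∫ y in Ω, w y ^ 2 = 2 * T := by rw [hw2, hT]; ring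
  have hDR : (1 / 2) * (M.h ^ 2 * ∫ y in Ω, D y ^ 2) - T ≤ M.h ^ 2 * ∫ y in Ω, D y * R y := by
    have h4 : ∫ y in Ω, D y * R y = ∫ y in Ω, D y * (D y - w y) := by
      refine integral_congr_ae ?_
      filter_upwards [hRae] with y hy
      rw [hy, hD, hw]
    have h5 := mul_le_mul_of_nonneg_left (integral_mul_sub_ge hDL hwL) (sq_nonneg M.h)
    rw [h4]
    linarith
  have hR2 : M.h ^ 2 * ∫ y in Ω, R y ^ 2 ≤ 2 * (M.h ^ 2 * ∫ y in Ω, D y ^ 2) + 4 * T := by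
    have h4 : ∫ y in Ω, R y ^ 2 = ∫ y in Ω, ‖D y + (-1 : ℝ) • w y‖ ^ 2 := by
      refine integral_congr_ae ?_
      filter_upwards [hRae] with y hy
      rw [hy, hD, hw, Real.norm_eq_abs, sq_abs, smul_eq_mul]
      ring
    have h5 := mul_le_mul_of_nonneg_left (integral_norm_add_smul_sq_le hDL hwL (-1)) (sq_nonneg M.h)
    simp only [Real.norm_eq_abs, sq_abs] at h4 h5
    rw [h4]
    linarith
  have hBR : t ^ 2 * M.brokenH1Norm Sig l R ^ 2 ≤
      ε ^ 2 * (CR * (2 * (M.h ^ 2 * ∫ y in Ω, D y ^ 2) + 4 * T)) := by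
    calc t ^ 2 * M.brokenH1Norm Sig l R ^ 2
        = ε ^ 2 * (M.h ^ 2 * (M.h ^ 2 * M.brokenH1Norm Sig l R ^ 2)) := by rw [ht]; ring
      _ ≤ ε ^ 2 * (M.h ^ 2 * (CR * ∫ y in Ω, R y ^ 2)) := by gcongr
      _ = ε ^ 2 * (CR * (M.h ^ 2 * ∫ y in Ω, R y ^ 2)) := by ring
      _ ≤ _ := by gcongr
  have hQ : t * ∫ y in Ω, ⟪e y, gradient R y⟫_ℝ ≤ (1 / 2) * (∫ y in Ω, ‖e y‖ ^ 2) +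
      (1 / 2) * (ε ^ 2 * (CR * (2 * (M.h ^ 2 * ∫ y in Ω, D y ^ 2) + 4 * T))) := by
    refine (mul_integral_inner_le heL hgRL t).trans ?_
    have := mul_le_mul_of_nonneg_left (M.setIntegral_gradient_sq_le hΩ Sig l hR) (sq_nonneg t)
    linarith
  have hW : δ * ∫ y in Ω, ⟪S y, η y⟫_ℝ ≤ (1 / 2) * (∫ y in Ω, ‖S y‖ ^ 2) +
      (1 / 2) * (δ ^ 2 * (C * M.brokenH1Norm Sig l x ^ 2)) := by
    refine (mul_integral_inner_le hSL hηs.1 δ).trans ?_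
    gcongr
  refine ⟨fun y => q y + δ • η y, hyD, fun y => -x y + t * R y, hrX, ?_, ?_⟩
  · have hP : ε * ((1 / 2) * (M.h ^ 2 * ∫ y in Ω, D y ^ 2) - T) ≤ t * ∫ y in Ω, D y * R y := by
      refine (mul_le_mul_of_nonneg_left hDR hε.le).trans (le_of_eq ?_)
      rw [ht]; ring
    have key := stability_arith hδ hε hγs hBn hen hDn hTn hΓn hSn hηx hP hQ hW hδC hδγ hεC hε2
      h1 h2 h3
    rw [hN, SimplicialMesh.formA, hb1, hb2, SimplicialMesh.sFull, hf, hT0, hstar]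
    linarith
  · refine add_le_of_sq_le (Real.sqrt_nonneg _) (Real.sqrt_nonneg _) hK1 ?_ ?_
    · have hS' : ∫ y in Ω, ‖Matrix.toEuclideanLin A (weakGrad Ω v y) - (q y + δ • η y)‖ ^ 2 ≤
          2 * (∫ y in Ω, ‖S y‖ ^ 2) + 2 * (δ ^ 2 * (C * M.brokenH1Norm Sig l x ^ 2)) := by
        have h4 := integral_norm_add_smul_sq_le hSL hηs.1 (-δ)
        have h5 : ∀ y, Matrix.toEuclideanLin A (weakGrad Ω v y) - (q y + δ • η y) =
            S y + (-δ) • η y := fun y => by rw [hS]; module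
        simp only [h5]
        refine h4.trans ?_
        have := mul_le_mul_of_nonneg_left hη2 (sq_nonneg δ)
        linarith
      have hD' : M.h ^ 2 * ∫ y in Ω, (weakDiv Ω (fun y => q y + δ • η y) y + μ * v y) ^ 2 ≤
          2 * (M.h ^ 2 * ∫ y in Ω, D y ^ 2) + 2 * (δ ^ 2 * (C * M.brokenH1Norm Sig l x ^ 2)) := by
        have h4 := integral_norm_add_smul_sq_le hDL hηs.2.1 δ
        have h5 : ∫ y in Ω, (weakDiv Ω (fun y => q y + δ • η y) y + μ * v y) ^ 2 =
            ∫ y in Ω, ‖D y + δ • weakDiv Ω η y‖ ^ 2 := by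
          refine integral_congr_ae ?_
          filter_upwards [hdy] with y hy
          rw [hy, hD, Real.norm_eq_abs, sq_abs, smul_eq_mul]
          ring
        simp only [Real.norm_eq_abs, sq_abs] at h4 h5
        rw [h5]
        have h6 := mul_le_mul_of_nonneg_left h4 (sq_nonneg M.h)
        have h7 := mul_le_mul_of_nonneg_left hηd (sq_nonneg δ)
        linarith
      rw [hNy, hN]
      have h8 : 0 ≤ 3 * (δ ^ 2 * C) + 8 * (ε ^ 2 * CR) := by positivity
      have h9 := mul_nonneg h8 (show 0 ≤ (1 / 2) * (∫ y in Ω, ‖S y‖ ^ 2) + (T + Γ) +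
        M.h ^ 2 * ∫ y in Ω, D y ^ 2 by positivity)
      have h10 : 0 ≤ (2 + 8 * (ε ^ 2 * CR)) * M.brokenH1Norm Sig l x ^ 2 := by positivity
      linarith
    · refine hRr.trans ?_
      rw [hN]
      have h8 : 0 ≤ (2 + 3 * (δ ^ 2 * C)) * ((1 / 2) * (∫ y in Ω, ‖S y‖ ^ 2) + (T + Γ) +
        M.h ^ 2 * ∫ y in Ω, D y ^ 2) := by positivity
      have h9 : 0 ≤ (8 * (ε ^ 2 * CR)) * ((1 / 2) * (∫ y in Ω, ‖S y‖ ^ 2) + Γ) := by positivity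
      have h10 : 0 ≤ (3 * (δ ^ 2 * C) + 8 * (ε ^ 2 * CR)) * M.brokenH1Norm Sig l x ^ 2 := by
        positivity
      have h11 : 0 ≤ (ε ^ 2 * CR) * (M.h ^ 2 * ∫ y in Ω, D y ^ 2) := by positivity
      linarith

theorem SimplicialMesh.tripleNorm_sRed_sq {d : ℕ} {Ω : Set (E d)} (M : SimplicialMesh Ω) (k : ℕ)
    (A : Matrix (Fin d) (Fin d) ℝ) (μ : ℝ) {γT : ℝ} (hγT : 0 ≤ γT) (v : E d → ℝ) (q : E d → E d) :
    M.tripleNorm (M.sRed k A γT) μ 0 v q ^ 2 = M.formAR k A μ γT v q v q := by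
  have hh := M.h_nonneg
  have hs : 0 ≤ M.sRed k A γT v q v q := by
    simp only [sRed, fluxStab, tRed, real_inner_self_eq_norm_sq]
    positivity
  have hI : ∫ y in Ω, (M.h ^ 0 * (weakDiv Ω q y + μ * v y)) ^ 2 =
      ∫ y in Ω, (weakDiv Ω q y + μ * v y) * (weakDiv Ω q y + μ * v y) := by
    simp only [pow_zero, one_mul, pow_two]
  rw [tripleNorm, Real.sq_sqrt (add_nonneg hs (integral_nonneg fun y => sq_nonneg _)), hI, formAR,
    add_comm]

end CauchyFEM

/-! ### Stability of the full method and the norm identity of the reduced method -/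

theorem mainTheorem2 (d : ℕ) (hd : d = 2 ∨ d = 3) :
    (∀ k l m : ℕ, 1 ≤ k → k - 1 ≤ l → l ≤ m → m ≤ k → ∀ σ : ℝ,
      ∃ γ₀ : ℝ, 0 < γ₀ ∧ ∀ γs : ℝ, 0 < γs → (l < m → γs < γ₀) →
        ∃ α C : ℝ, 0 < α ∧ 0 < C ∧
          ∀ (Ω Sig : Set (CauchyFEM.E d)), CauchyFEM.IsConvexPolytopeDomain Ω →
            Sig ⊆ frontier Ω →
            ∀ (A : Matrix (Fin d) (Fin d) ℝ) (μ γT : ℝ), A.PosDef → 0 ≤ γT →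
            ∀ M : CauchyFEM.SimplicialMesh Ω, M.IsRegular σ → M.Fits Sig →
            ∀ v ∈ M.V0 Sig k, ∀ q ∈ M.D0 Sig l, ∀ x ∈ M.X m,
            ∃ w ∈ M.V0 Sig k, ∃ y ∈ M.D0 Sig l, ∃ r ∈ M.X m,
              α * (M.tripleNorm (M.sFull k m A μ γT) μ 1 v q ^ 2 + M.brokenH1Norm Sig l x ^ 2)
                  ≤ M.formA k l m A μ γT γs v q x w y r ∧
              M.tripleNorm (M.sFull k m A μ γT) μ 1 w y + M.brokenH1Norm Sig l r
                  ≤ C * (M.tripleNorm (M.sFull k m A μ γT) μ 1 v q + M.brokenH1Norm Sig l x)) ∧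
    (∀ (k : ℕ) (Ω : Set (CauchyFEM.E d)), 1 ≤ k → CauchyFEM.IsConvexPolytopeDomain Ω →
      ∀ (A : Matrix (Fin d) (Fin d) ℝ) (μ γT : ℝ), A.PosDef → 0 ≤ γT →
      ∀ (M : CauchyFEM.SimplicialMesh Ω) (v : CauchyFEM.E d → ℝ)
        (q : CauchyFEM.E d → CauchyFEM.E d), CauchyFEM.MemH1 Ω v → CauchyFEM.MemHdiv Ω q →
        M.tripleNorm (M.sRed k A γT) μ 0 v q ^ 2 = M.formAR k A μ γT v q v q) := by
  -- Here $n$ is the dimension of the faces.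
  obtain ⟨n, rfl⟩ : ∃ n, d = n + 1 := by
    rcases hd with rfl | rfl
    · exact ⟨1, rfl⟩
    · exact ⟨2, rfl⟩
  -- The value 1 for $\gamma_0$ is arbitrary, because $\delta$ and $\varepsilon$ adapt to
  -- $\gamma^*$.
  refine ⟨fun k l m _ _ hlm _ σ => ⟨1, one_pos, fun γs hγs _ => ?_⟩,
    fun k Ω _ _ A μ γT _ hγT M v q _ _ => M.tripleNorm_sRed_sq k A μ hγT v q⟩
  obtain ⟨α, C, hα, hC, H⟩ := CauchyFEM.exists_stable_test n k l m hlm σ hγs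
  refine ⟨α, C, hα, hC, fun Ω Sig hΩ _ A μ γT _ hγT M hM _ v hv q hq x hx => ?_⟩
  obtain ⟨y, hy, r, hr, h⟩ := H Ω Sig hΩ A μ γT hγT M hM v hv.1.1 q hq x hx
  exact ⟨v, hv, y, hy, r, hr, h⟩
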